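/- Let $\mathbb K=\mathbb Q(q,t)$ and let $n\ge 1$. Let $\Lambda=\mathbb K[p_1,p_2,\dots]$ be the ring of symmetric functions and let $\Lambda^{(n)}$ be the ring of multi-symmetric functions in $n$ infinite alphabets $x^{(1)},\dots,x^{(n)}$, that is, the polynomial ring over $\mathbb K$ in the power sums $p_r(x^{(i)})$; write $X^{(i)}=x^{(i)}_1+x^{(i)}_2+\cdots$. Plethysm: for $Z\in\Lambda^{(n)}$, $p_r[Z]$ is obtained from $Z$ by $q\mapsto q^r$, $t\mapsto t^r$ and $x^{(i)}_k\mapsto (x^{(i)}_k)^r$, and $f\mapsto f[Z]$ is the $\mathbb K$-algebra homomorphism $\Lambda\to\Lambda^{(n)}$ with $p_r\mapsto p_r[Z]$. Macdonald polynomials: $\{P_\lambda^{(q,t)}\}_\lambda$ is the unique basis of $\Lambda$ such that $P_\lambda^{(q,t)}=m_\lambda+{}$(a combination of the $m_\mu$ with $\mu<\lambda$ in the dominance order on partitions of the same degree) and such that $P_\lambda^{(q,t)}$ and $P_\mu^{(q,t)}$ are orthogonal for $\lambda\ne\mu$ with respect to the bilinear form $\langle p_\lambda,p_\mu\rangle=\delta_{\lambda\mu}\,z_\lambda\prod_{i=1}^{\ell(\lambda)}\frac{1-q^{\lambda_i}}{1-t^{\lambda_i}}$,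 where $z_\lambda=\prod_{i\ge1} i^{m_i}m_i!$ and $m_i$ is the number of parts of $\lambda$ equal to $i$. Put $c_\lambda(q,t)=\prod_{s\in\lambda}(1-q^{a(s)}t^{l(s)+1})$, with $a(s)$, $l(s)$ the arm- and leg-length of the cell $s$, and let $J_\lambda^{(q,t)}=c_\lambda(q,t)P_\lambda^{(q,t)}$ and $H_\lambda^{(q,t)}=J_\lambda^{(q,t)}\left[\frac{X}{1-t}\right]$ (that is, $p_r\mapsto p_r/(1-t^r)$). The same notions are used with the parameters $(q,t)$ replaced by other pairs of monomials in $q,t$; in particular $H_\lambda^{(a,b)}$ is obtained from $J_\lambda^{(a,b)}$ by $p_r\mapsto p_r/(1-b^r)$. Multi-Macdonald polynomials: for a multi-partition ${\pmb\lambda}=(\lambda^{(1)},\dots,\lambda^{(n)})$ put $m_{\pmb\lambda}=\prod_{i} m_{\lambda^{(i)}}(x^{(i)})$ and $p_{\pmb\lambda}=\prod_i p_{\lambda^{(i)}}[X^{(1)}+\cdots+X^{(i)}]$. For multi-partitions of the same total degree, ${\pmb\mu}\le{\pmb\lambda}$ means that $$\sum_{i<k}|\mu^{(i)}|+\mu^{(k)}_1+\cdots+\mu^{(k)}_j\le\sum_{i<k}|\lambda^{(i)}|+\lambda^{(k)}_1+\cdots+\lambda^{(k)}_j\quad\text{for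 all } j \text{ and } k.$$ Then $\{P_{\pmb\lambda}^{(q,t)}\}_{\pmb\lambda}$ is the unique basis of $\Lambda^{(n)}$ such that $P_{\pmb\lambda}^{(q,t)}=m_{\pmb\lambda}+{}$(a combination of the $m_{\pmb\mu}$ with ${\pmb\mu}<{\pmb\lambda}$) and such that $P_{\pmb\lambda}^{(q,t)}$ and $P_{\pmb\mu}^{(q,t)}$ are orthogonal for ${\pmb\lambda}\ne{\pmb\mu}$ with respect to the bilinear form $$\langle p_{\pmb\lambda},p_{\pmb\mu}\rangle=\delta_{{\pmb\lambda}{\pmb\mu}}\;q^{\sum_{i=1}^n (n-i)|\lambda^{(i)}|}\;z_{\lambda^{(1)}}\cdots z_{\lambda^{(n)}}\prod_{i=1}^{\ell(\lambda^{(n)})}\frac{1-q^{\lambda^{(n)}_i}}{1-t^{\lambda^{(n)}_i}}.$$ Put $$J_{\pmb\lambda}^{(q,t)}=c_{\lambda^{(1)}}(q,q^{n-1}t)\,c_{\lambda^{(2)}}(q^{n-1}t,q^{n-2}t)\cdots c_{\lambda^{(n)}}(qt,t)\;P_{\pmb\lambda}^{(q,t)},\qquad H_{\pmb\lambda}^{(q,t)}=\phi\bigl(J_{\pmb\lambda}^{(q,t)}\bigr),$$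 where $\phi$ is the plethystic substitution with $X^{(i)}\mapsto X^{(i)}$ for $1\le i\le n-1$ and $X^{(1)}+\cdots+X^{(n)}\mapsto\frac{X^{(1)}+\cdots+X^{(n)}}{1-t}$. Proposition. For $0\le i\le n-1$ let $$Z_i=q^it\left(X^{(1)}+\cdots+X^{(n-i-1)}\right)+X^{(n-i)}+qX^{(n-i+1)}+\cdots+q^iX^{(n)}.$$ Then, for every multi-partition ${\pmb\lambda}=(\lambda^{(1)},\dots,\lambda^{(n)})$, $$H_{\pmb\lambda}^{(q,t)}(x^{(1)},\dots,x^{(n)})=H_{\lambda^{(1)}}^{(q,q^{n-1}t)}[Z_{n-1}]\;H_{\lambda^{(2)}}^{(q^{n-1}t,q^{n-2}t)}[Z_{n-2}]\cdots H_{\lambda^{(n)}}^{(qt,t)}[Z_0],$$ where the first factor has the parameters $(q,q^{n-1}t)$ and, for $2\le k\le n$, the $k$-th factor is $H_{\lambda^{(k)}}^{(q^{n-k+1}t,\,q^{n-k}t)}[Z_{n-k}]$; for $n=1$ there is only the first factor. -/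

import Mathlib

open scoped Nat

namespace MultiMacdonald

noncomputable section

/-! ### The ground field and the rings of symmetric functions -/

/-- The field `ℚ(q,t)`. -/
abbrev Kqt : Type := FractionRing (MvPolynomial (Fin 2) ℚ)

/-- The indeterminate `q` of `ℚ(q,t)`. -/
def q : Kqt := algebraMap (MvPolynomial (Fin 2) ℚ) Kqt (MvPolynomial.X 0)

/-- The indeterminate `t` of `ℚ(q,t)`. -/
def t : Kqt := algebraMap (MvPolynomial (Fin 2) ℚ) Kqt (MvPolynomial.X 1)

/-- The ring of symmetric functions `Λ = ℚ(q,t)[p₁, p₂, …]`; the variable `X r` is the power sum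
`p_r(x)`. -/
abbrev Sym : Type := MvPolynomial ℕ+ Kqt

/-- The ring of multi-symmetric functions in the `n` alphabets `x^{(1)}, …, x^{(n)}`; the variable
`X (i, r)` is the power sum `p_r(x^{(i+1)})` (the alphabets are numbered from `0` in the code). -/
abbrev MSym (n : ℕ) : Type := MvPolynomial (Fin n × ℕ+) Kqt

/-! ### Plethysm -/

/-- The substitution `q ↦ q^r`, `t ↦ t^r` on `ℚ(q,t)`. -/
def adamsK (r : ℕ+) : Kqt →+* Kqt :=
  IsFractionRing.map (A := MvPolynomial (Fin 2) ℚ) (B := MvPolynomial (Fin 2) ℚ)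
    (j := (MvPolynomial.expand (R := ℚ) (σ := Fin 2) (r : ℕ)).toRingHom)
    (MvPolynomial.expand_injective r.pos)

/-- The action `Z ↦ p_r[Z]` of the power sum `p_r`: it raises `q`, `t` and every variable of every
alphabet to the power `r`, so that it sends `p_k(x^{(i)})` to `p_{rk}(x^{(i)})`. -/
def adams {n : ℕ} (r : ℕ+) : MSym n →+* MSym n :=
  MvPolynomial.eval₂Hom (MvPolynomial.C.comp (adamsK r)) (fun v => MvPolynomial.X (v.1, r * v.2))

/-- The alphabet `X^{(i+1)} = x^{(i+1)}_1 + x^{(i+1)}_2 + ⋯`, that is, `p_1(x^{(i+1)})`. -/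
def alphabet {n : ℕ} (i : Fin n) : MSym n := MvPolynomial.X (i, 1)

/-- The plethysm `f[Z]`: the `ℚ(q,t)`-algebra map in `f` that sends `p_r` to `p_r[Z]`. -/
def pleth {n : ℕ} (f : Sym) (Z : MSym n) : MSym n :=
  MvPolynomial.aeval (fun r => adams r Z) f

/-- The substitution of the alphabet `Y i` for `X^{(i+1)}` for all `i` at once: the
`ℚ(q,t)`-algebra map that sends `p_r(x^{(i+1)})` to `p_r[Y i]`. -/
def multiPleth {n : ℕ} (Y : Fin n → MSym n) : MSym n →ₐ[Kqt] MSym n :=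
  MvPolynomial.aeval (fun v => adams v.2 (Y v.1))

/-! ### Partitions

Partitions are Young diagrams: `lam.rowLen i` is the `(i+1)`-st part of `lam`, `lam.colLen j` is
the `(j+1)`-st part of its conjugate, `lam.rowLens` is the list of its nonzero parts and
`lam.card` is its degree. -/

/-- The multiset of the (nonzero) parts of a partition. -/
def parts (lam : YoungDiagram) : Multiset ℕ+ := (lam.rowLens : Multiset ℕ).map Nat.toPNat'

theorem map_parts (lam : YoungDiagram) :
    (parts lam).map (fun r : ℕ+ => (r : ℕ)) = (lam.rowLens : Multiset ℕ) := by
  rw [parts, Multiset.map_map]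
  conv_rhs => rw [← Multiset.map_id (lam.rowLens : Multiset ℕ)]
  refine Multiset.map_congr rfl fun x hx => ?_
  have := lam.pos_of_mem_rowLens x (by simpa using hx)
  simp [Nat.toPNat'_coe, this]

theorem parts_bijective : Function.Bijective parts := by
  constructor
  · intro lam mu h
    have h1 : (lam.rowLens : Multiset ℕ) = mu.rowLens := by
      rw [← map_parts, ← map_parts, h]
    apply YoungDiagram.equivListRowLens.injective
    apply Subtype.ext
    exact (Multiset.coe_eq_coe.1 h1).eq_of_pairwise
      (fun a b _ _ h1 h2 => le_antisymm h2 h1)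
      lam.rowLens_sorted.pairwise mu.rowLens_sorted.pairwise
  · intro s
    set l : List ℕ := (s.map (fun r : ℕ+ => (r : ℕ))).sort (· ≥ ·) with hl
    have hs : l.SortedGE := (Multiset.pairwise_sort _ _).sortedGE
    have hp : ∀ x ∈ l, 0 < x := by
      intro x hx
      rw [hl, Multiset.mem_sort, Multiset.mem_map] at hx
      obtain ⟨r, -, rfl⟩ := hx
      exact r.pos
    refine ⟨YoungDiagram.ofRowLens l hs, ?_⟩
    rw [parts, YoungDiagram.rowLens_ofRowLens_eq_self hp, hl, Multiset.sort_eq, Multiset.map_map]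
    conv_rhs => rw [← Multiset.map_id s]
    refine Multiset.map_congr rfl fun x _ => ?_
    simp

/-- A partition is determined by the multiplicities of its parts. -/
def partitionEquiv : YoungDiagram ≃ (ℕ+ →₀ ℕ) :=
  (Equiv.ofBijective parts parts_bijective).trans Multiset.toFinsupp.toEquiv

/-- `z_λ = ∏_i i^{m_i} m_i!`, where `m_i` is the number of parts of `λ` equal to `i`. -/
def zee (lam : YoungDiagram) : ℕ :=
  ∏ r ∈ (parts lam).toFinset, (r : ℕ) ^ (parts lam).count r * ((parts lam).count r)!

/-- `∏_i (1 - a^{λ_i}) / (1 - b^{λ_i})`, over the nonzero parts of `λ`. -/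
def zeeFactor (a b : Kqt) (lam : YoungDiagram) : Kqt :=
  ((parts lam).map (fun r : ℕ+ => (1 - a ^ (r : ℕ)) / (1 - b ^ (r : ℕ)))).prod

/-- `μ < λ` in the dominance ordering of partitions of the same degree. -/
def DomLT (mu lam : YoungDiagram) : Prop :=
  mu ≠ lam ∧ mu.card = lam.card ∧
    ∀ k : ℕ, ∑ i ∈ Finset.range k, mu.rowLen i ≤ ∑ i ∈ Finset.range k, lam.rowLen i

/-- `μ < λ` in the dominance ordering of multi-partitions of the same total degree. -/
def MultiDomLT {n : ℕ} (mu lam : Fin n → YoungDiagram) : Prop :=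
  mu ≠ lam ∧ ∑ i, (mu i).card = ∑ i, (lam i).card ∧
    ∀ (k : Fin n) (j : ℕ),
      ∑ i ∈ Finset.Iio k, (mu i).card + ∑ l ∈ Finset.range j, (mu k).rowLen l ≤
        ∑ i ∈ Finset.Iio k, (lam i).card + ∑ l ∈ Finset.range j, (lam k).rowLen l

/-! ### Symmetric functions as power series in the variables

`S` is the set of those variables that form the alphabet. -/

open Classical in
/-- The power sum `p_r = ∑_{v ∈ S} v^r` as a power series. -/
def psumSeries {σ : Type} (S : Set σ) (r : ℕ+) : MvPowerSeries σ Kqt :=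
  fun α => if ∃ v ∈ S, α = Finsupp.single v (r : ℕ) then 1 else 0

open Classical in
/-- The monomial symmetric function `m_λ` in the variables of `S` as a power series: the sum of
all monomials in these variables whose nonzero exponents are the parts of `λ` in some order. -/
def monoSeries {σ : Type} (S : Set σ) (lam : YoungDiagram) : MvPowerSeries σ Kqt :=
  fun α => if (∀ v ∈ α.support, v ∈ S) ∧
    α.support.val.map α = (lam.rowLens : Multiset ℕ) then 1 else 0

/-- A symmetric function as a power series in `x_1, x_2, …`. -/
def toSeries : Sym →ₐ[Kqt] MvPowerSeries ℕ Kqt :=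
  MvPolynomial.aeval (fun r => psumSeries Set.univ r)

/-- A multi-symmetric function as a power series in the variables `x^{(i)}_k`. -/
def toMultiSeries {n : ℕ} : MSym n →ₐ[Kqt] MvPowerSeries (Fin n × ℕ) Kqt :=
  MvPolynomial.aeval (fun v => psumSeries {w | w.1 = v.1} v.2)

/-- `m_λ(x^{(1)}, …, x^{(n)}) = m_{λ^{(1)}}(x^{(1)}) ⋯ m_{λ^{(n)}}(x^{(n)})`. -/
def multiMonoSeries {n : ℕ} (lam : Fin n → YoungDiagram) : MvPowerSeries (Fin n × ℕ) Kqt :=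
  ∏ i, monoSeries {w | w.1 = i} (lam i)

/-! ### Power-sum bases and scalar products -/

/-- The power-sum symmetric function `p_λ = ∏_i p_{λ_i}`. -/
def powerSum (lam : YoungDiagram) : Sym := ((parts lam).map MvPolynomial.X).prod

/-- The basis of the power sums `p_λ` (see `powerSumBasis_apply`). -/
def powerSumBasis : Module.Basis YoungDiagram Kqt Sym :=
  (MvPolynomial.basisMonomials ℕ+ Kqt).reindex partitionEquiv.symm

theorem monomial_toFinsupp {σ : Type} [DecidableEq σ] (s : Multiset σ) :
    MvPolynomial.monomial (Multiset.toFinsupp s) (1 : Kqt) = (s.map MvPolynomial.X).prod := by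
  induction s using Multiset.induction_on with
  | empty => simp
  | cons a s ih =>
    rw [← Multiset.singleton_add, map_add, ← one_mul (1 : Kqt), ← MvPolynomial.monomial_mul, ih]
    simp [MvPolynomial.X, Multiset.toFinsupp_singleton]

theorem powerSumBasis_apply (lam : YoungDiagram) : powerSumBasis lam = powerSum lam := by
  rw [powerSumBasis, Module.Basis.reindex_apply, MvPolynomial.coe_basisMonomials, powerSum,
    ← monomial_toFinsupp]
  rfl

/-- The Macdonald scalar product with parameters `(a, b)`: the bilinear form with
`⟨p_λ, p_μ⟩ = δ_{λμ} z_λ ∏_i (1 - a^{λ_i}) / (1 - b^{λ_i})`. -/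
def scalarProduct (a b : Kqt) (f g : Sym) : Kqt :=
  (powerSumBasis.repr f).sum fun lam c => c * powerSumBasis.repr g lam * (zee lam * zeeFactor a b lam)

/-- The alphabet `X^{(1)} + ⋯ + X^{(i+1)}`. -/
def partialAlphabet {n : ℕ} (i : Fin n) : MSym n := ∑ j ∈ Finset.Iic i, alphabet j

/-- `p_λ(x^{(1)}, …, x^{(n)}) = p_{λ^{(1)}}[X^{(1)}] p_{λ^{(2)}}[X^{(1)} + X^{(2)}] ⋯
p_{λ^{(n)}}[X^{(1)} + ⋯ + X^{(n)}]`. -/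
def multiPowerSum {n : ℕ} (lam : Fin n → YoungDiagram) : MSym n :=
  ∏ i, pleth (powerSum (lam i)) (partialAlphabet i)

theorem adams_alphabet {n : ℕ} (r : ℕ+) (i : Fin n) :
    adams r (alphabet i) = MvPolynomial.X (i, r) := by
  simp [adams, alphabet]

/-- The previous alphabet, or `0` for the first one. -/
def prevVar {n : ℕ} (i : Fin n) (r : ℕ+) : MSym n :=
  if h : (i : ℕ) = 0 then 0 else MvPolynomial.X (⟨i - 1, by omega⟩, r)

theorem Iic_succ_sum {n : ℕ} {M : Type*} [AddCommMonoid M] (f : Fin n → M) (i : Fin n)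
    (h : (i : ℕ) ≠ 0) :
    ∑ j ∈ Finset.Iic i, f j = ∑ j ∈ Finset.Iic (⟨i - 1, by omega⟩ : Fin n), f j + f i := by
  have : Finset.Iic i = insert i (Finset.Iic (⟨i - 1, by omega⟩ : Fin n)) := by
    ext j
    simp only [Finset.mem_Iic, Finset.mem_insert, Fin.le_def, Fin.ext_iff]
    omega
  rw [this, Finset.sum_insert, add_comm]
  simp only [Finset.mem_Iic, Fin.le_def]
  omega

/-- The change of variables `p_r(x^{(i)}) ↦ p_r[X^{(1)} + ⋯ + X^{(i)}]` is invertible. -/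
def partialEquiv (n : ℕ) : MSym n ≃ₐ[Kqt] MSym n :=
  AlgEquiv.ofAlgHom (multiPleth partialAlphabet)
    (MvPolynomial.aeval (fun v => MvPolynomial.X v - prevVar v.1 v.2))
    (by
      refine MvPolynomial.algHom_ext fun v => ?_
      obtain ⟨i, r⟩ := v
      by_cases h : (i : ℕ) = 0
      · have h1 : Finset.Iic i = {i} := by
          ext j
          simp only [Finset.mem_Iic, Finset.mem_singleton, Fin.le_def, Fin.ext_iff]
          omega
        simp [multiPleth, prevVar, h, partialAlphabet, h1, adams_alphabet]
      · simp [multiPleth, prevVar, h, partialAlphabet, Iic_succ_sum _ i h, adams_alphabet])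
    (by
      refine MvPolynomial.algHom_ext fun v => ?_
      obtain ⟨i, r⟩ := v
      obtain ⟨i, hi⟩ := i
      induction i with
      | zero =>
        have h1 : Finset.Iic (⟨0, hi⟩ : Fin n) = {⟨0, hi⟩} := by
          ext j
          simp only [Finset.mem_Iic, Finset.mem_singleton, Fin.le_def, Fin.ext_iff]
          omega
        simp [multiPleth, prevVar, partialAlphabet, h1, adams_alphabet]
      | succ k ih =>
        have := ih (by omega)
        simp only [multiPleth, partialAlphabet, AlgHom.comp_apply, MvPolynomial.aeval_X, map_sum,
          adams_alphabet, AlgHom.id_apply] at this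
        simp only [multiPleth, partialAlphabet, AlgHom.comp_apply, MvPolynomial.aeval_X, map_sum,
          adams_alphabet, AlgHom.id_apply]
        rw [Iic_succ_sum _ (⟨k + 1, hi⟩ : Fin n) (by simp)]
        simp only [Nat.add_sub_cancel]
        rw [this]
        simp [prevVar])

/-- A multi-partition is determined by the multiplicities of its parts. -/
def multiPartitionEquiv (n : ℕ) : (Fin n → YoungDiagram) ≃ (Fin n × ℕ+ →₀ ℕ) :=
  ((Equiv.piCongrRight fun _ => partitionEquiv).trans Finsupp.equivFunOnFinite.symm).trans
    Finsupp.curryEquiv.symm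

/-- The basis of the multi-power sums `p_λ` (see `multiPowerSumBasis_apply`). -/
def multiPowerSumBasis (n : ℕ) : Module.Basis (Fin n → YoungDiagram) Kqt (MSym n) :=
  ((MvPolynomial.basisMonomials (Fin n × ℕ+) Kqt).reindex (multiPartitionEquiv n).symm).map
    (partialEquiv n).toLinearEquiv

theorem multiPartitionEquiv_eq {n : ℕ} (lam : Fin n → YoungDiagram) :
    multiPartitionEquiv n lam =
      ∑ i, Multiset.toFinsupp ((parts (lam i)).map fun r => (i, r)) := by
  classical
  ext ⟨i, r⟩
  have h : ∀ j, Multiset.count (i, r) ((parts (lam j)).map fun r => (j, r)) =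
      if j = i then (parts (lam i)).count r else 0 := by
    intro j
    split_ifs with hj
    · subst hj
      exact Multiset.count_map_eq_count' (fun r => (j, r)) _ (fun a b h => by simpa using h) r
    · rw [Multiset.count_eq_zero]
      simp [hj]
  simp [Finsupp.finsetSum_apply, h, multiPartitionEquiv, partitionEquiv]

theorem multiPowerSumBasis_apply {n : ℕ} (lam : Fin n → YoungDiagram) :
    multiPowerSumBasis n lam = multiPowerSum lam := by
  rw [multiPowerSumBasis, Module.Basis.map_apply, Module.Basis.reindex_apply,
    MvPolynomial.coe_basisMonomials, Equiv.symm_symm, multiPartitionEquiv_eq]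
  have h : MvPolynomial.monomial (∑ i, Multiset.toFinsupp ((parts (lam i)).map fun r => (i, r)))
      (1 : Kqt) = ∏ i, ((parts (lam i)).map fun r => MvPolynomial.X (i, r)).prod := by
    rw [MvPolynomial.monomial_sum_one]
    refine Finset.prod_congr rfl fun i _ => ?_
    rw [monomial_toFinsupp, Multiset.map_map]
    rfl
  change (partialEquiv n) (MvPolynomial.monomial _ (1 : Kqt)) = _
  rw [h, multiPowerSum, map_prod]
  refine Finset.prod_congr rfl fun i _ => ?_
  rw [map_multiset_prod, pleth, powerSum, map_multiset_prod, Multiset.map_map, Multiset.map_map]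
  simp [partialEquiv, multiPleth, Function.comp_def]

/-- `z_λ(a,b) = a^{(n-1)|λ̄| - n(λ̄)} z_{λ^{(1)}} ⋯ z_{λ^{(n)}}
∏_i (1 - a^{λ^{(n)}_i}) / (1 - b^{λ^{(n)}_i})`, where `|λ̄| = ∑_i |λ^{(i)}|` and
`n(λ̄) = ∑_i (i - 1) |λ^{(i)}|`. The last product is over the parts of the last component only. -/
def multiZee (n : ℕ) (a b : Kqt) (lam : Fin n → YoungDiagram) : Kqt :=
  a ^ (((n : ℤ) - 1) * ∑ i, ((lam i).card : ℤ) -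
      ∑ i : Fin n, ((i : ℕ) : ℤ) * ((lam i).card : ℤ)) *
    (∏ i, (zee (lam i) : Kqt)) *
    ∏ i : Fin n, if (i : ℕ) + 1 = n then zeeFactor a b (lam i) else 1

/-- The scalar product of multi-symmetric functions with parameters `(a, b)`: the bilinear form
with `⟨p_λ, p_μ⟩ = δ_{λμ} z_λ(a,b)`. -/
def multiScalarProduct (n : ℕ) (a b : Kqt) (f g : MSym n) : Kqt :=
  ((multiPowerSumBasis n).repr f).sum fun lam c =>
    c * (multiPowerSumBasis n).repr g lam * multiZee n a b lam

/-! ### Macdonald polynomials -/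

/-- The characterization of the Macdonald polynomials with parameters `(a, b)`: a basis that is
unitriangular on the monomials and orthogonal. -/
structure IsMacdonaldFamily (a b : Kqt) (P : YoungDiagram → Sym) : Prop where
  linearIndependent : LinearIndependent Kqt P
  span_eq_top : Submodule.span Kqt (Set.range P) = ⊤
  triangular : ∀ lam, toSeries (P lam) - monoSeries Set.univ lam ∈
    Submodule.span Kqt (monoSeries (Set.univ : Set ℕ) '' {mu | DomLT mu lam})
  orthogonal : ∀ lam mu, lam ≠ mu → scalarProduct a b (P lam) (P mu) = 0

open Classical in
/-- The Macdonald polynomial `P_λ^{(a,b)}`, that is, the member with index `λ` of the unique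
family with the properties of `IsMacdonaldFamily a b`. -/
def macdonaldP (a b : Kqt) : YoungDiagram → Sym :=
  if h : ∃ P, IsMacdonaldFamily a b P then h.choose else 0

/-- The characterization of the multi-Macdonald polynomials with parameters `(a, b)`. -/
structure IsMultiMacdonaldFamily (n : ℕ) (a b : Kqt) (P : (Fin n → YoungDiagram) → MSym n) :
    Prop where
  linearIndependent : LinearIndependent Kqt P
  span_eq_top : Submodule.span Kqt (Set.range P) = ⊤
  triangular : ∀ lam, toMultiSeries (P lam) - multiMonoSeries lam ∈
    Submodule.span Kqt (multiMonoSeries '' {mu | MultiDomLT mu lam})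
  orthogonal : ∀ lam mu, lam ≠ mu → multiScalarProduct n a b (P lam) (P mu) = 0

open Classical in
/-- The multi-Macdonald polynomial `P_λ^{(a,b)}(x^{(1)}, …, x^{(n)})`, that is, the member with
index `λ` of the unique family with the properties of `IsMultiMacdonaldFamily n a b`. -/
def multiMacdonaldP (n : ℕ) (a b : Kqt) : (Fin n → YoungDiagram) → MSym n :=
  if h : ∃ P, IsMultiMacdonaldFamily n a b P then h.choose else 0

/-! ### Integral forms and modified versions -/

/-- `c_λ(a,b) = ∏_{s ∈ λ} (1 - a^{arm(s)} b^{leg(s) + 1})`; the cells are numbered from `(0,0)`. -/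
def cCoeff (a b : Kqt) (lam : YoungDiagram) : Kqt :=
  ∏ s ∈ lam.cells, (1 - a ^ (lam.rowLen s.1 - (s.2 + 1)) * b ^ (lam.colLen s.2 - (s.1 + 1) + 1))

/-- The integral form `J_λ^{(a,b)} = c_λ(a,b) P_λ^{(a,b)}`. -/
def macdonaldJ (a b : Kqt) (lam : YoungDiagram) : Sym := cCoeff a b lam • macdonaldP a b lam

/-- The modified Macdonald polynomial `H_λ^{(a,b)} = J_λ^{(a,b)}[X / (1 - b)]`, where the
parameter `b` counts as a monomial in the plethysm: `p_r[X / (1 - b)] = p_r / (1 - b^r)`. -/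
def macdonaldH (a b : Kqt) (lam : YoungDiagram) : Sym :=
  MvPolynomial.aeval (fun r : ℕ+ => (1 - b ^ (r : ℕ))⁻¹ • (MvPolynomial.X r : Sym))
    (macdonaldJ a b lam)

/-- The first parameter of the `i`-th factor: `q` for the first factor, then
`q^{n-1}t, …, q^2t, qt`. -/
def firstParam (n : ℕ) (i : Fin n) : Kqt := if (i : ℕ) = 0 then q else q ^ (n - (i : ℕ)) * t

/-- The second parameter of the `i`-th factor: `q^{n-1}t, …, qt, t`. -/
def secondParam (n : ℕ) (i : Fin n) : Kqt := q ^ (n - 1 - (i : ℕ)) * t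

/-- The integral form of the multi-Macdonald polynomial with parameters `(q, t)`,
`J_λ = c_{λ^{(1)}}(q,q^{n-1}t) c_{λ^{(2)}}(q^{n-1}t,q^{n-2}t) ⋯ c_{λ^{(n)}}(qt,t) P_λ`. -/
def multiMacdonaldJ (n : ℕ) (lam : Fin n → YoungDiagram) : MSym n :=
  (∏ i, cCoeff (firstParam n i) (secondParam n i) (lam i)) • multiMacdonaldP n q t lam

/-- The images of the alphabets under `φ`: the alphabets `X^{(1)}, …, X^{(n-1)}` are fixed, and
`X^{(1)} + ⋯ + X^{(n)}` is sent to `(X^{(1)} + ⋯ + X^{(n)}) / (1 - t)`; thus `X^{(n)}` is sent to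
`(X^{(1)} + ⋯ + X^{(n)}) / (1 - t) - (X^{(1)} + ⋯ + X^{(n-1)})`. -/
def phiAlphabet {n : ℕ} (i : Fin n) : MSym n :=
  if (i : ℕ) + 1 = n then
    (1 - t)⁻¹ • ∑ j, alphabet j - ∑ j ∈ Finset.Iio i, alphabet j
  else alphabet i

/-- The plethystic substitution `φ`. -/
def phi (n : ℕ) : MSym n →ₐ[Kqt] MSym n := multiPleth phiAlphabet

/-- The modified multi-Macdonald polynomial `H_λ^{(q,t)} = φ(J_λ^{(q,t)})`. -/
def multiMacdonaldH (n : ℕ) (lam : Fin n → YoungDiagram) : MSym n := phi n (multiMacdonaldJ n lam)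

/-- The alphabet `Z_i = q^i t (X^{(1)} + ⋯ + X^{(n-i-1)}) + X^{(n-i)} + q X^{(n-i+1)} + ⋯ +
q^i X^{(n)}`, for `0 ≤ i ≤ n - 1`; the index `j` below stands for `X^{(j+1)}`. -/
def alphabetZ (n i : ℕ) : MSym n :=
  ∑ j : Fin n,
    (if (j : ℕ) + 1 + i < n then q ^ i * t else q ^ ((j : ℕ) + 1 + i - n)) • alphabet j

end

end MultiMacdonald

/-! The multi-Macdonald polynomial is itself a product of ordinary ones. With the alphabets numbered
from 0, put `g_j = q^j - q^(n-1) t` and `Y_k = ∑_{j ≥ k} (g_j / g_k) X_j` (`factorAlphabet`). Then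
`P_lam = ∏_k P_(lam k)[Y_k]`, where the k-th factor has the parameters `firstParam n k`,
`secondParam n k` (`multiMacdonaldP_eq_prod`). It suffices to verify that these products are
unitriangular and orthogonal, and that such a family is unique.

Triangularity: `Y_k` is `X_k` plus a combination of later alphabets. Moving variables to later
alphabets only lowers a monomial in the multi-dominance order, and the part of a monomial that stays
in `X_k` is bounded by dominance in one alphabet (`triangular_prod_pleth`).

Orthogonality: a scalar product for which products of power sums are orthogonal is a Fock form:
multiplication by a variable is adjoint to a multiple of the derivative. Such a form is determined
by its values on linear forms, so a linear change of the power sums to another orthogonal family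
transports it (`fock_linear_change`). For each `r` the elements `p_r[Y_k]` form such a family. This
is a telescoping computation (`sum_ratioCoeff`), and it determines the `g_j`: the differences `g_i -
g_(i+1)`, with `g_n = 0`, are inversely proportional to the norms of the power sums of the partial
sums of alphabets. The norm of `p_r[Y_k]` turns out to be the Macdonald norm for the k-th pair of
parameters, times `q^((n-1-k) r)`, and this power only rescales each degree
(`multiScalarProduct_prod_pleth`).

The substitution `phi` then sends `p_r[Y_k]` to `p_r[Z_(n-1-k)] / (1 - b^r)` with `b = secondParam n
k` (`phi_adams_factorAlphabet`), which is exactly the passage from `J` to `H` in each factor.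

Since `macdonaldP` is a choice with default value 0, existence in one alphabet has to be proved for
the parameter pairs that occur (`exists_isMacdonaldFamily`). The polynomials are eigenvectors of
Macdonald's operator, written as `macOp = ∑_k b^(-k) g_k · [w^k] f[X + (a-1)w]`, where the `g_k` are
now the coefficients `gCoeff b k`. Multiplication by `g_k` is adjoint to extracting `[w^k]`, so the
operator is self-adjoint (`fock_macOp`). In finitely many variables it becomes the usual difference
operator (`evalAt_macOp`), which is triangular on monomial symmetric functions (`macOp_monoSym`),
and its eigenvalues are distinct when the monomials in the two parameters are linearly independent
(`GenericParams.macEigenvalue_injective`). -/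

namespace MultiMacdonald

noncomputable section

/-! ### Fock forms on polynomial rings -/

section Fock

open MvPolynomial

variable {K : Type*} [Field K] {U V : Type*}

/-- The norm `∏_v α_v! c_v^{α_v}` of the monomial with exponent `α`. -/
def fockNorm (c : V → K) (α : V →₀ ℕ) : K := α.prod fun v k => (k ! : K) * c v ^ k

/-- The bilinear form on a polynomial ring for which the monomials are orthogonal with the norms
`fockNorm c`. -/
def fock (c : V → K) (f g : MvPolynomial V K) : K :=
  ∑ α ∈ f.support, coeff α f * coeff α g * fockNorm c α

theorem fock_eq_sum (c : V → K) (f g : MvPolynomial V K) {s : Finset (V →₀ ℕ)}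
    (h : f.support ⊆ s) : fock c f g = ∑ α ∈ s, coeff α f * coeff α g * fockNorm c α := by
  refine Finset.sum_subset h fun α _ hα => ?_
  rw [notMem_support_iff.1 hα]; ring

theorem fock_comm (c : V → K) (f g : MvPolynomial V K) : fock c f g = fock c g f := by
  classical
  rw [fock_eq_sum c f g (Finset.subset_union_left (s₂ := g.support)),
    fock_eq_sum c g f (Finset.subset_union_right (s₁ := f.support))]
  exact Finset.sum_congr rfl fun _ _ => by ring

theorem fock_add_right (c : V → K) (f g h : MvPolynomial V K) :
    fock c f (g + h) = fock c f g + fock c f h := by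
  simp only [fock, coeff_add, ← Finset.sum_add_distrib]
  exact Finset.sum_congr rfl fun _ _ => by ring

theorem fock_smul_right (c : V → K) (f g : MvPolynomial V K) (x : K) :
    fock c f (x • g) = x * fock c f g := by
  simp only [fock, coeff_smul, smul_eq_mul, Finset.mul_sum]
  exact Finset.sum_congr rfl fun _ _ => by ring

theorem fock_add_left (c : V → K) (f g h : MvPolynomial V K) :
    fock c (f + g) h = fock c f h + fock c g h := by
  rw [fock_comm, fock_add_right, fock_comm c h, fock_comm c h]

theorem fock_smul_left (c : V → K) (f g : MvPolynomial V K) (x : K) :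
    fock c (x • f) g = x * fock c f g := by
  rw [fock_comm, fock_smul_right, fock_comm]

/-- The form `fock c` as a bilinear map. -/
def fockForm (c : V → K) : MvPolynomial V K →ₗ[K] MvPolynomial V K →ₗ[K] K :=
  LinearMap.mk₂ K (fock c) (fock_add_left c) (fun x f g => fock_smul_left c f g x)
    (fock_add_right c) (fun x f g => fock_smul_right c f g x)

theorem fockForm_apply (c : V → K) (f g : MvPolynomial V K) : fockForm c f g = fock c f g := rfl

theorem fock_monomial_left (c : V → K) (α : V →₀ ℕ) (x : K) (g : MvPolynomial V K) :
    fock c (monomial α x) g = x * coeff α g * fockNorm c α := by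
  classical
  rw [fock_eq_sum c _ g (support_monomial_subset), Finset.sum_singleton, coeff_monomial,
    if_pos rfl]

theorem fockNorm_add_single (c : V → K) (α : V →₀ ℕ) (v : V) :
    fockNorm c (α + Finsupp.single v 1) = fockNorm c α * ((α v + 1 : ℕ) * c v) := by
  classical
  have h1 := Finsupp.prod_of_support_subset (α + Finsupp.single v 1)
    (s := insert v α.support) (fun w hw => by
      by_cases hwv : w = v
      · simp [hwv]
      · simpa [Finsupp.single_apply, Ne.symm hwv, hwv] using hw)
    (fun v k => (k ! : K) * c v ^ k) (by simp)
  have h2 := Finsupp.prod_of_support_subset α (s := insert v α.support)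
    (Finset.subset_insert _ _) (fun v k => (k ! : K) * c v ^ k) (by simp)
  rw [fockNorm, fockNorm, h1, h2, ← Finset.mul_prod_erase _ _ (Finset.mem_insert_self v _),
    ← Finset.mul_prod_erase _ (fun i => ((α i)! : K) * c i ^ α i)
      (Finset.mem_insert_self v α.support)]
  have h3 : ∀ w ∈ (insert v α.support).erase v,
      ((((α + Finsupp.single v 1 : V →₀ ℕ) w)! : ℕ) : K) * c w ^ ((α + Finsupp.single v 1 : V →₀ ℕ) w) =
        ((α w)! : K) * c w ^ α w := by
    intro w hw
    have h4 : (α + Finsupp.single v 1 : V →₀ ℕ) w = α w := by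
      simp [Finset.ne_of_mem_erase hw]
    rw [h4]
  rw [Finset.prod_congr rfl h3]
  simp only [Finsupp.add_apply, Finsupp.single_eq_same, Nat.factorial_succ]
  push_cast
  ring

/-- On monomials this is the recursion `(k+1)! = (k+1) k!`. Together with the value on constants,
this adjointness determines the form; all later computations with `fock` go through it. -/
theorem fock_X_mul (c : V → K) (v : V) (f g : MvPolynomial V K) :
    fock c (X v * f) g = c v * fock c f (pderiv v g) := by
  induction f using MvPolynomial.induction_on' with
  | monomial α x =>
    rw [mul_comm, ← pow_one (X v), ← monomial_add_single, fock_monomial_left, fock_monomial_left,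
      fockNorm_add_single, coeff_pderiv]
    push_cast
    ring
  | add p q hp hq => rw [mul_add, fock_add_left, fock_add_left, hp, hq]; ring

theorem fock_C_left (c : V → K) (x : K) (g : MvPolynomial V K) :
    fock c (C x) g = x * constantCoeff g := by
  rw [C_apply, fock_monomial_left, fockNorm, Finsupp.prod_zero_index, mul_one, constantCoeff_eq]

theorem fockForm_injective (c : V → K) (hc : ∀ v, c v ≠ 0) [CharZero K] {f : MvPolynomial V K}
    (h : ∀ g, fock c f g = 0) : f = 0 := by
  ext α
  have := h (monomial α 1)
  rw [fock_comm, fock_monomial_left, one_mul, mul_eq_zero] at this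
  rw [coeff_zero]
  refine this.resolve_right ?_
  refine Finset.prod_ne_zero_iff.2 fun v _ => mul_ne_zero ?_ (pow_ne_zero _ (hc v))
  exact_mod_cast (Nat.factorial_pos _).ne'

/-- A linear change of variables to an orthogonal family of linear forms transports Fock forms. -/
theorem fock_linear_change [DecidableEq U] (c : V → K) (c' : U → K) (a : U → V →₀ K)
    (A : MvPolynomial U K →ₐ[K] MvPolynomial V K)
    (hA : ∀ u, A (X u) = (a u).sum fun v x => x • X v)
    (h : ∀ u u', ((a u).sum fun v x => x * (c v * a u' v)) = if u = u' then c' u else 0)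
    (f g : MvPolynomial U K) : fock c (A f) (A g) = fock c' f g := by
  classical
  -- The adjoint of multiplication by the linear form `A (X u)` is the derivation on the left. By
  -- the chain rule and the orthogonality `h`, it acts on the image of `A` as `c' u` times the
  -- derivative in `X u`.
  have hder : ∀ u g, ((a u).sum fun v x => (x * c v) • pderiv v (A g)) = c' u • A (pderiv u g) := by
    intro u g
    induction g using MvPolynomial.induction_on with
    | C x => rw [← algebraMap_eq, AlgHom.commutes]; simp [Finsupp.sum, algebraMap_eq]
    | add p q hp hq =>
      simp only [map_add, smul_add]
      rw [← hp, ← hq, ← Finsupp.sum_add]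
    | mul_X p u' hp =>
      have h1 : ((a u).sum fun v x => (x * c v) • pderiv v (A (X u'))) =
          c' u • A (pderiv u (X u')) := by
        have h2 : ∀ v, pderiv v (A (X u')) = C (a u' v) := by
          intro v
          rw [hA, Finsupp.sum, map_sum]
          have h5 : ∀ w, pderiv v (a u' w • X w : MvPolynomial V K) =
              if w = v then C (a u' w) else 0 := by
            intro w
            rw [Derivation.map_smul, pderiv_X, Pi.single_apply, smul_eq_C_mul, mul_ite, mul_one,
              mul_zero]
          rw [Finset.sum_congr rfl fun w _ => h5 w, Finset.sum_ite_eq']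
          split_ifs with hv
          · rfl
          · rw [Finsupp.notMem_support_iff.1 hv, C_0]
        simp only [h2]
        have h3 := congrArg (C : K → MvPolynomial V K) (h u u')
        rw [Finsupp.sum, map_sum] at h3
        rw [Finsupp.sum]
        simp only [smul_eq_C_mul, ← C_mul, mul_assoc]
        rw [h3, pderiv_X, Pi.single_apply]
        by_cases huu : u = u'
        · simp [huu]
        · simp [huu, Ne.symm huu]
      simp only [map_mul, Derivation.leibniz, map_add, smul_add, smul_eq_mul]
      rw [Finsupp.sum_add, ← mul_smul_comm, ← h1, ← mul_smul_comm (c' u) (A (X u')), ← hp,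
        Finsupp.mul_sum, Finsupp.mul_sum]
      simp only [mul_smul_comm]
  have hconst : ∀ g, constantCoeff (A g) = constantCoeff g := by
    intro g
    have : (constantCoeff.comp A.toRingHom : MvPolynomial U K →+* K) = constantCoeff := by
      refine ringHom_ext (fun x => by simp [← algebraMap_eq]) fun u => ?_
      simp [hA, Finsupp.sum, smul_eq_C_mul]
    exact RingHom.congr_fun this g
  induction f using MvPolynomial.induction_on generalizing g with
  | C x =>
    rw [← algebraMap_eq, AlgHom.commutes, algebraMap_eq, algebraMap_eq, fock_C_left, fock_C_left,
      hconst]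
  | add p q hp hq => rw [map_add, fock_add_left, fock_add_left, hp, hq]
  | mul_X p u hp =>
    rw [mul_comm p, fock_X_mul, ← hp, ← fock_smul_right, ← hder, map_mul, hA, Finsupp.sum,
      Finset.sum_mul, Finsupp.sum, ← fockForm_apply, ← fockForm_apply, map_sum, map_sum,
      LinearMap.sum_apply]
    refine Finset.sum_congr rfl fun v _ => ?_
    rw [fockForm_apply, fockForm_apply, smul_mul_assoc, fock_smul_left, fock_X_mul,
      fock_smul_right]
    ring

/-- Fock forms are multiplicative over disjoint sets of variables. -/
theorem fock_rename_mul (c : V → K) {e : U → V} (he : Function.Injective e)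
    {F G : MvPolynomial V K} (hF : ∀ u, pderiv (e u) F = 0) (hG : ∀ u, pderiv (e u) G = 0)
    (f g : MvPolynomial U K) :
    fock c (rename e f * F) (rename e g * G) = fock (c ∘ e) f g * fock c F G := by
  induction f using MvPolynomial.induction_on generalizing g with
  | C x =>
    rw [rename_C, ← smul_eq_C_mul, fock_smul_left, fock_C_left, mul_assoc]
    congr 1
    induction g using MvPolynomial.induction_on with
    | C y => rw [rename_C, ← smul_eq_C_mul, fock_smul_right, constantCoeff_C]
    | add p q hp hq => rw [map_add, add_mul, fock_add_right, hp, hq, map_add, add_mul]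
    | mul_X p u _ =>
      rw [map_mul, rename_X, mul_comm _ (X (e u)), mul_assoc, fock_comm, fock_X_mul, hF]
      simp [fock]
  | add p q hp hq => rw [map_add, add_mul, fock_add_left, fock_add_left, hp, hq, add_mul]
  | mul_X p u hp =>
    rw [mul_comm p, map_mul, rename_X, mul_assoc, fock_X_mul, fock_X_mul, Derivation.leibniz, hG,
      smul_zero, zero_add, pderiv_rename he, smul_eq_mul, mul_comm G, hp]
    simp [mul_assoc]

/-- The factors `κ ^ r` contribute `κ` to the weighted degree of each monomial. Only monomials
common to `f` and `g` count, so homogeneity of one argument is enough. -/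
theorem fock_weight (c : ℕ+ → K) (κ : K) {d : ℕ} {g : MvPolynomial ℕ+ K}
    (hg : IsWeightedHomogeneous (fun r : ℕ+ => (r : ℕ)) g d) (f : MvPolynomial ℕ+ K) :
    fock (fun r : ℕ+ => κ ^ (r : ℕ) * c r) f g = κ ^ d * fock c f g := by
  simp only [fock, Finset.mul_sum]
  refine Finset.sum_congr rfl fun α _ => ?_
  by_cases h : coeff α g = 0
  · simp [h]
  have h1 : fockNorm (fun r : ℕ+ => κ ^ (r : ℕ) * c r) α = κ ^ d * fockNorm c α := by
    rw [← hg h, fockNorm, fockNorm, Finsupp.weight_apply, Finsupp.sum, ← Finset.prod_pow_eq_pow_sum,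
      Finsupp.prod, Finsupp.prod, ← Finset.prod_mul_distrib]
    refine Finset.prod_congr rfl fun r _ => ?_
    rw [mul_pow, ← pow_mul, smul_eq_mul, mul_comm (α r) (r : ℕ)]
    ring
  rw [h1]
  ring

end Fock

/-! ### Partitions and exponents -/

theorem sum_le_sum_range_of_antitone {f : ℕ → ℕ} (hf : Antitone f) (S : Finset ℕ) :
    ∑ i ∈ S, f i ≤ ∑ i ∈ Finset.range S.card, f i := by
  induction S using Finset.induction_on_max with
  | empty => simp
  | insert m S hm ih =>
    have hmS : m ∉ S := fun h => lt_irrefl _ (hm m h)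
    rw [Finset.sum_insert hmS, Finset.card_insert_of_notMem hmS, Finset.sum_range_succ, add_comm]
    refine Nat.add_le_add ih (hf ?_)
    calc S.card ≤ (Finset.range m).card :=
          Finset.card_le_card fun i hi => Finset.mem_range.2 (hm i hi)
      _ = m := Finset.card_range m

theorem youngDiagram_ext {mu lam : YoungDiagram} (h : ∀ i, mu.rowLen i = lam.rowLen i) :
    mu = lam := by
  refine SetLike.ext fun c => ?_
  obtain ⟨i, j⟩ := c
  rw [YoungDiagram.mem_iff_lt_rowLen, YoungDiagram.mem_iff_lt_rowLen, h]

theorem rowLen_pos_iff (lam : YoungDiagram) (i : ℕ) : lam.rowLen i ≠ 0 ↔ i < lam.colLen 0 := by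
  rw [← YoungDiagram.mem_iff_lt_colLen, YoungDiagram.mem_iff_lt_rowLen, Nat.pos_iff_ne_zero]

/-- The exponent `(λ_1, λ_2, …)` of the leading monomial of `m_λ`. -/
def leadExp (lam : YoungDiagram) : ℕ →₀ ℕ :=
  Finsupp.onFinset (Finset.range (lam.colLen 0)) lam.rowLen fun i hi =>
    Finset.mem_range.2 ((rowLen_pos_iff lam i).1 hi)

@[simp]
theorem leadExp_apply (lam : YoungDiagram) (i : ℕ) : leadExp lam i = lam.rowLen i := rfl

theorem leadExp_support (lam : YoungDiagram) :
    (leadExp lam).support = Finset.range (lam.colLen 0) := by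
  ext i
  rw [Finsupp.mem_support_iff, leadExp_apply, rowLen_pos_iff, Finset.mem_range]

/-- The multiset of nonzero values of an exponent. -/
def values (α : ℕ →₀ ℕ) : Multiset ℕ := α.support.val.map α

theorem values_leadExp (lam : YoungDiagram) : values (leadExp lam) = (lam.rowLens : Multiset ℕ) := by
  rw [values, leadExp_support, YoungDiagram.rowLens]
  rfl

theorem card_values (α : ℕ →₀ ℕ) : (values α).card = α.support.card := by
  rw [values, Multiset.card_map, Finset.card_def]

theorem sum_values (α : ℕ →₀ ℕ) : (values α).sum = α.degree := rfl

theorem rowLens_injective {mu lam : YoungDiagram}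
    (h : (mu.rowLens : Multiset ℕ) = (lam.rowLens : Multiset ℕ)) : mu = lam :=
  parts_bijective.1 (by rw [parts, parts, h])

theorem exists_rowLens_eq_values (α : ℕ →₀ ℕ) :
    ∃ lam : YoungDiagram, (lam.rowLens : Multiset ℕ) = values α := by
  obtain ⟨lam, h⟩ := parts_bijective.2 ((values α).map Nat.toPNat')
  refine ⟨lam, ?_⟩
  rw [← map_parts, h, Multiset.map_map]
  conv_rhs => rw [← Multiset.map_id (values α)]
  refine Multiset.map_congr rfl fun x hx => ?_
  obtain ⟨v, hv, rfl⟩ := Multiset.mem_map.1 hx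
  have : 0 < α v := Nat.pos_of_ne_zero (Finsupp.mem_support_iff.1 hv)
  simp [Nat.toPNat'_coe, this]

/-- The partition formed by the nonzero values of an exponent. -/
def expType (α : ℕ →₀ ℕ) : YoungDiagram := (exists_rowLens_eq_values α).choose

theorem rowLens_expType (α : ℕ →₀ ℕ) : ((expType α).rowLens : Multiset ℕ) = values α :=
  (exists_rowLens_eq_values α).choose_spec

theorem expType_eq_iff {α : ℕ →₀ ℕ} {lam : YoungDiagram} :
    expType α = lam ↔ values α = (lam.rowLens : Multiset ℕ) := by
  rw [← rowLens_expType]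
  exact ⟨fun h => by rw [h], rowLens_injective⟩

@[simp]
theorem expType_leadExp (lam : YoungDiagram) : expType (leadExp lam) = lam :=
  expType_eq_iff.2 (values_leadExp lam)

/-- A permutation is assembled from bijections of the fibres. Over a nonzero value the fibres are
finite and their size is a multiplicity in `values`; over zero both are countably infinite. -/
theorem exists_perm_of_values_eq {α β : ℕ →₀ ℕ} (h : values α = values β) :
    ∃ π : Equiv.Perm ℕ, ∀ i, α (π i) = β i := by
  classical
  have hcard : ∀ (γ : ℕ →₀ ℕ) (c : ℕ), c ≠ 0 →
      (Nat.card {v // γ v = c} = (values γ).count c ∧ Finite {v // γ v = c}) := by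
    intro γ c hc
    have hset : ∀ v, v ∈ γ.support.filter (fun v => c = γ v) ↔ γ v = c := by
      intro v
      simp only [Finset.mem_filter, Finsupp.mem_support_iff]
      constructor
      · rintro ⟨_, h⟩; exact h.symm
      · rintro rfl; exact ⟨hc, rfl⟩
    have e : {v // γ v = c} ≃ {v // v ∈ γ.support.filter (fun v => c = γ v)} :=
      Equiv.subtypeEquivRight fun v => (hset v).symm
    refine ⟨?_, Finite.of_equiv _ e.symm⟩
    rw [Nat.card_congr e, values, Multiset.count_map, Nat.card_eq_fintype_card, Fintype.card_coe]
    rfl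
  have hinf : ∀ γ : ℕ →₀ ℕ, Infinite {v // γ v = 0} := by
    intro γ
    have : ({v | γ v = 0} : Set ℕ) = (γ.support : Set ℕ)ᶜ := by ext; simp
    have h2 : ({v | γ v = 0} : Set ℕ).Infinite := by
      rw [this]
      exact γ.support.finite_toSet.infinite_compl
    exact Set.infinite_coe_iff.2 h2
  have key : ∀ c, Nonempty ({v // β v = c} ≃ {v // α v = c}) := by
    intro c
    by_cases hc : c = 0
    · subst hc
      have := hinf α
      have := hinf β
      exact nonempty_equiv_of_countable
    · have := (hcard α c hc).2
      have := (hcard β c hc).2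
      exact Finite.card_eq.1 (by rw [(hcard α c hc).1, (hcard β c hc).1, h])
  exact ⟨Equiv.ofFiberEquiv fun c => (key c).some, fun i => Equiv.ofFiberEquiv_map _ i⟩

/-- After sorting, the first `j` parts are the `j` largest exponents. This is how dominance bounds
are read off from unsorted exponents. -/
theorem sum_le_of_expType {α : ℕ →₀ ℕ} (T : Finset ℕ) {j : ℕ} (hT : T.card ≤ j) :
    ∑ v ∈ T, α v ≤ ∑ i ∈ Finset.range j, (expType α).rowLen i := by
  obtain ⟨π, hπ⟩ := exists_perm_of_values_eq (α := leadExp (expType α)) (β := α)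
    (by rw [values_leadExp, rowLens_expType])
  calc ∑ v ∈ T, α v = ∑ v ∈ T.map π.toEmbedding, (expType α).rowLen v := by
        rw [Finset.sum_map]
        exact Finset.sum_congr rfl fun v _ => (hπ v).symm
    _ ≤ ∑ i ∈ Finset.range T.card, (expType α).rowLen i := by
        have := sum_le_sum_range_of_antitone (f := (expType α).rowLen)
          (fun i k h => (expType α).rowLen_anti i k h) (T.map π.toEmbedding)
        rwa [Finset.card_map] at this
    _ ≤ _ := Finset.sum_le_sum_of_subset (Finset.range_mono hT)

theorem degree_leadExp (lam : YoungDiagram) : (leadExp lam).degree = lam.card := by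
  rw [Finsupp.degree_apply, leadExp_support, YoungDiagram.card,
    Finset.card_eq_sum_card_fiberwise (f := Prod.fst) (t := Finset.range (lam.colLen 0))]
  · refine Finset.sum_congr rfl fun i _ => ?_
    rw [leadExp_apply, YoungDiagram.rowLen_eq_card]
    rfl
  · rintro ⟨i, j⟩ h
    have h1 : (i, 0) ∈ lam := lam.up_left_mem le_rfl (Nat.zero_le j) h
    simpa using YoungDiagram.mem_iff_lt_colLen.1 h1

theorem card_expType (α : ℕ →₀ ℕ) : (expType α).card = α.degree := by
  rw [← degree_leadExp, ← sum_values, ← sum_values, values_leadExp, rowLens_expType]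

theorem sum_rowLen_le_card (lam : YoungDiagram) (j : ℕ) :
    ∑ i ∈ Finset.range j, lam.rowLen i ≤ lam.card := by
  rw [← degree_leadExp, Finsupp.degree_apply]
  calc ∑ i ∈ Finset.range j, lam.rowLen i
      = ∑ i ∈ Finset.range j, leadExp lam i := rfl
    _ ≤ ∑ i ∈ Finset.range j ∪ (leadExp lam).support, leadExp lam i :=
        Finset.sum_le_sum_of_subset Finset.subset_union_left
    _ = _ := (Finset.sum_subset Finset.subset_union_right fun i _ hi =>
        Finsupp.notMem_support_iff.1 hi).symm

/-- A cell `(i, j)` forces `i + 1` cells in the first column and `j + 1` in the first row, so the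
diagram fits in a bounded square. -/
theorem finite_card_le (d : ℕ) : {lam : YoungDiagram | lam.card ≤ d}.Finite := by
  refine Set.Finite.of_finite_image (f := YoungDiagram.cells)
    (Set.Finite.subset (Finset.range (d + 1) ×ˢ Finset.range (d + 1)).powerset.finite_toSet ?_)
    (fun mu _ lam _ h => YoungDiagram.ext h)
  rintro _ ⟨lam, hlam, rfl⟩
  simp only [Finset.coe_powerset, Set.mem_preimage, Set.mem_powerset_iff, Finset.coe_subset]
  rintro ⟨i, j⟩ h
  have hsub : ∀ s : Finset (ℕ × ℕ), (∀ c ∈ s, c ∈ lam) → s.card ≤ d := fun s hs =>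
    (Finset.card_le_card fun c hc => YoungDiagram.mem_cells c |>.2 (hs c hc)).trans hlam
  have h1 := hsub ((Finset.range (i + 1)).map ⟨fun k => (k, 0), fun a b h => by simpa using h⟩)
    (by
      intro c hc
      obtain ⟨k, hk, rfl⟩ := Finset.mem_map.1 hc
      exact lam.up_left_mem (Nat.lt_succ_iff.1 (Finset.mem_range.1 hk)) (Nat.zero_le j) h)
  have h2 := hsub ((Finset.range (j + 1)).map ⟨fun k => (0, k), fun a b h => by simpa using h⟩)
    (by
      intro c hc
      obtain ⟨k, hk, rfl⟩ := Finset.mem_map.1 hc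
      exact lam.up_left_mem (Nat.zero_le i) (Nat.lt_succ_iff.1 (Finset.mem_range.1 hk)) h)
  rw [Finset.card_map, Finset.card_range] at h1 h2
  simp only [Finset.mem_product, Finset.mem_range]
  omega

/-! ### Symmetry of the series -/

open MvPowerSeries in
theorem killCompl_psumSeries {σ τ : Type} (e : σ ↪ τ) (S : Set τ) (r : ℕ+) :
    killCompl e (psumSeries S r) = psumSeries (e ⁻¹' S) r := by
  classical
  ext α
  rw [coeff_killCompl]
  change (if _ then _ else _ : Kqt) = if _ then _ else _
  refine if_congr ?_ rfl rfl
  constructor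
  · rintro ⟨v, hv, h⟩
    have h1 : v ∈ (Finsupp.embDomain e α).support := by
      rw [h, Finsupp.mem_support_iff, Finsupp.single_eq_same]
      exact r.pos.ne'
    rw [Finsupp.support_embDomain, Finset.mem_map] at h1
    obtain ⟨u, _, rfl⟩ := h1
    refine ⟨u, hv, Finsupp.embDomain_injective e ?_⟩
    rw [h, Finsupp.embDomain_single]
  · rintro ⟨u, hu, rfl⟩
    exact ⟨e u, hu, Finsupp.embDomain_single _ _ _⟩

theorem embDomain_eq_of_forall {σ τ : Type} (π : σ ≃ τ) {α : τ →₀ ℕ} {β : σ →₀ ℕ}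
    (h : ∀ i, α (π i) = β i) : Finsupp.embDomain π.toEmbedding β = α := by
  ext v
  obtain ⟨u, rfl⟩ := π.surjective v
  rw [h]
  exact Finsupp.embDomain_apply_self _ _ _

/-- Along a bijection `killCompl` merely renames variables, so this is the symmetry of symmetric
functions. -/
theorem killCompl_toSeries (π : Equiv.Perm ℕ) (f : Sym) :
    MvPowerSeries.killCompl π.toEmbedding (toSeries f) = toSeries f := by
  have : (MvPowerSeries.killCompl π.toEmbedding).comp toSeries = toSeries := by
    refine MvPolynomial.algHom_ext fun r => ?_
    simp [toSeries, killCompl_psumSeries]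
  exact AlgHom.congr_fun this f

open MvPowerSeries in
theorem coeff_toSeries_congr {α β : ℕ →₀ ℕ} (h : values α = values β) (f : Sym) :
    coeff α (toSeries f) = coeff β (toSeries f) := by
  obtain ⟨π, hπ⟩ := exists_perm_of_values_eq h
  rw [← embDomain_eq_of_forall π hπ, ← coeff_killCompl, killCompl_toSeries]

open MvPowerSeries in
theorem coeff_toSeries_eq_leadExp (α : ℕ →₀ ℕ) (f : Sym) :
    coeff α (toSeries f) = coeff (leadExp (expType α)) (toSeries f) :=
  coeff_toSeries_congr (by rw [values_leadExp, rowLens_expType]) f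

open Classical in
theorem coeff_monoSeries (lam : YoungDiagram) (α : ℕ →₀ ℕ) :
    MvPowerSeries.coeff α (monoSeries Set.univ lam) = if expType α = lam then 1 else 0 := by
  by_cases h : expType α = lam
  · rw [if_pos h]
    exact if_pos ⟨fun _ _ => Set.mem_univ _, expType_eq_iff.1 h⟩
  · rw [if_neg h]
    exact if_neg fun h1 => h (expType_eq_iff.2 h1.2)

/-- A series whose coefficients only depend on the type of the exponent is a combination of the
monomial series of the types that occur. -/
theorem mem_span_of_coeff {σ I : Type} (typ : (σ →₀ ℕ) → I) (lead : I → σ →₀ ℕ)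
    (mono : I → MvPowerSeries σ Kqt)
    (hmono : ∀ i α, open Classical in
      MvPowerSeries.coeff α (mono i) = if typ α = i then 1 else 0)
    (F : MvPowerSeries σ Kqt)
    (hF : ∀ α, MvPowerSeries.coeff α F = MvPowerSeries.coeff (lead (typ α)) F)
    {A : Set I} (hA : A.Finite) (hFA : ∀ α, MvPowerSeries.coeff α F ≠ 0 → typ α ∈ A) :
    F ∈ Submodule.span Kqt (mono '' A) := by
  classical
  have h : F = ∑ i ∈ hA.toFinset, MvPowerSeries.coeff (lead i) F • mono i := by
    ext α
    simp only [map_sum, map_smul, hmono, smul_eq_mul, mul_ite, mul_one, mul_zero]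
    rw [Finset.sum_ite_eq]
    split_ifs with h1
    · exact hF α
    · by_contra h2
      exact h1 (hA.mem_toFinset.2 (hFA α h2))
  rw [h]
  refine Submodule.sum_mem _ fun i hi => Submodule.smul_mem _ _ (Submodule.subset_span ?_)
  exact ⟨i, hA.mem_toFinset.1 hi, rfl⟩

/-- The support of a combination of monomial series. -/
theorem typ_mem_of_mem_span {σ I : Type} (typ : (σ →₀ ℕ) → I) (mono : I → MvPowerSeries σ Kqt)
    (hmono : ∀ i α, open Classical in
      MvPowerSeries.coeff α (mono i) = if typ α = i then 1 else 0)
    {F : MvPowerSeries σ Kqt} {A : Set I} (hF : F ∈ Submodule.span Kqt (mono '' A)) {α : σ →₀ ℕ}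
    (hα : typ α ∉ A) : MvPowerSeries.coeff α F = 0 := by
  induction hF using Submodule.span_induction with
  | mem x hx =>
    obtain ⟨i, hi, rfl⟩ := hx
    rw [hmono, if_neg]
    rintro rfl
    exact hα hi
  | zero => exact map_zero _
  | add x y _ _ hx hy => rw [map_add, hx, hy, add_zero]
  | smul c x _ hx => rw [map_smul, hx, smul_zero]

/-! ### Supports of power series -/

theorem exists_of_coeff_mul_ne_zero {σ : Type} {F G : MvPowerSeries σ Kqt} {α : σ →₀ ℕ}
    (h : MvPowerSeries.coeff α (F * G) ≠ 0) :
    ∃ β γ, β + γ = α ∧ MvPowerSeries.coeff β F ≠ 0 ∧ MvPowerSeries.coeff γ G ≠ 0 := by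
  classical
  rw [MvPowerSeries.coeff_mul] at h
  obtain ⟨p, hp, h1⟩ := Finset.exists_ne_zero_of_sum_ne_zero h
  exact ⟨p.1, p.2, Finset.HasAntidiagonal.mem_antidiagonal.1 hp, left_ne_zero_of_mul h1, right_ne_zero_of_mul h1⟩

/-- All exponents that occur in `F` have the degree `d` with respect to `w`. -/
def HasWeight {σ : Type} (w : (σ →₀ ℕ) →+ ℕ) (d : ℕ) (F : MvPowerSeries σ Kqt) : Prop :=
  ∀ α, MvPowerSeries.coeff α F ≠ 0 → w α = d

theorem HasWeight.mul {σ : Type} {w : (σ →₀ ℕ) →+ ℕ} {d e : ℕ} {F G : MvPowerSeries σ Kqt}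
    (hF : HasWeight w d F) (hG : HasWeight w e G) : HasWeight w (d + e) (F * G) := by
  intro α h
  obtain ⟨β, γ, rfl, h1, h2⟩ := exists_of_coeff_mul_ne_zero h
  rw [map_add, hF β h1, hG γ h2]

theorem HasWeight.one {σ : Type} (w : (σ →₀ ℕ) →+ ℕ) : HasWeight w 0 1 := by
  classical
  intro α h
  rw [MvPowerSeries.coeff_one] at h
  rw [(ite_ne_right_iff.1 h).1, map_zero]

theorem HasWeight.pow {σ : Type} {w : (σ →₀ ℕ) →+ ℕ} {d : ℕ} {F : MvPowerSeries σ Kqt}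
    (hF : HasWeight w d F) (k : ℕ) : HasWeight w (k * d) (F ^ k) := by
  induction k with
  | zero => simpa using HasWeight.one w
  | succ k ih => rw [pow_succ, add_mul, one_mul]; exact ih.mul hF

theorem HasWeight.add {σ : Type} {w : (σ →₀ ℕ) →+ ℕ} {d : ℕ} {F G : MvPowerSeries σ Kqt}
    (hF : HasWeight w d F) (hG : HasWeight w d G) : HasWeight w d (F + G) := by
  intro α h
  rw [map_add] at h
  by_cases h1 : MvPowerSeries.coeff α F = 0
  · exact hG α fun h2 => h (by rw [h1, h2, add_zero])
  · exact hF α h1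

theorem HasWeight.smul {σ : Type} {w : (σ →₀ ℕ) →+ ℕ} {d : ℕ} {F : MvPowerSeries σ Kqt}
    (hF : HasWeight w d F) (c : Kqt) : HasWeight w d (c • F) := by
  intro α h
  rw [map_smul] at h
  exact hF α (right_ne_zero_of_smul h)

theorem HasWeight.zero {σ : Type} (w : (σ →₀ ℕ) →+ ℕ) (d : ℕ) : HasWeight w d 0 :=
  fun _ h => absurd (map_zero _) h

theorem HasWeight.sum {σ ι : Type} {w : (σ →₀ ℕ) →+ ℕ} {d : ℕ} {F : ι → MvPowerSeries σ Kqt}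
    (s : Finset ι) (h : ∀ i ∈ s, HasWeight w d (F i)) : HasWeight w d (∑ i ∈ s, F i) := by
  classical
  induction s using Finset.induction_on with
  | empty => exact HasWeight.zero w d
  | insert a s ha ih =>
    rw [Finset.sum_insert ha]
    exact (h a (Finset.mem_insert_self a s)).add
      (ih fun i hi => h i (Finset.mem_insert_of_mem hi))

theorem hasWeight_monomial {σ J : Type} {w : (σ →₀ ℕ) →+ ℕ}
    (Φ : MvPolynomial J Kqt →ₐ[Kqt] MvPowerSeries σ Kqt) {wt : J → ℕ}
    (hΦ : ∀ j, HasWeight w (wt j) (Φ (MvPolynomial.X j))) (β : J →₀ ℕ) (c : Kqt) :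
    HasWeight w (Finsupp.weight wt β) (Φ (MvPolynomial.monomial β c)) := by
  classical
  induction β using Finsupp.induction generalizing c with
  | zero =>
    rw [map_zero, ← mul_one c, ← smul_eq_mul, ← MvPolynomial.smul_monomial, map_smul,
      show MvPolynomial.monomial (0 : J →₀ ℕ) (1 : Kqt) = 1 from rfl, map_one]
    exact (HasWeight.one w).smul c
  | single_add j k β _ _ ih =>
    rw [map_add, ← one_mul c, ← MvPolynomial.monomial_mul, map_mul, Finsupp.weight_single]
    refine HasWeight.mul ?_ (ih c)
    rw [← MvPolynomial.X_pow_eq_monomial, map_pow]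
    exact (hΦ j).pow k

theorem hasWeight_of_isWeightedHomogeneous {σ J : Type} {w : (σ →₀ ℕ) →+ ℕ}
    (Φ : MvPolynomial J Kqt →ₐ[Kqt] MvPowerSeries σ Kqt) {wt : J → ℕ}
    (hΦ : ∀ j, HasWeight w (wt j) (Φ (MvPolynomial.X j))) {f : MvPolynomial J Kqt} {d : ℕ}
    (hf : MvPolynomial.IsWeightedHomogeneous wt f d) : HasWeight w d (Φ f) := by
  rw [MvPolynomial.as_sum f, map_sum]
  refine HasWeight.sum _ fun β hβ => ?_
  rw [← hf (MvPolynomial.mem_support_iff.1 hβ)]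
  exact hasWeight_monomial Φ hΦ β _

theorem exists_of_coeff_psumSeries_ne_zero {σ : Type} {S : Set σ} {r : ℕ+} {α : σ →₀ ℕ}
    (h : MvPowerSeries.coeff α (psumSeries S r) ≠ 0) :
    ∃ v ∈ S, α = Finsupp.single v (r : ℕ) := by
  classical
  by_contra h1
  exact h (if_neg h1)

theorem coeff_single_psumSeries {σ : Type} {S : Set σ} (r : ℕ+) {v : σ} (hv : v ∈ S) :
    MvPowerSeries.coeff (Finsupp.single v (r : ℕ)) (psumSeries S r) = 1 :=
  if_pos ⟨v, hv, rfl⟩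

theorem hasWeight_degree_psumSeries {σ : Type} (S : Set σ) (r : ℕ+) :
    HasWeight Finsupp.degree r (psumSeries S r) := by
  intro α h
  obtain ⟨v, _, rfl⟩ := exists_of_coeff_psumSeries_ne_zero h
  exact Finsupp.degree_single v _

theorem toSeries_X (r : ℕ+) : toSeries (MvPolynomial.X r) = psumSeries Set.univ r := by
  rw [toSeries, MvPolynomial.aeval_X]

theorem toMultiSeries_X {n : ℕ} (v : Fin n × ℕ+) :
    toMultiSeries (MvPolynomial.X v) = psumSeries {w | w.1 = v.1} v.2 := by
  rw [toMultiSeries, MvPolynomial.aeval_X]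

/-! ### Power sums expand triangularly with respect to the number of parts -/

theorem coeff_psumSeries_mul (r : ℕ+) (F : MvPowerSeries ℕ Kqt) (α : ℕ →₀ ℕ) :
    MvPowerSeries.coeff α (psumSeries Set.univ r * F) =
      ∑ v ∈ α.support.filter (fun v => (r : ℕ) ≤ α v),
        MvPowerSeries.coeff (α - Finsupp.single v (r : ℕ)) F := by
  classical
  rw [MvPowerSeries.coeff_mul]
  symm
  have hle : ∀ v ∈ α.support.filter (fun v => (r : ℕ) ≤ α v), Finsupp.single v (r : ℕ) ≤ α :=
    fun v hv => Finsupp.single_le_iff.2 (Finset.mem_filter.1 hv).2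
  refine Finset.sum_of_injOn
    (fun v => (Finsupp.single v (r : ℕ), α - Finsupp.single v (r : ℕ))) ?_ ?_ ?_ ?_
  · intro v _ u _ h
    exact Finsupp.single_left_injective r.pos.ne' (Prod.ext_iff.1 h).1
  · intro v hv
    exact Finset.mem_coe.2 (Finset.HasAntidiagonal.mem_antidiagonal.2 (add_tsub_cancel_of_le (hle v hv)))
  · rintro ⟨β, γ⟩ hp hn
    by_contra h
    obtain ⟨v, _, rfl⟩ := exists_of_coeff_psumSeries_ne_zero (left_ne_zero_of_mul h)
    rw [Finset.HasAntidiagonal.mem_antidiagonal] at hp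
    refine hn ⟨v, ?_, ?_⟩
    · have h1 : (r : ℕ) ≤ α v := by
        rw [← hp]
        simp
      exact Finset.mem_coe.2 (Finset.mem_filter.2
        ⟨Finsupp.mem_support_iff.2 (by have := r.pos; omega), h1⟩)
    · rw [← hp]
      simp
  · intro v _
    rw [coeff_single_psumSeries r (Set.mem_univ v), one_mul]

theorem values_of_support_sub {α : ℕ →₀ ℕ} {v : ℕ} {r : ℕ} (hr : r ≠ 0) (h : α v = r) :
    values α = r ::ₘ values (α - Finsupp.single v r) := by
  classical
  have h1 : (α - Finsupp.single v r).support = α.support.erase v := by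
    ext u
    by_cases hu : u = v
    · subst hu; simp [h]
    · simp [hu]
  have hv : v ∈ α.support := Finsupp.mem_support_iff.2 (h ▸ hr)
  rw [values, values, h1, ← Finset.insert_erase hv, Finset.erase_insert (Finset.notMem_erase v _),
    Finset.insert_val_of_notMem (Finset.notMem_erase v _), Multiset.map_cons, h]
  congr 1
  refine Multiset.map_congr rfl fun u hu => ?_
  have : u ≠ v := Finset.ne_of_mem_erase hu
  simp [this]

/-- Expanding a product of power sums assigns a variable to each part and adds the parts that meet.
Hence at most `s.card` variables occur, with equality only when no parts merge. The coefficients are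
natural numbers, so nothing cancels. -/
theorem coeff_toSeries_prod_X (s : Multiset ℕ+) (α : ℕ →₀ ℕ) :
    ∃ k : ℕ, MvPowerSeries.coeff α (toSeries (s.map MvPolynomial.X).prod) = k ∧
      (k ≠ 0 → α.support.card ≤ s.card ∧
        (α.support.card = s.card → values α = s.map fun r : ℕ+ => (r : ℕ))) ∧
      ((values α = s.map fun r : ℕ+ => (r : ℕ)) → k ≠ 0) := by
  classical
  induction s using Multiset.induction_on generalizing α with
  | empty =>
    refine ⟨if α = 0 then 1 else 0, ?_, ?_, ?_⟩
    · rw [Multiset.map_zero, Multiset.prod_zero, map_one, MvPowerSeries.coeff_one]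
      push_cast
      rfl
    · intro h
      rw [ite_ne_right_iff] at h
      simp [h.1, values]
    · intro h
      have h1 : α.support.card = 0 := by rw [← card_values, h]; simp
      have : α = 0 := by simpa using h1
      simp [this]
  | cons r s ih =>
    choose k hk hk1 hk2 using ih
    refine ⟨∑ v ∈ α.support.filter (fun v => (r : ℕ) ≤ α v),
      k (α - Finsupp.single v (r : ℕ)), ?_, ?_, ?_⟩
    · rw [Multiset.map_cons, Multiset.prod_cons, map_mul, toSeries_X, coeff_psumSeries_mul]
      push_cast
      exact Finset.sum_congr rfl fun v _ => hk _
    · intro h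
      obtain ⟨v, hv, h1⟩ := Finset.exists_ne_zero_of_sum_ne_zero h
      obtain ⟨h2, h3⟩ := hk1 _ h1
      have hv1 := (Finset.mem_filter.1 hv).1
      have hsub : α.support.erase v ⊆ (α - Finsupp.single v (r : ℕ)).support := by
        intro u hu
        have := Finset.ne_of_mem_erase hu
        simpa [this] using Finsupp.mem_support_iff.1 (Finset.mem_of_mem_erase hu)
      have h4 := Finset.card_le_card hsub
      rw [Finset.card_erase_of_mem hv1] at h4
      have h5 : 0 < α.support.card := Finset.card_pos.2 ⟨v, hv1⟩
      rw [Multiset.card_cons]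
      refine ⟨by omega, fun h6 => ?_⟩
      have h7 : (α - Finsupp.single v (r : ℕ)).support.card = s.card := by omega
      have h8 : α.support.erase v = (α - Finsupp.single v (r : ℕ)).support := by
        refine Finset.eq_of_subset_of_card_le hsub ?_
        rw [Finset.card_erase_of_mem hv1]
        omega
      have h9 : α v = r := by
        have : v ∉ (α - Finsupp.single v (r : ℕ)).support := h8 ▸ Finset.notMem_erase v _
        rw [Finsupp.notMem_support_iff, Finsupp.tsub_apply, Finsupp.single_eq_same] at this
        have := (Finset.mem_filter.1 hv).2
        omega
      rw [values_of_support_sub r.pos.ne' h9, h3 h7, Multiset.map_cons]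
    · intro h
      have h1 : (r : ℕ) ∈ values α := by rw [h]; simp
      obtain ⟨v, hv, h2⟩ := Multiset.mem_map.1 h1
      intro h3
      refine hk2 _ ?_ (Finset.sum_eq_zero_iff.1 h3 v (Finset.mem_filter.2 ⟨hv, h2.ge⟩))
      rw [values_of_support_sub r.pos.ne' h2, Multiset.map_cons] at h
      exact (Multiset.cons_inj_right _).1 h

theorem exists_values_eq (s : Multiset ℕ+) :
    ∃ α : ℕ →₀ ℕ, values α = s.map fun r : ℕ+ => (r : ℕ) := by
  obtain ⟨lam, rfl⟩ := parts_bijective.2 s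
  exact ⟨leadExp lam, by rw [values_leadExp, map_parts]⟩

/-- Take a monomial of `f` with the largest number of power sums and an exponent whose values are
its parts. Any other monomial contributing there would have at least as many factors, hence the same
parts. -/
theorem toSeries_injective : Function.Injective toSeries := by
  classical
  rw [injective_iff_map_eq_zero]
  intro f hf
  by_contra hne
  have hsupp : f.support.Nonempty := MvPolynomial.support_nonempty.2 hne
  obtain ⟨β, hβ, hmax⟩ := f.support.exists_max_image (fun β => (Finsupp.toMultiset β).card) hsupp
  obtain ⟨α, hα⟩ := exists_values_eq (Finsupp.toMultiset β)
  have hcard : α.support.card = (Finsupp.toMultiset β).card := by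
    rw [← card_values, hα, Multiset.card_map]
  have hmono : ∀ γ : ℕ+ →₀ ℕ, MvPolynomial.monomial γ (1 : Kqt) =
      ((Finsupp.toMultiset γ).map MvPolynomial.X).prod := by
    intro γ
    rw [← monomial_toFinsupp, Finsupp.toMultiset_toFinsupp]
  have h1 : MvPowerSeries.coeff α (toSeries f) = ∑ γ ∈ f.support, MvPolynomial.coeff γ f *
      MvPowerSeries.coeff α (toSeries ((Finsupp.toMultiset γ).map MvPolynomial.X).prod) := by
    conv_lhs => rw [MvPolynomial.as_sum f, map_sum, map_sum]
    refine Finset.sum_congr rfl fun γ _ => ?_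
    rw [← hmono, ← smul_eq_mul, ← map_smul, ← map_smul, MvPolynomial.smul_monomial, smul_eq_mul,
      mul_one]
  rw [hf, map_zero, Finset.sum_eq_single_of_mem β hβ] at h1
  · obtain ⟨k, hk, _, hk2⟩ := coeff_toSeries_prod_X (Finsupp.toMultiset β) α
    rw [hk] at h1
    exact mul_ne_zero (MvPolynomial.mem_support_iff.1 hβ) (Nat.cast_ne_zero.2 (hk2 hα)) h1.symm
  · intro γ hγ hne
    obtain ⟨k, hk, hk1, _⟩ := coeff_toSeries_prod_X (Finsupp.toMultiset γ) α
    rw [hk]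
    by_cases h0 : k = 0
    · rw [h0, Nat.cast_zero, mul_zero]
    · exfalso
      obtain ⟨h2, h3⟩ := hk1 h0
      have h4 := h3 (le_antisymm h2 (hcard ▸ hmax γ hγ))
      rw [hα] at h4
      exact hne (Multiset.toFinsupp.symm.injective
        (Multiset.map_injective PNat.coe_injective h4)).symm

theorem hasWeight_toSeries {f : Sym} {d : ℕ}
    (hf : MvPolynomial.IsWeightedHomogeneous (fun r : ℕ+ => (r : ℕ)) f d) :
    HasWeight Finsupp.degree d (toSeries f) :=
  hasWeight_of_isWeightedHomogeneous toSeries (fun r => by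
    rw [toSeries_X]
    exact hasWeight_degree_psumSeries _ r) hf

/-- The component of `f` of weighted degree `e` accounts for exactly the exponents of degree `e` in
the series. For `e ≠ d` its series vanishes, and injectivity of `toSeries` applies. -/
theorem isWeightedHomogeneous_of_hasWeight {f : Sym} {d : ℕ}
    (hf : HasWeight Finsupp.degree d (toSeries f)) :
    MvPolynomial.IsWeightedHomogeneous (fun r : ℕ+ => (r : ℕ)) f d := by
  classical
  have hcomp : ∀ e, e ≠ d →
      MvPolynomial.weightedHomogeneousComponent (fun r : ℕ+ => (r : ℕ)) e f = 0 := by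
    intro e he
    apply toSeries_injective
    rw [map_zero]
    ext α
    rw [map_zero]
    by_cases h : α.degree = e
    · have h1 : MvPowerSeries.coeff α (toSeries f) = MvPowerSeries.coeff α (toSeries
          (MvPolynomial.weightedHomogeneousComponent (fun r : ℕ+ => (r : ℕ)) e f)) := by
        conv_lhs => rw [MvPolynomial.as_sum f, map_sum, map_sum]
        rw [MvPolynomial.weightedHomogeneousComponent_apply, map_sum, map_sum, Finset.sum_filter]
        refine Finset.sum_congr rfl fun β _ => ?_
        split_ifs with h3
        · rfl
        · by_contra h4
          have := hasWeight_monomial toSeries (wt := fun r : ℕ+ => (r : ℕ)) (fun r => by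
            rw [toSeries_X]
            exact hasWeight_degree_psumSeries _ r) β _ α h4
          exact h3 (by rw [← this, h])
      rw [← h1]
      by_contra h2
      exact he (h ▸ hf α h2)
    · by_contra h1
      exact h (hasWeight_toSeries
        (MvPolynomial.weightedHomogeneousComponent_isWeightedHomogeneous e f) α h1)
  intro β hβ
  by_contra hne
  have := congrArg (MvPolynomial.coeff β) (hcomp _ hne)
  rw [MvPolynomial.coeff_weightedHomogeneousComponent, if_pos rfl, MvPolynomial.coeff_zero] at this
  exact hβ this

theorem weight_sum_toMultiset (s : Multiset ℕ+) :
    MvPolynomial.IsWeightedHomogeneous (fun r : ℕ+ => (r : ℕ))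
      ((s.map MvPolynomial.X).prod : Sym) (s.map fun r : ℕ+ => (r : ℕ)).sum := by
  induction s using Multiset.induction_on with
  | empty => simpa using MvPolynomial.isWeightedHomogeneous_one Kqt _
  | cons r s ih =>
    rw [Multiset.map_cons, Multiset.prod_cons, Multiset.map_cons, Multiset.sum_cons]
    exact (MvPolynomial.isWeightedHomogeneous_X Kqt _ r).mul ih

/-- Induction on the number of parts: `p_λ` is a nonzero multiple of `m_λ` plus monomial functions
with strictly fewer parts. -/
theorem exists_toSeries_eq_monoSeries (lam : YoungDiagram) :
    ∃ f : Sym, toSeries f = monoSeries Set.univ lam := by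
  classical
  induction hN : lam.rowLens.length using Nat.strong_induction_on generalizing lam with
  | _ N ih =>
  subst hN
  obtain ⟨k, hk, -, hk2⟩ := coeff_toSeries_prod_X (parts lam) (leadExp lam)
  have hk0 : (k : Kqt) ≠ 0 := Nat.cast_ne_zero.2 (hk2 (by rw [values_leadExp, map_parts]))
  change MvPowerSeries.coeff (leadExp lam) (toSeries (powerSum lam)) = k at hk
  have hmem : toSeries (powerSum lam) - (k : Kqt) • monoSeries Set.univ lam ∈
      Submodule.span Kqt (monoSeries (Set.univ : Set ℕ) ''
        {mu | mu.card ≤ lam.card ∧ mu.rowLens.length < lam.rowLens.length}) := by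
    refine mem_span_of_coeff expType leadExp _ (fun i α => ?_) _ (fun α => ?_)
      ((finite_card_le lam.card).subset fun mu h => h.1) fun α hα => ?_
    · rw [coeff_monoSeries]
    · rw [map_sub, map_sub, map_smul, map_smul, coeff_monoSeries, coeff_monoSeries,
        expType_leadExp, ← coeff_toSeries_eq_leadExp]
    · rw [map_sub, map_smul, coeff_monoSeries] at hα
      have hne : expType α ≠ lam := by
        rintro h
        rw [if_pos h, coeff_toSeries_eq_leadExp, h, hk, smul_eq_mul, mul_one, sub_self] at hα
        exact hα rfl
      rw [if_neg hne, smul_zero, sub_zero] at hα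
      have hdeg := hasWeight_toSeries (weight_sum_toMultiset (parts lam)) α hα
      rw [map_parts, ← values_leadExp, sum_values, degree_leadExp, ← card_expType] at hdeg
      refine ⟨hdeg.le, ?_⟩
      obtain ⟨l, hl, hl1, -⟩ := coeff_toSeries_prod_X (parts lam) α
      change MvPowerSeries.coeff α (toSeries (powerSum lam)) = l at hl
      have hl0 : l ≠ 0 := by
        rintro rfl
        exact hα (by rw [hl, Nat.cast_zero])
      obtain ⟨h1, h2⟩ := hl1 hl0
      have hc : ∀ mu : YoungDiagram, mu.rowLens.length = Multiset.card (mu.rowLens : Multiset ℕ) :=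
        fun mu => (Multiset.coe_card _).symm
      have hp : (parts lam).card = lam.rowLens.length := by
        rw [hc, ← map_parts, Multiset.card_map]
      rw [hp, ← card_values, ← rowLens_expType, ← hc] at h1 h2
      refine lt_of_le_of_ne h1 fun h3 => hne (expType_eq_iff.2 ?_)
      rw [← rowLens_expType, h2 h3, map_parts]
  have hle : Submodule.span Kqt (monoSeries (Set.univ : Set ℕ) ''
      {mu | mu.card ≤ lam.card ∧ mu.rowLens.length < lam.rowLens.length}) ≤
      LinearMap.range toSeries.toLinearMap := by
    rw [Submodule.span_le]
    rintro _ ⟨mu, hmu, rfl⟩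
    obtain ⟨f, hf⟩ := ih _ hmu.2 mu rfl
    exact ⟨f, hf⟩
  obtain ⟨g, hg⟩ := hle hmem
  rw [AlgHom.toLinearMap_apply] at hg
  refine ⟨(k : Kqt)⁻¹ • (powerSum lam - g), ?_⟩
  rw [map_smul, map_sub, hg, sub_sub_cancel, smul_smul, inv_mul_cancel₀ hk0, one_smul]

/-- The monomial symmetric function `m_λ`. -/
def monoSym (lam : YoungDiagram) : Sym := (exists_toSeries_eq_monoSeries lam).choose

theorem toSeries_monoSym (lam : YoungDiagram) :
    toSeries (monoSym lam) = monoSeries Set.univ lam :=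
  (exists_toSeries_eq_monoSeries lam).choose_spec

/-! ### Families that are triangular with respect to a strict order -/

section Triangular

variable {I : Type*} {r : I → I → Prop}

/-- The number of elements below `i` strictly decreases along `r`. -/
theorem wellFounded_of_finite_lower (htrans : ∀ {i j k}, r i j → r j k → r i k)
    (hirrefl : ∀ i, ¬ r i i) (hfin : ∀ i, {j | r j i}.Finite) : WellFounded r := by
  refine Subrelation.wf (r := InvImage (· < ·) fun i => {j | r j i}.ncard) ?_
    (InvImage.wf _ Nat.lt_wfRel.wf)
  intro i j hij
  refine Set.ncard_lt_ncard ⟨fun k hk => htrans hk hij, fun h => ?_⟩ (hfin j)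
  exact hirrefl i (h hij)

variable {K V : Type*} [Field K] [AddCommGroup V] [Module K V]

/-- An operator that is triangular with distinct eigenvalues on a family has eigenvectors that are
unitriangular on it. -/
theorem exists_triangular_eigenvector (htrans : ∀ {i j k}, r i j → r j k → r i k)
    (hwf : WellFounded r) (E : V →ₗ[K] V) (M : I → V) (e : I → K)
    (hE : ∀ i, E (M i) - e i • M i ∈ Submodule.span K (M '' {j | r j i}))
    (hne : ∀ i j, r j i → e j ≠ e i) (i : I) :
    ∃ P, P - M i ∈ Submodule.span K (M '' {j | r j i}) ∧ E P = e i • P := by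
  set W := Submodule.span K (M '' {j | r j i}) with hW
  set T : V →ₗ[K] V := E - e i • LinearMap.id with hT
  have hTapp : ∀ v, T v = E v - e i • v := fun v => rfl
  -- `T` acts on `M j` by the nonzero scalar `e j - e i` up to lower terms, so `T` maps `W` onto a
  -- space containing `W`. As `T (M i)` lies in `W`, it equals `T w` for some `w` in `W`, and `M i -
  -- w` is the eigenvector.
  have key : ∀ j, r j i → M j ∈ W.map T := by
    intro j
    induction j using hwf.induction with
    | _ j ih =>
    intro hj
    have h1 : Submodule.span K (M '' {k | r k j}) ≤ W.map T := by
      rw [Submodule.span_le]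
      rintro _ ⟨k, hk, rfl⟩
      exact ih k hk (htrans hk hj)
    have h2 : T (M j) ∈ W.map T :=
      Submodule.mem_map_of_mem (Submodule.subset_span ⟨j, hj, rfl⟩)
    have h3 : (e j - e i) • M j ∈ W.map T := by
      have := Submodule.sub_mem _ h2 (h1 (hE j))
      rw [hTapp] at this
      convert this using 1
      module
    have h4 : e j - e i ≠ 0 := sub_ne_zero.2 (hne i j hj)
    have h5 := Submodule.smul_mem _ (e j - e i)⁻¹ h3
    rwa [smul_smul, inv_mul_cancel₀ h4, one_smul] at h5
  have hle : W ≤ W.map T := by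
    conv_lhs => rw [hW]
    rw [Submodule.span_le]
    rintro _ ⟨j, hj, rfl⟩
    exact key j hj
  obtain ⟨w, hw, hw1⟩ := hle (hE i)
  refine ⟨M i - w, ?_, ?_⟩
  · rw [sub_sub_cancel_left]
    exact Submodule.neg_mem _ hw
  · rw [hTapp] at hw1
    rw [map_sub, smul_sub, ← sub_eq_zero, sub_sub_sub_comm, hw1, sub_self]

theorem span_le_span_of_triangular (hwf : WellFounded r) {M P : I → V}
    (hP : ∀ i, P i - M i ∈ Submodule.span K (M '' {j | r j i})) {A : Set I}
    (hA : ∀ i ∈ A, ∀ j, r j i → j ∈ A) :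
    Submodule.span K (M '' A) ≤ Submodule.span K (P '' A) := by
  rw [Submodule.span_le]
  rintro _ ⟨i, hi, rfl⟩
  induction i using hwf.induction with
  | _ i ih =>
  have h1 : Submodule.span K (M '' {j | r j i}) ≤ Submodule.span K (P '' A) := by
    rw [Submodule.span_le]
    rintro _ ⟨j, hj, rfl⟩
    exact ih j hj (hA i hi j hj)
  have h2 := Submodule.sub_mem _ (Submodule.subset_span (Set.mem_image_of_mem P hi)) (h1 (hP i))
  rwa [sub_sub_cancel] at h2

theorem linearIndependent_of_triangular (htrans : ∀ {i j k}, r i j → r j k → r i k)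
    (hirrefl : ∀ i, ¬ r i i) {M P : I → V}
    (hP : ∀ i, P i - M i ∈ Submodule.span K (M '' {j | r j i})) (coord : I → V →ₗ[K] K)
    (hcoord : ∀ i, coord i (M i) = 1) (hcoord' : ∀ i j, j ≠ i → coord i (M j) = 0) :
    LinearIndependent K P := by
  classical
  have hspan : ∀ i (A : Set I), i ∉ A → ∀ v ∈ Submodule.span K (M '' A), coord i v = 0 := by
    intro i A hi v hv
    induction hv using Submodule.span_induction with
    | mem x hx =>
      obtain ⟨j, hj, rfl⟩ := hx
      exact hcoord' i j fun h => hi (h ▸ hj)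
    | zero => exact map_zero _
    | add x y _ _ hx hy => rw [map_add, hx, hy, add_zero]
    | smul c x _ hx => rw [map_smul, hx, smul_zero]
  rw [linearIndependent_iff']
  intro s c hc
  by_contra hne
  push Not at hne
  obtain ⟨i₀, hi₀, hci₀⟩ := hne
  -- The order is flipped so that well-foundedness on the finite support yields a maximal index; the
  -- corresponding coordinate sees only that term of the relation.
  let _ : IsStrictOrder I (flip r) :=
    { irrefl := hirrefl
      trans := fun _ _ _ h1 h2 => htrans h2 h1 }
  have hwf : (↑(s.filter fun i => c i ≠ 0) : Set I).WellFoundedOn (flip r) :=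
    (s.filter fun i => c i ≠ 0).finite_toSet.wellFoundedOn
  obtain ⟨i, hi, hmin⟩ : ∃ i ∈ s.filter (fun i => c i ≠ 0),
      ∀ j ∈ s.filter (fun i => c i ≠ 0), ¬ r i j := by
    rw [Set.wellFoundedOn_iff] at hwf
    obtain ⟨i, hi, h⟩ := hwf.has_min (↑(s.filter fun i => c i ≠ 0))
      ⟨i₀, Finset.mem_coe.2 (Finset.mem_filter.2 ⟨hi₀, hci₀⟩)⟩
    exact ⟨i, hi, fun j hj hr => h j hj ⟨hr, hj, hi⟩⟩
  obtain ⟨his, hci⟩ := Finset.mem_filter.1 hi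
  have h1 := congrArg (coord i) hc
  rw [map_sum, map_zero, Finset.sum_eq_single_of_mem i his] at h1
  · have h2 := hspan i {j | r j i} (hirrefl i) _ (hP i)
    rw [map_sub, hcoord, sub_eq_zero] at h2
    rw [map_smul, h2, smul_eq_mul, mul_one] at h1
    exact hci h1
  · intro j hj hji
    rw [map_smul]
    by_cases hcj : c j = 0
    · rw [hcj, zero_smul]
    · have h2 := hspan i {k | r k j} (hmin j (Finset.mem_filter.2 ⟨hj, hcj⟩)) _ (hP j)
      rw [map_sub, hcoord' i j hji, sub_zero] at h2
      rw [h2, smul_zero]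

end Triangular

/-! ### The dominance orders -/

theorem eq_of_forall_sum_rowLen_eq {mu lam : YoungDiagram}
    (h : ∀ k, ∑ i ∈ Finset.range k, mu.rowLen i = ∑ i ∈ Finset.range k, lam.rowLen i) :
    mu = lam := by
  refine youngDiagram_ext fun i => ?_
  have := h (i + 1)
  rw [Finset.sum_range_succ, Finset.sum_range_succ, h i] at this
  omega

theorem DomLT.trans {nu mu lam : YoungDiagram} (h1 : DomLT nu mu) (h2 : DomLT mu lam) :
    DomLT nu lam := by
  refine ⟨?_, h1.2.1.trans h2.2.1, fun k => (h1.2.2 k).trans (h2.2.2 k)⟩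
  rintro rfl
  exact h1.1 (eq_of_forall_sum_rowLen_eq fun k => le_antisymm (h1.2.2 k) (h2.2.2 k))

theorem DomLT.irrefl (lam : YoungDiagram) : ¬ DomLT lam lam := fun h => h.1 rfl

theorem finite_domLT (lam : YoungDiagram) : {mu | DomLT mu lam}.Finite :=
  (finite_card_le lam.card).subset fun _ h => h.2.1.le

theorem wellFounded_domLT : WellFounded DomLT :=
  wellFounded_of_finite_lower DomLT.trans DomLT.irrefl finite_domLT

theorem multi_eq_of_forall {n : ℕ} {mu lam : Fin n → YoungDiagram}
    (h : ∀ (k : Fin n) (j : ℕ),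
      ∑ i ∈ Finset.Iio k, (mu i).card + ∑ l ∈ Finset.range j, (mu k).rowLen l =
        ∑ i ∈ Finset.Iio k, (lam i).card + ∑ l ∈ Finset.range j, (lam k).rowLen l) :
    mu = lam := by
  funext k
  refine eq_of_forall_sum_rowLen_eq fun j => ?_
  have h0 := h k 0
  have hj := h k j
  rw [Finset.range_zero, Finset.sum_empty, Finset.sum_empty] at h0
  omega

theorem MultiDomLT.trans {n : ℕ} {nu mu lam : Fin n → YoungDiagram} (h1 : MultiDomLT nu mu)
    (h2 : MultiDomLT mu lam) : MultiDomLT nu lam := by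
  refine ⟨?_, h1.2.1.trans h2.2.1, fun k j => (h1.2.2 k j).trans (h2.2.2 k j)⟩
  rintro rfl
  exact h1.1 (multi_eq_of_forall fun k j => le_antisymm (h1.2.2 k j) (h2.2.2 k j))

theorem MultiDomLT.irrefl {n : ℕ} (lam : Fin n → YoungDiagram) : ¬ MultiDomLT lam lam :=
  fun h => h.1 rfl

theorem finite_multiDomLT {n : ℕ} (lam : Fin n → YoungDiagram) :
    {mu | MultiDomLT mu lam}.Finite := by
  refine (Set.Finite.pi' fun _ : Fin n => finite_card_le (∑ i, (lam i).card)).subset ?_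
  intro mu h i
  rw [Set.mem_ofPred_eq, ← h.2.1]
  exact Finset.single_le_sum (f := fun i => (mu i).card) (fun _ _ => Nat.zero_le _)
    (Finset.mem_univ i)

theorem wellFounded_multiDomLT (n : ℕ) : WellFounded (MultiDomLT (n := n)) :=
  wellFounded_of_finite_lower MultiDomLT.trans MultiDomLT.irrefl finite_multiDomLT

/-! ### A self-adjoint operator on symmetric functions -/

section Operator

variable {K : Type*} [Field K]

/-- The translation `f ↦ f[X + (a - 1) w]`, as a polynomial in `w`. -/
def translate (a : K) : MvPolynomial ℕ+ K →ₐ[K] Polynomial (MvPolynomial ℕ+ K) :=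
  MvPolynomial.aeval fun r => Polynomial.C (MvPolynomial.X r) +
    (a ^ (r : ℕ) - 1) • (Polynomial.X : Polynomial (MvPolynomial ℕ+ K)) ^ (r : ℕ)

theorem translate_X (a : K) (r : ℕ+) : translate a (MvPolynomial.X r) =
    Polynomial.C (MvPolynomial.X r) +
      (a ^ (r : ℕ) - 1) • (Polynomial.X : Polynomial (MvPolynomial ℕ+ K)) ^ (r : ℕ) := by
  rw [translate, MvPolynomial.aeval_X]

theorem coeff_zero_translate (a : K) (f : MvPolynomial ℕ+ K) : (translate a f).coeff 0 = f := by
  have h : ((Polynomial.aeval (R := MvPolynomial ℕ+ K) (0 : MvPolynomial ℕ+ K)).restrictScalars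
      K).comp (translate a) = AlgHom.id K _ := by
    refine MvPolynomial.algHom_ext fun r => ?_
    rw [AlgHom.comp_apply, translate_X]
    simp [r.pos.ne']
  have := AlgHom.congr_fun h f
  rw [AlgHom.comp_apply, AlgHom.restrictScalars_apply, ← Polynomial.coeff_zero_eq_aeval_zero'] at this
  simpa using this

/-- The chain rule for the Euler operator `w d/dw`, since the translated `p_r` is `p_r + (a^r - 1)
w^r`. The sum over all `r` is truncated at any large `N`, because `f` involves finitely many power
sums. -/
theorem exists_derivative_translate (a : K) (f : MvPolynomial ℕ+ K) :
    ∃ N₀ : ℕ, ∀ N, N₀ ≤ N → Polynomial.X * Polynomial.derivative (translate a f) =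
      ∑ r ∈ Finset.range N, ((r.succPNat : ℕ) * (a ^ (r.succPNat : ℕ) - 1)) •
        ((Polynomial.X : Polynomial (MvPolynomial ℕ+ K)) ^ (r.succPNat : ℕ) *
          translate a (MvPolynomial.pderiv r.succPNat f)) := by
  classical
  induction f using MvPolynomial.induction_on with
  | C x =>
    refine ⟨0, fun N _ => ?_⟩
    rw [← MvPolynomial.algebraMap_eq, AlgHom.commutes]
    simp [Polynomial.algebraMap_apply]
  | add p q hp hq =>
    obtain ⟨N₁, h1⟩ := hp
    obtain ⟨N₂, h2⟩ := hq
    refine ⟨max N₁ N₂, fun N hN => ?_⟩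
    rw [map_add, map_add, mul_add, h1 N ((le_max_left _ _).trans hN),
      h2 N ((le_max_right _ _).trans hN), ← Finset.sum_add_distrib]
    refine Finset.sum_congr rfl fun r _ => ?_
    rw [map_add, map_add, mul_add, smul_add]
  | mul_X p s hp =>
    obtain ⟨N₁, h1⟩ := hp
    refine ⟨max N₁ s, fun N hN => ?_⟩
    have hs : (s : ℕ).pred ∈ Finset.range N :=
      Finset.mem_range.2 (lt_of_lt_of_le (Nat.pred_lt s.pos.ne') ((le_max_right _ _).trans hN))
    have hs' : (s : ℕ).pred.succPNat = s := PNat.succPNat_natPred s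
    have h2 : Polynomial.X * Polynomial.derivative (translate a (MvPolynomial.X s)) =
        ((s : ℕ) * (a ^ (s : ℕ) - 1)) •
          (Polynomial.X : Polynomial (MvPolynomial ℕ+ K)) ^ (s : ℕ) := by
      rw [translate_X, Polynomial.derivative_add, Polynomial.derivative_C, zero_add,
        Polynomial.derivative_smul, Polynomial.derivative_X_pow, mul_smul_comm, mul_comm (s : K),
        mul_smul, ← Nat.sub_add_cancel s.pos]
      congr 1
      rw [Nat.add_sub_cancel, pow_succ, Nat.cast_smul_eq_nsmul, nsmul_eq_mul, map_natCast]
      ring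
    rw [map_mul, Polynomial.derivative_mul, mul_add, ← mul_assoc, h1 N ((le_max_left _ _).trans hN),
      mul_left_comm, h2, Finset.sum_mul]
    have h3 : ∀ r : ℕ, translate a (MvPolynomial.pderiv r.succPNat (p * MvPolynomial.X s)) =
        translate a (MvPolynomial.pderiv r.succPNat p) * translate a (MvPolynomial.X s) +
          if r = (s : ℕ).pred then translate a p else 0 := by
      intro r
      rw [Derivation.leibniz, MvPolynomial.pderiv_X, Pi.single_apply, map_add, smul_eq_mul,
        smul_eq_mul, map_mul, map_mul, add_comm, mul_comm (translate a (MvPolynomial.X s))]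
      congr 1
      by_cases h : r = (s : ℕ).pred
      · rw [if_pos h, if_pos (by rw [h, hs']), map_one, mul_one]
      · rw [if_neg h, if_neg, map_zero, mul_zero]
        rintro rfl
        exact h rfl
    simp only [h3, mul_add, smul_add, Finset.sum_add_distrib, mul_ite, mul_zero, smul_ite, smul_zero]
    rw [Finset.sum_ite_eq', if_pos hs, hs']
    refine congrArg₂ (· + ·) ?_ ?_
    · exact Finset.sum_congr rfl fun r _ => by rw [smul_mul_assoc, mul_assoc]
    · rw [mul_smul_comm, mul_comm (translate a p)]

theorem succ_smul_coeff_translate (a : K) (k : ℕ) (f : MvPolynomial ℕ+ K) :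
    ((k : K) + 1) • (translate a f).coeff (k + 1) =
      ∑ r ∈ Finset.range (k + 1), (((r : K) + 1) * (a ^ (r + 1) - 1)) •
        (translate a (MvPolynomial.pderiv r.succPNat f)).coeff (k - r) := by
  obtain ⟨N₀, h⟩ := exists_derivative_translate a f
  have h1 := congrArg (fun p => Polynomial.coeff p (k + 1)) (h (max N₀ (k + 1)) (le_max_left _ _))
  simp only [Polynomial.coeff_X_mul, Polynomial.coeff_derivative, Polynomial.finsetSum_coeff,
    Polynomial.coeff_smul, Polynomial.coeff_X_pow_mul', Nat.succPNat_coe] at h1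
  rw [← Finset.sum_subset (Finset.range_mono (le_max_right N₀ (k + 1)))] at h1
  · have h2 : ((k : K) + 1) • (translate a f).coeff (k + 1) =
        (translate a f).coeff (k + 1) * ((k : MvPolynomial ℕ+ K) + 1) := by
      rw [mul_comm, add_smul, one_smul, add_mul, one_mul, Nat.cast_smul_eq_nsmul, nsmul_eq_mul]
    rw [h2, h1]
    refine Finset.sum_congr rfl fun r hr => ?_
    rw [if_pos (by have := Finset.mem_range.1 hr; omega)]
    push_cast
    congr 2
  · intro r _ hr
    rw [if_neg (by simpa using hr), smul_zero]

/-- The coefficients of `exp(-∑_r (1 - b^r) p_r w^r / r)`. -/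
def gCoeff (b : K) : ℕ → MvPolynomial ℕ+ K
  | 0 => 1
  | k + 1 => (-((k : K) + 1)⁻¹) • ∑ r : Fin (k + 1),
      (1 - b ^ ((r : ℕ) + 1)) • (MvPolynomial.X (r : ℕ).succPNat * gCoeff b (k - r))

theorem gCoeff_zero (b : K) : gCoeff b 0 = 1 := by rw [gCoeff]

theorem gCoeff_succ [CharZero K] (b : K) (k : ℕ) : ((k : K) + 1) • gCoeff b (k + 1) =
    -∑ r ∈ Finset.range (k + 1),
      (1 - b ^ (r + 1)) • (MvPolynomial.X r.succPNat * gCoeff b (k - r)) := by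
  have h : (k : K) + 1 ≠ 0 := by exact_mod_cast Nat.succ_ne_zero k
  rw [gCoeff, smul_smul, mul_neg, mul_inv_cancel₀ h, neg_one_smul, Finset.sum_range]

/-- The weights of the Macdonald scalar product with parameters `(a, b)`. -/
def macWeight (a b : K) (r : ℕ+) : K := (r : ℕ) * ((1 - a ^ (r : ℕ)) / (1 - b ^ (r : ℕ)))

/-- Both sides satisfy the same recursion in `k`. The adjoint of `p_r` is `r (1 - a^r) / (1 - b^r)`
times the derivative in `p_r`; the factor `1 - b^r` from `gCoeff_succ` cancels the denominator and
leaves the coefficient `r (a^r - 1)` of `succ_smul_coeff_translate`. -/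
theorem fock_gCoeff_mul [CharZero K] {a b : K} (hb : ∀ r : ℕ, b ^ (r + 1) ≠ 1) (k : ℕ)
    (f g : MvPolynomial ℕ+ K) :
    fock (macWeight a b) (gCoeff b k * f) g =
      fock (macWeight a b) f ((translate a g).coeff k) := by
  induction k using Nat.strong_induction_on generalizing f g with
  | _ k ih =>
  cases k with
  | zero => rw [gCoeff_zero, one_mul, coeff_zero_translate]
  | succ k =>
    have h : (k : K) + 1 ≠ 0 := by exact_mod_cast Nat.succ_ne_zero k
    refine mul_left_cancel₀ h ?_
    rw [← fock_smul_left, ← smul_mul_assoc, gCoeff_succ, ← fock_smul_right,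
      succ_smul_coeff_translate, neg_mul, Finset.sum_mul, ← fockForm_apply, ← fockForm_apply,
      map_neg, LinearMap.neg_apply, map_sum, map_sum, LinearMap.sum_apply, ← Finset.sum_neg_distrib]
    refine Finset.sum_congr rfl fun r _ => ?_
    rw [fockForm_apply, fockForm_apply, smul_mul_assoc, mul_assoc, fock_smul_left, fock_X_mul,
      ih (k - r) (by omega), fock_smul_right, macWeight, Nat.succPNat_coe]
    have h1 : 1 - b ^ (r + 1) ≠ 0 := sub_ne_zero.2 (hb r).symm
    push_cast
    field_simp
    ring

/-- The operator `f ↦ ∑_k b^{-k} g_k · [w^k] f[X + (a - 1) w]`. -/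
def macOp (a b : K) : MvPolynomial ℕ+ K →ₗ[K] MvPolynomial ℕ+ K :=
  (Polynomial.lsum fun k => (b⁻¹ ^ k) • LinearMap.mulLeft K (gCoeff b k)) ∘ₗ
    (translate a).toLinearMap

theorem macOp_apply (a b : K) (f : MvPolynomial ℕ+ K) {N : ℕ}
    (hN : (translate a f).natDegree < N) : macOp a b f =
      ∑ k ∈ Finset.range N, b⁻¹ ^ k • (gCoeff b k * (translate a f).coeff k) := by
  rw [macOp, LinearMap.comp_apply, AlgHom.toLinearMap_apply, Polynomial.lsum_apply,
    Polynomial.sum_over_range' _ _ N hN]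
  · rfl
  · intro k
    exact map_zero _

/-- Each summand is a scalar times an operator composed with its own adjoint, hence self-adjoint. -/
theorem fock_macOp [CharZero K] {a b : K} (hb : ∀ r : ℕ, b ^ (r + 1) ≠ 1)
    (f g : MvPolynomial ℕ+ K) :
    fock (macWeight a b) (macOp a b f) g = fock (macWeight a b) f (macOp a b g) := by
  set N := max (translate a f).natDegree (translate a g).natDegree + 1 with hN
  rw [macOp_apply a b f (N := N) (by omega), macOp_apply a b g (N := N) (by omega),
    ← fockForm_apply, ← fockForm_apply, map_sum, map_sum, LinearMap.sum_apply]
  refine Finset.sum_congr rfl fun k _ => ?_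
  rw [fockForm_apply, fockForm_apply, fock_smul_left, fock_smul_right, fock_gCoeff_mul hb,
    fock_comm _ f, fock_gCoeff_mul hb, fock_comm]

end Operator

/-! ### The operator in finitely many variables -/

section PartialFractions

variable {L σ : Type*} [Field L] [DecidableEq σ]

/-- The series `(1 - β x w) / (1 - x w)`. -/
def ratioSeries (β x : L) : PowerSeries L :=
  PowerSeries.mk fun k => if k = 0 then 1 else (1 - β) * x ^ k

theorem one_sub_mul_ratioSeries (β x : L) :
    (1 - PowerSeries.C x * PowerSeries.X) * ratioSeries β x =
      1 - PowerSeries.C (β * x) * PowerSeries.X := by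
  ext k
  rw [sub_mul, one_mul, mul_assoc, map_sub, map_sub, PowerSeries.coeff_C_mul,
    PowerSeries.coeff_C_mul, PowerSeries.coeff_X, PowerSeries.coeff_one, ratioSeries]
  rcases k with _ | _ | k
  · simp
  · simp [PowerSeries.coeff_succ_X_mul]
    ring
  · simp only [PowerSeries.coeff_succ_X_mul, PowerSeries.coeff_mk]
    simp
    ring

/-- The logarithm of the series is `log (1 - β x w) - log (1 - x w)`, and `w d/dw` turns it into `∑
(1 - β^k) x^k w^k`. Coefficientwise this is a geometric sum. -/
theorem logDeriv_ratioSeries (β x : L) :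
    PowerSeries.X * PowerSeries.derivative L (ratioSeries β x) =
      ratioSeries β x * PowerSeries.mk fun k => (1 - β ^ k) * x ^ k := by
  ext k
  rcases k with _ | k
  · simp
  rw [PowerSeries.coeff_succ_X_mul, PowerSeries.coeff_derivative, PowerSeries.coeff_mul,
    Finset.Nat.sum_antidiagonal_eq_sum_range_succ
      (fun i j => PowerSeries.coeff i (ratioSeries β x) *
        PowerSeries.coeff j (PowerSeries.mk fun k => (1 - β ^ k) * x ^ k)),
    ← Finset.sum_range_reflect, Finset.sum_range_succ]
  have h : ∀ j ∈ Finset.range (k + 1), PowerSeries.coeff (k + 1 + 1 - 1 - j) (ratioSeries β x) *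
      PowerSeries.coeff (k + 1 - (k + 1 + 1 - 1 - j))
        (PowerSeries.mk fun k => (1 - β ^ k) * x ^ k) =
      x ^ (k + 1) * ((1 - β) - (1 - β) * β ^ j) := by
    intro j hj
    have hj' := Finset.mem_range.1 hj
    rw [ratioSeries, PowerSeries.coeff_mk, PowerSeries.coeff_mk, if_neg (by omega),
      show k + 1 - (k + 1 + 1 - 1 - j) = j by omega]
    have : x ^ (k + 1) = x ^ (k + 1 + 1 - 1 - j) * x ^ j := by
      rw [← pow_add]
      congr 1
      omega
    rw [this]
    ring
  rw [Finset.sum_congr rfl h, ← Finset.mul_sum, Finset.sum_sub_distrib, ← Finset.mul_sum,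
    mul_comm (1 - β) (∑ i ∈ Finset.range (k + 1), β ^ i), geom_sum_mul_neg]
  simp [ratioSeries]
  ring

theorem logDeriv_prod_ratioSeries (β : L) (x : σ → L) (s : Finset σ) :
    PowerSeries.X * PowerSeries.derivative L (∏ i ∈ s, ratioSeries β (x i)) =
      (∏ i ∈ s, ratioSeries β (x i)) *
        PowerSeries.mk fun k => (1 - β ^ k) * ∑ i ∈ s, x i ^ k := by
  induction s using Finset.induction_on with
  | empty =>
    have : (PowerSeries.mk fun _ : ℕ => (0 : L)) = 0 := by ext; simp
    simp [this]
  | insert i s hi ih =>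
    rw [Finset.prod_insert hi, Derivation.leibniz, smul_eq_mul, smul_eq_mul, mul_add,
      mul_left_comm, ih, mul_left_comm PowerSeries.X, logDeriv_ratioSeries]
    have : (PowerSeries.mk fun k => (1 - β ^ k) * ∑ j ∈ insert i s, x j ^ k) =
        (PowerSeries.mk fun k => (1 - β ^ k) * x i ^ k) +
          PowerSeries.mk fun k => (1 - β ^ k) * ∑ j ∈ s, x j ^ k := by
      ext k
      simp [Finset.sum_insert hi]
      ring
    rw [this]
    ring

variable [Fintype σ]

/-- The coefficients of the partial fraction expansion of
`∏_i (1 - β x_i w) / (1 - x_i w)`. -/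
def fracCoeff (β : L) (x : σ → L) (i : σ) : L :=
  (1 - β) * ∏ l ∈ Finset.univ.erase i, (x i - β * x l) / (x i - x l)

/-- Partial fractions: the product equals `1 + ∑_i A_i x_i w / (1 - x_i w)` with `A_i = fracCoeff β
x i`. -/
theorem coeff_prod_ratioSeries (β : L) {x : σ → L} (hx : Function.Injective x)
    (hx0 : ∀ i, x i ≠ 0) (k : ℕ) :
    PowerSeries.coeff (k + 1) (∏ i, ratioSeries β (x i)) =
      ∑ i, fracCoeff β x i * x i ^ (k + 1) := by
  classical
  open Polynomial in
  have hdeg1 : ∀ (s : Finset σ) (y : σ → L),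
      (∏ l ∈ s, ((1 : L[X]) - C (y l) * X)).natDegree ≤ s.card := by
    intro s y
    refine (natDegree_prod_le _ _).trans ?_
    rw [Finset.card_eq_sum_ones]
    refine Finset.sum_le_sum fun l _ => ?_
    refine (natDegree_sub_le _ _).trans ?_
    rw [natDegree_one]
    exact max_le (Nat.zero_le _) ((natDegree_C_mul_le _ _).trans natDegree_X_le)
  -- The identity with cleared denominators. Both sides have degree at most the number of variables
  -- and agree at 0 and at all `1 / x_i`, which is one point more than the degree bound.
  open Polynomial in
  have hpoly : ∏ l, ((1 : L[X]) - C (β * x l) * X) = ∏ l, ((1 : L[X]) - C (x l) * X) +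
      ∑ i, C (fracCoeff β x i * x i) * X * ∏ l ∈ Finset.univ.erase i, ((1 : L[X]) - C (x l) * X) := by
    have h0 : (0 : L) ∉ Finset.univ.image fun i => (x i)⁻¹ := by
      simp [hx0]
    have hcard : (insert (0 : L) (Finset.univ.image fun i => (x i)⁻¹)).card =
        Fintype.card σ + 1 := by
      rw [Finset.card_insert_of_notMem h0, Finset.card_image_of_injective _
        (fun i j h => hx (inv_injective h)), Finset.card_univ]
    have hd : ∀ p : L[X], p.natDegree ≤ Fintype.card σ →
        p.degree < (insert (0 : L) (Finset.univ.image fun i => (x i)⁻¹)).card := by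
      intro p hp
      rw [hcard]
      exact lt_of_le_of_lt (degree_le_of_natDegree_le hp) (by exact_mod_cast Nat.lt_succ_self _)
    refine eq_of_degrees_lt_of_eval_finset_eq
      (insert (0 : L) (Finset.univ.image fun i => (x i)⁻¹)) (hd _ ?_) (hd _ ?_) ?_
    · simpa using hdeg1 Finset.univ fun l => β * x l
    · refine (natDegree_add_le _ _).trans (max_le (by simpa using hdeg1 Finset.univ x) ?_)
      refine natDegree_sum_le_of_forall_le _ _ fun i _ => ?_
      refine natDegree_mul_le.trans ?_
      have h1 := hdeg1 (Finset.univ.erase i) x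
      rw [Finset.card_erase_of_mem (Finset.mem_univ i), Finset.card_univ] at h1
      have h2 : (C (fracCoeff β x i * x i) * X : L[X]).natDegree ≤ 1 :=
        (natDegree_C_mul_le _ _).trans natDegree_X_le
      have h3 : 0 < Fintype.card σ := Fintype.card_pos_iff.2 ⟨i⟩
      omega
    · intro y hy
      rw [Finset.mem_insert] at hy
      rcases hy with rfl | hy
      · simp [eval_prod, eval_finsetSum]
      · obtain ⟨i, _, rfl⟩ := Finset.mem_image.1 hy
        have hz : ∀ s : Finset σ, i ∈ s → ∏ l ∈ s, (1 - x l * (x i)⁻¹) = 0 := fun s hs =>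
          Finset.prod_eq_zero hs (by rw [mul_inv_cancel₀ (hx0 i), sub_self])
        simp only [eval_prod, eval_add, eval_finsetSum, eval_sub, eval_one, eval_mul, eval_C,
          eval_X]
        rw [hz _ (Finset.mem_univ i), zero_add, Finset.sum_eq_single i]
        · rw [mul_assoc (fracCoeff β x i), mul_inv_cancel₀ (hx0 i), mul_one, fracCoeff, mul_assoc,
            ← Finset.prod_mul_distrib, ← Finset.mul_prod_erase _ _ (Finset.mem_univ i), mul_assoc,
            mul_inv_cancel₀ (hx0 i), mul_one]
          congr 1
          refine Finset.prod_congr rfl fun l hl => ?_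
          have h1 : x i - x l ≠ 0 :=
            sub_ne_zero.2 fun h => Finset.ne_of_mem_erase hl (hx h).symm
          have := hx0 i
          field_simp
        · intro j _ hj
          rw [hz _ (Finset.mem_erase.2 ⟨hj.symm, Finset.mem_univ i⟩), mul_zero]
        · intro h
          exact absurd (Finset.mem_univ i) h
  set D : PowerSeries L := ∏ l, (1 - PowerSeries.C (x l) * PowerSeries.X) with hD
  have hpow : (∏ l, (1 - PowerSeries.C (β * x l) * PowerSeries.X) : PowerSeries L) = D +
      ∑ i, PowerSeries.C (fracCoeff β x i * x i) * PowerSeries.X *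
        ∏ l ∈ Finset.univ.erase i, (1 - PowerSeries.C (x l) * PowerSeries.X) := by
    have := congrArg (Polynomial.coeToPowerSeries.ringHom (R := L)) hpoly
    simpa only [map_add, map_prod, map_sum, map_mul, map_sub, map_one,
      Polynomial.coeToPowerSeries.ringHom_apply, Polynomial.coe_C, Polynomial.coe_X] using this
  have hD0 : D ≠ 0 := by
    intro h
    have := congrArg (PowerSeries.constantCoeff (R := L)) h
    simp [hD, map_prod] at this
  have hgeom : ∀ y : L, (1 - PowerSeries.C y * PowerSeries.X) * PowerSeries.mk (fun k => y ^ k) =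
      1 := by
    intro y
    ext k
    rw [sub_mul, one_mul, mul_assoc, map_sub, PowerSeries.coeff_C_mul, PowerSeries.coeff_one]
    rcases k with _ | k
    · simp
    · simp [PowerSeries.coeff_succ_X_mul, pow_succ']
  have hF : ∏ i, ratioSeries β (x i) = 1 + ∑ i, PowerSeries.C (fracCoeff β x i * x i) *
      PowerSeries.X * PowerSeries.mk (fun k => x i ^ k) := by
    refine mul_left_cancel₀ hD0 ?_
    conv_lhs => rw [hD, ← Finset.prod_mul_distrib]
    rw [Finset.prod_congr rfl fun i _ => one_sub_mul_ratioSeries β (x i), hpow, mul_add, mul_one,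
      Finset.mul_sum]
    congr 1
    refine Finset.sum_congr rfl fun i _ => ?_
    rw [hD, ← Finset.mul_prod_erase _ _ (Finset.mem_univ i)]
    linear_combination (-(PowerSeries.C (fracCoeff β x i * x i) * PowerSeries.X *
      ∏ l ∈ Finset.univ.erase i, (1 - PowerSeries.C (x l) * PowerSeries.X))) * hgeom (x i)
  rw [hF, map_add, PowerSeries.coeff_one, if_neg (Nat.succ_ne_zero k), zero_add, map_sum]
  refine Finset.sum_congr rfl fun i _ => ?_
  rw [mul_assoc, PowerSeries.coeff_C_mul, PowerSeries.coeff_succ_X_mul, PowerSeries.coeff_mk,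
    pow_succ']
  ring

end PartialFractions

/-! ### Evaluation of the operator as Macdonald's difference operator -/

section Evaluation

variable {K : Type*} [Field K] {L σ : Type*} [Field L] [Algebra K L] [Fintype σ] [DecidableEq σ]

/-- The evaluation of a symmetric function at finitely many elements. -/
def evalAt (x : σ → L) : MvPolynomial ℕ+ K →ₐ[K] L :=
  MvPolynomial.aeval fun r => ∑ i, x i ^ (r : ℕ)

/-- The generating series of the `gCoeff b k` evaluates to `∏_i (1 - x_i w) / (1 - b x_i w)`;
replacing `w` by `w / b` gives the ratio series with `β = 1 / b`. The proof compares the recursions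
given by the logarithmic derivatives. -/
theorem evalAt_gCoeff [CharZero K] {b : K} (hb : b ≠ 0) (x : σ → L) (k : ℕ) :
    evalAt x (b⁻¹ ^ k • gCoeff b k) =
      PowerSeries.coeff k (∏ i, ratioSeries (algebraMap K L b⁻¹) (x i)) := by
  induction k using Nat.strong_induction_on with
  | _ k ih =>
  cases k with
  | zero => simp [gCoeff_zero, map_prod, ratioSeries]
  | succ k =>
    have : CharZero L := charZero_of_injective_algebraMap (algebraMap K L).injective
    have h : (k : L) + 1 ≠ 0 := by exact_mod_cast Nat.succ_ne_zero k
    refine mul_left_cancel₀ h ?_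
    have h1 := congrArg (PowerSeries.coeff (k + 1))
      (logDeriv_prod_ratioSeries (algebraMap K L b⁻¹) x Finset.univ)
    rw [PowerSeries.coeff_succ_X_mul, PowerSeries.coeff_derivative, PowerSeries.coeff_mul,
      Finset.Nat.sum_antidiagonal_eq_sum_range_succ
        (fun i j => PowerSeries.coeff i (∏ i, ratioSeries (algebraMap K L b⁻¹) (x i)) *
          PowerSeries.coeff j (PowerSeries.mk fun k =>
            (1 - (algebraMap K L b⁻¹) ^ k) * ∑ i, x i ^ k)),
      Finset.sum_range_succ, Nat.sub_self, PowerSeries.coeff_mk, pow_zero, sub_self, zero_mul,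
      mul_zero, add_zero, mul_comm] at h1
    rw [h1]
    have h2 := congrArg (fun f => evalAt x (b⁻¹ ^ (k + 1) • f)) (gCoeff_succ b k)
    simp only [smul_comm _ ((k : K) + 1)] at h2
    rw [map_smul, Algebra.smul_def, map_add, map_natCast, map_one] at h2
    rw [h2, ← Finset.sum_range_reflect, smul_neg, Finset.smul_sum, map_neg, map_sum,
      ← Finset.sum_neg_distrib]
    refine Finset.sum_congr rfl fun r hr => ?_
    have hr' := Finset.mem_range.1 hr
    rw [← ih r (by omega), PowerSeries.coeff_mk, show k + 1 - 1 - r = k - r by omega,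
      show k - (k - r) = r by omega]
    simp only [map_smul, map_mul, evalAt, MvPolynomial.aeval_X, Nat.succPNat_coe]
    simp only [Algebra.smul_def, map_sub, map_one, map_pow, map_inv₀]
    rw [show (k - r).succ = k + 1 - r by omega, show k - r + 1 = k + 1 - r by omega]
    have hb' : algebraMap K L b ≠ 0 := (map_ne_zero _).2 hb
    have h3 : (algebraMap K L b)⁻¹ ^ (k + 1) * (1 - algebraMap K L b ^ (k + 1 - r)) =
        -((algebraMap K L b)⁻¹ ^ r * (1 - (algebraMap K L b)⁻¹ ^ (k + 1 - r))) := by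
      obtain ⟨m, hm⟩ : ∃ m, k + 1 = r + m := ⟨k + 1 - r, by omega⟩
      have h4 : algebraMap K L b ^ m * (algebraMap K L b)⁻¹ ^ m = 1 := by
        rw [← mul_pow, mul_inv_cancel₀ hb', one_pow]
      rw [hm, Nat.add_sub_cancel_left, pow_add]
      linear_combination (-((algebraMap K L b)⁻¹ ^ r)) * h4
    linear_combination (-((∑ i, x i ^ (k + 1 - r)) *
      (MvPolynomial.aeval fun r : ℕ+ => ∑ i, x i ^ (r : ℕ)) (gCoeff b r))) * h3

theorem evalAt_macOp [CharZero K] {a b : K} (hb : b ≠ 0) {x : σ → L} (hx : Function.Injective x)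
    (hx0 : ∀ i, x i ≠ 0) (f : MvPolynomial ℕ+ K) :
    evalAt x (macOp a b f) = evalAt x f + ∑ i, fracCoeff (algebraMap K L b⁻¹) x i *
      (evalAt (Function.update x i (algebraMap K L a * x i)) f - evalAt x f) := by
  -- Adding `(a - 1) w` to the alphabet at `w = x_i` replaces `x_i` by `a x_i`. Together with the
  -- partial fractions, this converts the sum over `k` in `macOp` into a sum over variables.
  have hT : ∀ i, evalAt (Function.update x i (algebraMap K L a * x i)) f =
      Polynomial.eval₂ (evalAt x : MvPolynomial ℕ+ K →ₐ[K] L).toRingHom (x i) (translate a f) := by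
    intro i
    induction f using MvPolynomial.induction_on with
    | C y =>
      rw [← MvPolynomial.algebraMap_eq, AlgHom.commutes, AlgHom.commutes,
        Polynomial.algebraMap_apply, Polynomial.eval₂_C]
      exact ((evalAt x).commutes y).symm
    | add p q hp hq => rw [map_add, map_add, Polynomial.eval₂_add, hp, hq]
    | mul_X p r hp =>
      rw [map_mul, map_mul, Polynomial.eval₂_mul, hp]
      congr 1
      rw [translate_X, Polynomial.eval₂_add, Polynomial.eval₂_C, Algebra.smul_def,
        Polynomial.algebraMap_apply, Polynomial.eval₂_mul, Polynomial.eval₂_C,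
        Polynomial.eval₂_X_pow]
      have h1 : (evalAt x : MvPolynomial ℕ+ K →ₐ[K] L).toRingHom (MvPolynomial.X r) =
          ∑ i, x i ^ (r : ℕ) := MvPolynomial.aeval_X _ _
      have h2 : (evalAt x : MvPolynomial ℕ+ K →ₐ[K] L).toRingHom
          (algebraMap K (MvPolynomial ℕ+ K) (a ^ (r : ℕ) - 1)) =
          algebraMap K L (a ^ (r : ℕ) - 1) := (evalAt x).commutes _
      rw [h1, h2, evalAt, MvPolynomial.aeval_X, ← Finset.add_sum_erase _ _ (Finset.mem_univ i),
        ← Finset.add_sum_erase _ (fun i => x i ^ (r : ℕ)) (Finset.mem_univ i),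
        Function.update_self, Finset.sum_congr rfl fun l hl => by
          rw [Function.update_of_ne (Finset.ne_of_mem_erase hl)]]
      rw [map_sub, map_pow, map_one]
      ring
  obtain ⟨M, hM⟩ : ∃ M, (translate a f).natDegree < M + 1 := ⟨_, Nat.lt_succ_self _⟩
  rw [macOp_apply a b f hM, map_sum, Finset.sum_range_succ']
  have hcoeff : ∀ k, evalAt x (b⁻¹ ^ k • (gCoeff b k * (translate a f).coeff k)) =
      PowerSeries.coeff k (∏ i, ratioSeries (algebraMap K L b⁻¹) (x i)) *
        evalAt x ((translate a f).coeff k) := by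
    intro k
    rw [← smul_mul_assoc, map_mul, evalAt_gCoeff hb]
  simp only [hcoeff, hT, coeff_prod_ratioSeries _ hx hx0]
  rw [coeff_zero_translate, add_comm]
  congr 1
  · simp [map_prod, ratioSeries]
  · simp only [Finset.sum_mul]
    rw [Finset.sum_comm]
    refine Finset.sum_congr rfl fun i _ => ?_
    rw [Polynomial.eval₂_eq_sum_range' _ hM, Finset.sum_range_succ', coeff_zero_translate, pow_zero,
      mul_one]
    have : (evalAt x : MvPolynomial ℕ+ K →ₐ[K] L).toRingHom f = evalAt x f := rfl
    rw [this, add_sub_cancel_right, Finset.mul_sum]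
    refine Finset.sum_congr rfl fun k _ => ?_
    have : (evalAt x : MvPolynomial ℕ+ K →ₐ[K] L).toRingHom ((translate a f).coeff (k + 1)) =
      evalAt x ((translate a f).coeff (k + 1)) := rfl
    rw [this]
    ring

end Evaluation

/-! ### Leading exponents -/

section Leading

variable {σ J : Type}

/-- The exponent `β` dominates all exponents of `F` with respect to the functionals `w`, and its
coefficient is `c`. -/
def LeadsAt (w : J → (σ →₀ ℕ) →+ ℕ) (F : MvPowerSeries σ Kqt) (β : σ →₀ ℕ) (c : Kqt) : Prop :=
  MvPowerSeries.coeff β F = c ∧ ∀ α, MvPowerSeries.coeff α F ≠ 0 → ∀ j, w j α ≤ w j β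

/-- If two exponents add up to `β + γ`, the bounds from both factors must all be equalities. The
functionals separate exponents, so only one product contributes. -/
theorem LeadsAt.mul {w : J → (σ →₀ ℕ) →+ ℕ} (hw : ∀ α β, (∀ j, w j α = w j β) → α = β)
    {F G : MvPowerSeries σ Kqt} {β γ : σ →₀ ℕ} {c d : Kqt} (hF : LeadsAt w F β c)
    (hG : LeadsAt w G γ d) : LeadsAt w (F * G) (β + γ) (c * d) := by
  classical
  refine ⟨?_, fun α h j => ?_⟩
  · rw [MvPowerSeries.coeff_mul, Finset.sum_eq_single_of_mem (β, γ)
      (Finset.HasAntidiagonal.mem_antidiagonal.2 rfl), hF.1, hG.1]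
    rintro ⟨β', γ'⟩ hp hne
    by_contra h
    have h1 := hF.2 β' (left_ne_zero_of_mul h)
    have h2 := hG.2 γ' (right_ne_zero_of_mul h)
    have h3 : β' + γ' = β + γ := Finset.HasAntidiagonal.mem_antidiagonal.1 hp
    have h4 : ∀ j, w j β' + w j γ' = w j β + w j γ := fun j => by rw [← map_add, h3, map_add]
    refine hne (Prod.ext (hw _ _ fun j => ?_) (hw _ _ fun j => ?_))
    · have := h1 j; have := h2 j; have := h4 j
      change w j β' = w j β
      omega
    · have := h1 j; have := h2 j; have := h4 j
      change w j γ' = w j γ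
      omega
  · obtain ⟨β', γ', rfl, h1, h2⟩ := exists_of_coeff_mul_ne_zero h
    rw [map_add, map_add]
    exact Nat.add_le_add (hF.2 β' h1 j) (hG.2 γ' h2 j)

theorem LeadsAt.one (w : J → (σ →₀ ℕ) →+ ℕ) : LeadsAt w 1 0 1 := by
  classical
  refine ⟨by rw [MvPowerSeries.coeff_one, if_pos rfl], fun α h j => ?_⟩
  rw [MvPowerSeries.coeff_one] at h
  rw [(ite_ne_right_iff.1 h).1]

theorem LeadsAt.prod {w : J → (σ →₀ ℕ) →+ ℕ} (hw : ∀ α β, (∀ j, w j α = w j β) → α = β)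
    {ι : Type} (s : Finset ι) {F : ι → MvPowerSeries σ Kqt} {β : ι → σ →₀ ℕ} {c : ι → Kqt}
    (h : ∀ i ∈ s, LeadsAt w (F i) (β i) (c i)) :
    LeadsAt w (∏ i ∈ s, F i) (∑ i ∈ s, β i) (∏ i ∈ s, c i) := by
  classical
  induction s using Finset.induction_on with
  | empty => exact LeadsAt.one w
  | insert a s ha ih =>
    rw [Finset.prod_insert ha, Finset.sum_insert ha, Finset.prod_insert ha]
    exact (h a (Finset.mem_insert_self a s)).mul hw
      (ih fun i hi => h i (Finset.mem_insert_of_mem hi))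

theorem LeadsAt.smul {w : J → (σ →₀ ℕ) →+ ℕ} {F : MvPowerSeries σ Kqt} {β : σ →₀ ℕ} {c : Kqt}
    (hF : LeadsAt w F β c) (x : Kqt) : LeadsAt w (x • F) β (x * c) := by
  refine ⟨by rw [map_smul, hF.1, smul_eq_mul], fun α h => hF.2 α ?_⟩
  rw [map_smul] at h
  exact right_ne_zero_of_smul h

theorem LeadsAt.add {w : J → (σ →₀ ℕ) →+ ℕ} {F G : MvPowerSeries σ Kqt} {β : σ →₀ ℕ}
    {c d : Kqt} (hF : LeadsAt w F β c) (hG : LeadsAt w G β d) : LeadsAt w (F + G) β (c + d) := by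
  refine ⟨by rw [map_add, hF.1, hG.1], fun α h => ?_⟩
  rw [map_add] at h
  by_cases h1 : MvPowerSeries.coeff α F = 0
  · exact hG.2 α fun h2 => h (by rw [h1, h2, add_zero])
  · exact hF.2 α h1

theorem LeadsAt.sum {w : J → (σ →₀ ℕ) →+ ℕ} {ι : Type} (s : Finset ι)
    {F : ι → MvPowerSeries σ Kqt} {β : σ →₀ ℕ} {c : ι → Kqt}
    (h : ∀ i ∈ s, LeadsAt w (F i) β (c i)) : LeadsAt w (∑ i ∈ s, F i) β (∑ i ∈ s, c i) := by
  classical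
  induction s using Finset.induction_on with
  | empty => exact ⟨map_zero _, fun α h => absurd (map_zero _) h⟩
  | insert a s ha ih =>
    rw [Finset.sum_insert ha, Finset.sum_insert ha]
    exact (h a (Finset.mem_insert_self a s)).add
      (ih fun i hi => h i (Finset.mem_insert_of_mem hi))

/-- The polynomial `p`, graded by the functional `w`. -/
def gradeBy (w : (σ →₀ ℕ) →+ ℕ) :
    MvPolynomial σ Kqt →ₐ[Kqt] Polynomial (MvPolynomial σ Kqt) :=
  MvPolynomial.aeval fun i =>
    Polynomial.C (MvPolynomial.X i) * Polynomial.X ^ w (Finsupp.single i 1)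

theorem gradeBy_monomial (w : (σ →₀ ℕ) →+ ℕ) (α : σ →₀ ℕ) (c : Kqt) :
    gradeBy w (MvPolynomial.monomial α c) =
      Polynomial.C (MvPolynomial.monomial α c) * Polynomial.X ^ w α := by
  induction α using Finsupp.induction generalizing c with
  | zero =>
    rw [map_zero, pow_zero, mul_one, ← MvPolynomial.C_apply, ← MvPolynomial.algebraMap_eq,
      AlgHom.commutes, Polynomial.algebraMap_apply]
  | single_add i k α _ _ ih =>
    rw [← one_mul c, ← MvPolynomial.monomial_mul, map_mul, ih, map_mul,
      ← MvPolynomial.X_pow_eq_monomial, map_pow, gradeBy, MvPolynomial.aeval_X, map_pow, map_add,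
      mul_pow, ← pow_mul, pow_add,
      show w (Finsupp.single i k) = w (Finsupp.single i 1) * k by
        rw [mul_comm, ← smul_eq_mul, ← map_nsmul, Finsupp.smul_single, smul_eq_mul, mul_one]]
    ring

theorem coeff_coeff_gradeBy (w : (σ →₀ ℕ) →+ ℕ) (p : MvPolynomial σ Kqt) (k : ℕ)
    (α : σ →₀ ℕ) : MvPolynomial.coeff α ((gradeBy w p).coeff k) =
      if w α = k then MvPolynomial.coeff α p else 0 := by
  classical
  induction p using MvPolynomial.induction_on' with
  | monomial β c =>
    rw [gradeBy_monomial, Polynomial.coeff_C_mul, Polynomial.coeff_X_pow, mul_ite, mul_one,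
      mul_zero, MvPolynomial.coeff_monomial]
    by_cases h : β = α
    · subst h
      by_cases h1 : w β = k
      · rw [if_pos h1.symm, if_pos h1, MvPolynomial.coeff_monomial]
      · rw [if_neg (Ne.symm h1), if_neg h1, MvPolynomial.coeff_zero]
    · rw [if_neg h, ite_self]
      split_ifs
      · rw [MvPolynomial.coeff_monomial, if_neg h]
      · exact MvPolynomial.coeff_zero _
  | add p q hp hq =>
    rw [map_add, Polynomial.coeff_add, MvPolynomial.coeff_add, hp, hq, MvPolynomial.coeff_add]
    split_ifs
    · rfl
    · exact add_zero _

/-- Grading by `w` gives polynomials in one variable over a domain, where degrees add. This allows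
bounds on exponents to survive division by `p`. -/
theorem le_of_mul_bounded (w : (σ →₀ ℕ) →+ ℕ) {p h : MvPolynomial σ Kqt} {B : ℕ}
    {δ : σ →₀ ℕ} (hδ : MvPolynomial.coeff δ p ≠ 0)
    (hb : ∀ α, MvPolynomial.coeff α (p * h) ≠ 0 → w α ≤ w δ + B) {α : σ →₀ ℕ}
    (hα : MvPolynomial.coeff α h ≠ 0) : w α ≤ B := by
  have hnz : ∀ (q : MvPolynomial σ Kqt) γ, MvPolynomial.coeff γ q ≠ 0 →
      (gradeBy w q).coeff (w γ) ≠ 0 := by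
    intro q γ hγ h0
    have := coeff_coeff_gradeBy w q (w γ) γ
    rw [h0, MvPolynomial.coeff_zero, if_pos rfl] at this
    exact hγ this.symm
  have h1 := Polynomial.le_natDegree_of_ne_zero (hnz p δ hδ)
  have h2 := Polynomial.le_natDegree_of_ne_zero (hnz h α hα)
  have h3 : (gradeBy w (p * h)).natDegree ≤ w δ + B := by
    rw [Polynomial.natDegree_le_iff_coeff_eq_zero]
    intro k hk
    ext γ
    rw [coeff_coeff_gradeBy, MvPolynomial.coeff_zero]
    split_ifs with hγ
    · by_contra h4
      have := hb γ h4
      omega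
    · rfl
  rw [map_mul, Polynomial.natDegree_mul] at h3
  · omega
  · intro h0
    exact hnz p δ hδ (by rw [h0, Polynomial.coeff_zero])
  · intro h0
    exact hnz h α hα (by rw [h0, Polynomial.coeff_zero])

theorem hasWeight_coe_iff (w : (σ →₀ ℕ) →+ ℕ) (d : ℕ) (p : MvPolynomial σ Kqt) :
    HasWeight w d (p : MvPowerSeries σ Kqt) ↔
      gradeBy w p = Polynomial.C p * Polynomial.X ^ d := by
  constructor
  · intro h
    ext k α
    rw [coeff_coeff_gradeBy, Polynomial.coeff_C_mul, Polynomial.coeff_X_pow, mul_ite, mul_one,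
      mul_zero]
    by_cases h1 : MvPolynomial.coeff α p = 0
    · split_ifs <;> simp [h1]
    · have h2 := h α (by rwa [MvPolynomial.coeff_coe])
      rw [h2]
      by_cases h3 : d = k
      · rw [if_pos h3, if_pos h3.symm]
      · rw [if_neg h3, if_neg (Ne.symm h3), MvPolynomial.coeff_zero]
  · intro h α hα
    rw [MvPolynomial.coeff_coe] at hα
    have h1 := coeff_coeff_gradeBy w p (w α) α
    rw [h, if_pos rfl, Polynomial.coeff_C_mul, Polynomial.coeff_X_pow, mul_ite, mul_one,
      mul_zero] at h1
    by_contra h2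
    rw [if_neg h2, MvPolynomial.coeff_zero] at h1
    exact hα h1.symm

theorem hasWeight_of_mul (w : (σ →₀ ℕ) →+ ℕ) {d e : ℕ} {p h : MvPolynomial σ Kqt} (hp : p ≠ 0)
    (h1 : HasWeight w d (p : MvPowerSeries σ Kqt))
    (h2 : HasWeight w (d + e) ((p * h : MvPolynomial σ Kqt) : MvPowerSeries σ Kqt)) :
    HasWeight w e (h : MvPowerSeries σ Kqt) := by
  rw [hasWeight_coe_iff] at *
  have h3 : Polynomial.C p * Polynomial.X ^ d ≠ 0 :=
    mul_ne_zero (Polynomial.C_ne_zero.2 hp) (pow_ne_zero _ Polynomial.X_ne_zero)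
  refine mul_left_cancel₀ h3 ?_
  rw [← h1, ← map_mul, h2, h1, map_mul, pow_add]
  ring

end Leading

/-! ### Triangularity of the operator on monomial symmetric functions -/

/-- The sum of the first `j` exponents. -/
def initSum (j : ℕ) : (ℕ →₀ ℕ) →+ ℕ := ∑ i ∈ Finset.range j, Finsupp.applyAddHom i

theorem initSum_apply (j : ℕ) (α : ℕ →₀ ℕ) : initSum j α = ∑ i ∈ Finset.range j, α i := by
  rw [initSum, AddMonoidHom.finsetSum_apply]
  rfl

theorem initSum_single (j i k : ℕ) :
    initSum j (Finsupp.single i k) = if i < j then k else 0 := by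
  classical
  rw [initSum_apply]
  simp only [Finsupp.single_apply]
  rw [Finset.sum_ite_eq]
  simp

theorem initSum_separating (α β : ℕ →₀ ℕ) (h : ∀ j, initSum j α = initSum j β) : α = β := by
  ext i
  have := h (i + 1)
  rw [initSum_apply, initSum_apply, Finset.sum_range_succ, Finset.sum_range_succ, ← initSum_apply,
    ← initSum_apply, h i] at this
  omega

theorem initSum_le_of_expType (α : ℕ →₀ ℕ) (j : ℕ) :
    initSum j α ≤ ∑ i ∈ Finset.range j, (expType α).rowLen i := by
  rw [initSum_apply]
  exact sum_le_of_expType _ (Finset.card_range j).le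

/-! ### Leading terms of the difference operator in finitely many variables -/

section FiniteVariables

variable {N : ℕ}

/-- The extension of exponents by zero. -/
def extendExp (N : ℕ) : (Fin N →₀ ℕ) →+ (ℕ →₀ ℕ) :=
  Finsupp.mapDomain.addMonoidHom (Fin.valEmbedding : Fin N ↪ ℕ)

theorem extendExp_apply (α : Fin N →₀ ℕ) :
    extendExp N α = Finsupp.embDomain Fin.valEmbedding α :=
  (Finsupp.embDomain_eq_mapDomain _ _).symm

theorem extendExp_injective : Function.Injective (extendExp N) := fun α β h =>
  Finsupp.embDomain_injective Fin.valEmbedding (by rwa [← extendExp_apply, ← extendExp_apply])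

theorem extendExp_coe (α : Fin N →₀ ℕ) (i : Fin N) : extendExp N α (i : ℕ) = α i := by
  rw [extendExp_apply]
  exact Finsupp.embDomain_apply_self Fin.valEmbedding α i

theorem degree_extendExp (α : Fin N →₀ ℕ) : (extendExp N α).degree = α.degree :=
  Finsupp.degree_mapDomain _ _

/-- The sum of the first `j` exponents, in finitely many variables. -/
def initSumFin (N j : ℕ) : (Fin N →₀ ℕ) →+ ℕ := (initSum j).comp (extendExp N)

theorem initSumFin_apply (j : ℕ) (α : Fin N →₀ ℕ) :
    initSumFin N j α = initSum j (extendExp N α) := rfl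

theorem initSumFin_single (j : ℕ) (i : Fin N) (k : ℕ) :
    initSumFin N j (Finsupp.single i k) = if (i : ℕ) < j then k else 0 := by
  rw [initSumFin_apply, extendExp_apply, Finsupp.embDomain_single, initSum_single]
  rfl

theorem initSumFin_separating (α β : Fin N →₀ ℕ)
    (h : ∀ j, initSumFin N j α = initSumFin N j β) : α = β :=
  extendExp_injective (initSum_separating _ _ h)

theorem exists_extendExp_eq {lam : YoungDiagram} (h : lam.colLen 0 ≤ N) :
    ∃ α : Fin N →₀ ℕ, extendExp N α = leadExp lam := by
  have : leadExp lam ∈ Set.range (Finsupp.embDomain (Fin.valEmbedding : Fin N ↪ ℕ) (M := ℕ)) := by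
    rw [Finsupp.mem_range_embDomain_iff, leadExp_support]
    intro i hi
    have hi' := Finset.mem_range.1 (Finset.mem_coe.1 hi)
    exact ⟨⟨i, by omega⟩, rfl⟩
  obtain ⟨α, hα⟩ := this
  exact ⟨α, by rw [extendExp_apply, hα]⟩

/-- The symmetric polynomial in `N` variables of a symmetric function. -/
def polyEval (N : ℕ) : Sym →ₐ[Kqt] MvPolynomial (Fin N) Kqt :=
  MvPolynomial.aeval fun r => ∑ i, MvPolynomial.X i ^ (r : ℕ)

theorem coe_polyEval (f : Sym) : (polyEval N f : MvPowerSeries (Fin N) Kqt) =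
    MvPowerSeries.killCompl Fin.valEmbedding (toSeries f) := by
  classical
  have h : (MvPolynomial.coeToMvPowerSeries.algHom Kqt).comp (polyEval N) =
      (MvPowerSeries.killCompl (Fin.valEmbedding : Fin N ↪ ℕ)).comp toSeries := by
    refine MvPolynomial.algHom_ext fun r => ?_
    rw [AlgHom.comp_apply, AlgHom.comp_apply, toSeries_X, killCompl_psumSeries, polyEval,
      MvPolynomial.aeval_X]
    ext α
    rw [MvPolynomial.coeToMvPowerSeries.algHom_apply, Algebra.algebraMap_self, MvPowerSeries.map_id,
      RingHom.id_apply, MvPolynomial.coeff_coe, MvPolynomial.coeff_sum]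
    simp only [MvPolynomial.coeff_X_pow]
    by_cases hα : ∃ v : Fin N, α = Finsupp.single v (r : ℕ)
    · obtain ⟨v, rfl⟩ := hα
      rw [coeff_single_psumSeries r (by trivial), Finset.sum_eq_single v, if_pos rfl]
      · intro u _ hu
        rw [if_neg fun h => hu (Finsupp.single_left_injective r.pos.ne' h)]
      · intro hv
        exact absurd (Finset.mem_univ v) hv
    · rw [Finset.sum_eq_zero fun v _ => if_neg fun h => hα ⟨v, h.symm⟩]
      by_contra h1
      obtain ⟨v, _, h2⟩ := exists_of_coeff_psumSeries_ne_zero (Ne.symm h1)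
      exact hα ⟨v, h2⟩
  have h1 := AlgHom.congr_fun h f
  rw [AlgHom.comp_apply, AlgHom.comp_apply, MvPolynomial.coeToMvPowerSeries.algHom_apply,
    Algebra.algebraMap_self, MvPowerSeries.map_id, RingHom.id_apply] at h1
  exact h1

theorem coeff_polyEval (f : Sym) (α : Fin N →₀ ℕ) : MvPolynomial.coeff α (polyEval N f) =
    MvPowerSeries.coeff (extendExp N α) (toSeries f) := by
  rw [← MvPolynomial.coeff_coe, coe_polyEval, MvPowerSeries.coeff_killCompl, extendExp_apply]

/-- The substitution `x_i ↦ a x_i`. -/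
def scaleVar (a : Kqt) (i : Fin N) : MvPolynomial (Fin N) Kqt →ₐ[Kqt] MvPolynomial (Fin N) Kqt :=
  MvPolynomial.aeval (Function.update MvPolynomial.X i (a • MvPolynomial.X i))

theorem coeff_scaleVar (a : Kqt) (i : Fin N) (g : MvPolynomial (Fin N) Kqt) (α : Fin N →₀ ℕ) :
    MvPolynomial.coeff α (scaleVar a i g) = a ^ α i * MvPolynomial.coeff α g := by
  classical
  have hmono : ∀ (β : Fin N →₀ ℕ) (c : Kqt),
      scaleVar a i (MvPolynomial.monomial β c) = a ^ β i • MvPolynomial.monomial β c := by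
    intro β c
    rw [scaleVar, MvPolynomial.aeval_monomial, MvPolynomial.monomial_eq, MvPolynomial.algebraMap_eq,
      ← mul_smul_comm, Finsupp.prod_fintype _ _ (fun _ => pow_zero _),
      Finsupp.prod_fintype _ _ (fun _ => pow_zero _)]
    congr 1
    rw [← Finset.mul_prod_erase _ _ (Finset.mem_univ i),
      ← Finset.mul_prod_erase _ (fun i => (MvPolynomial.X i : MvPolynomial (Fin N) Kqt) ^ β i)
        (Finset.mem_univ i), Function.update_self, smul_pow, smul_mul_assoc]
    congr 2
    refine Finset.prod_congr rfl fun l hl => ?_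
    rw [Function.update_of_ne (Finset.ne_of_mem_erase hl)]
  induction g using MvPolynomial.induction_on' with
  | monomial β c =>
    rw [hmono, MvPolynomial.coeff_smul, MvPolynomial.coeff_monomial, smul_eq_mul]
    split_ifs with h
    · rw [h]
    · rw [mul_zero, mul_zero]
  | add p q hp hq => rw [map_add, MvPolynomial.coeff_add, hp, hq, MvPolynomial.coeff_add, mul_add]

/-- The linear form `x_i - β x_l`. -/
def linForm (β : Kqt) (i l : Fin N) : MvPolynomial (Fin N) Kqt :=
  MvPolynomial.X i - β • MvPolynomial.X l

/-- The product of all differences of two variables. -/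
def discPoly (N : ℕ) : MvPolynomial (Fin N) Kqt :=
  ∏ i, ∏ l ∈ Finset.univ.erase i, linForm 1 i l

/-- The numerator of the coefficient of `T_i` in Macdonald's operator over the common
denominator `discPoly N`. -/
def numPoly (β : Kqt) (i : Fin N) : MvPolynomial (Fin N) Kqt :=
  (1 - β) • ((∏ l ∈ Finset.univ.erase i, linForm β i l) *
    ∏ k ∈ Finset.univ.erase i, ∏ l ∈ Finset.univ.erase k, linForm 1 k l)

/-- The difference operator has denominators `x_i - x_l`. The identity `evalAt_macOp` is applied in
the fraction field, with the variables as points, and multiplied by the common denominator. -/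
theorem discPoly_mul_polyEval_macOp {a b : Kqt} (hb : b ≠ 0) (f : Sym) :
    discPoly N * polyEval N (macOp a b f) = discPoly N * polyEval N f +
      ∑ i, numPoly b⁻¹ i * (scaleVar a i (polyEval N f) - polyEval N f) := by
  set L := FractionRing (MvPolynomial (Fin N) Kqt)
  have hinj : Function.Injective (algebraMap (MvPolynomial (Fin N) Kqt) L) :=
    IsFractionRing.injective _ _
  set x : Fin N → L := fun i => algebraMap (MvPolynomial (Fin N) Kqt) L (MvPolynomial.X i) with hxdef
  have hx : Function.Injective x := fun i j h => MvPolynomial.X_injective (hinj h)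
  have hx0 : ∀ i, x i ≠ 0 := fun i h =>
    MvPolynomial.X_ne_zero i (hinj (by rw [map_zero]; exact h))
  have halg : ∀ c : Kqt, algebraMap (MvPolynomial (Fin N) Kqt) L (algebraMap Kqt _ c) =
      algebraMap Kqt L c := fun c => (IsScalarTower.algebraMap_apply _ _ _ c).symm
  have hev : ∀ g : Sym, evalAt x g = algebraMap (MvPolynomial (Fin N) Kqt) L (polyEval N g) := by
    intro g
    have : (evalAt x : Sym →ₐ[Kqt] L) =
        (IsScalarTower.toAlgHom Kqt (MvPolynomial (Fin N) Kqt) L).comp (polyEval N) := by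
      refine MvPolynomial.algHom_ext fun r => ?_
      simp [evalAt, polyEval, hxdef]
    rw [this]
    rfl
  have hsc : ∀ (i : Fin N) (g : Sym), evalAt (Function.update x i (algebraMap Kqt L a * x i)) g =
      algebraMap (MvPolynomial (Fin N) Kqt) L (scaleVar a i (polyEval N g)) := by
    intro i g
    have : (evalAt (Function.update x i (algebraMap Kqt L a * x i)) : Sym →ₐ[Kqt] L) =
        (IsScalarTower.toAlgHom Kqt (MvPolynomial (Fin N) Kqt) L).comp
          ((scaleVar a i).comp (polyEval N)) := by
      refine MvPolynomial.algHom_ext fun r => ?_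
      simp only [AlgHom.comp_apply, evalAt, polyEval, MvPolynomial.aeval_X, map_sum, map_pow,
        scaleVar]
      refine Finset.sum_congr rfl fun l _ => ?_
      congr 1
      by_cases h : l = i
      · subst h
        rw [Function.update_self, Function.update_self, Algebra.smul_def, map_mul]
        exact congrArg (· * x l) (halg a).symm
      · rw [Function.update_of_ne h, Function.update_of_ne h]
        rfl
    rw [this]
    rfl
  have hlin : ∀ (β : Kqt) (i l : Fin N), algebraMap (MvPolynomial (Fin N) Kqt) L (linForm β i l) =
      x i - algebraMap Kqt L β * x l := by
    intro β i l
    rw [linForm, Algebra.smul_def, map_sub, map_mul, halg]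
  have hnum : ∀ i, algebraMap (MvPolynomial (Fin N) Kqt) L (numPoly b⁻¹ i) =
      algebraMap (MvPolynomial (Fin N) Kqt) L (discPoly N) * fracCoeff (algebraMap Kqt L b⁻¹) x i := by
    intro i
    rw [numPoly, discPoly, ← Finset.mul_prod_erase _ _ (Finset.mem_univ i), Algebra.smul_def,
      fracCoeff, Finset.prod_div_distrib, map_mul, map_mul, map_mul, halg, map_sub, map_one]
    simp only [map_prod, hlin, map_one, one_mul]
    have hne : ∏ l ∈ Finset.univ.erase i, (x i - x l) ≠ 0 :=
      Finset.prod_ne_zero_iff.2 fun l hl =>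
        sub_ne_zero.2 fun h => Finset.ne_of_mem_erase hl (hx h).symm
    generalize ∏ l ∈ Finset.univ.erase i, (x i - x l) = D at hne ⊢
    generalize ∏ l ∈ Finset.univ.erase i, (x i - algebraMap Kqt L b⁻¹ * x l) = P
    generalize ∏ k ∈ Finset.univ.erase i, ∏ l ∈ Finset.univ.erase k, (x k - x l) = Q
    have h1 := div_mul_cancel₀ P hne
    linear_combination (-(1 - algebraMap Kqt L b⁻¹) * Q) * h1
  apply hinj
  rw [map_mul, ← hev, evalAt_macOp hb hx hx0, map_add, map_mul, map_sum, hev, mul_add,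
    Finset.mul_sum]
  congr 1
  refine Finset.sum_congr rfl fun i _ => ?_
  rw [map_mul, map_sub, ← hsc, hnum, mul_assoc]

/-- The leading coefficient of `linForm β i l`. -/
def linLead (β : Kqt) (i l : Fin N) : Kqt := if i < l then 1 else -β

theorem coeff_linForm (β : Kqt) (i l : Fin N) (α : Fin N →₀ ℕ) :
    MvPolynomial.coeff α (linForm β i l) =
      (if Finsupp.single i 1 = α then 1 else 0) - β * if Finsupp.single l 1 = α then 1 else 0 := by
  classical
  rw [linForm, MvPolynomial.coeff_sub, MvPolynomial.coeff_smul, MvPolynomial.coeff_X,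
    MvPolynomial.coeff_X, smul_eq_mul]

theorem exp_of_coeff_linForm_ne_zero {β : Kqt} {i l : Fin N} {α : Fin N →₀ ℕ}
    (h : MvPolynomial.coeff α (linForm β i l) ≠ 0) :
    α = Finsupp.single i 1 ∨ α = Finsupp.single l 1 := by
  by_contra h1
  push Not at h1
  rw [coeff_linForm, if_neg h1.1.symm, if_neg h1.2.symm] at h
  simp at h

/-- All functionals are sums of initial exponents, so the variable with the smaller index dominates.
-/
theorem leadsAt_linForm (β : Kqt) {i l : Fin N} (hil : i ≠ l) :
    LeadsAt (initSumFin N) (linForm β i l : MvPowerSeries (Fin N) Kqt)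
      (Finsupp.single (min i l) 1) (linLead β i l) := by
  classical
  have hinj : ∀ u v : Fin N, Finsupp.single u 1 = (Finsupp.single v 1 : Fin N →₀ ℕ) ↔ u = v :=
    fun u v => ⟨fun h => Finsupp.single_left_injective one_ne_zero h, fun h => by rw [h]⟩
  refine ⟨?_, fun α h j => ?_⟩
  · rw [MvPolynomial.coeff_coe, coeff_linForm, linLead]
    simp only [hinj]
    rcases lt_or_gt_of_ne hil with h | h
    · rw [min_eq_left h.le, if_pos rfl, if_neg hil.symm, if_pos h, mul_zero, sub_zero]
    · rw [min_eq_right h.le, if_pos rfl, if_neg hil, if_neg h.not_gt, mul_one, zero_sub]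
  · rw [MvPolynomial.coeff_coe] at h
    rw [initSumFin_single]
    have h1 : ((min i l : Fin N) : ℕ) ≤ i := min_le_left i l
    have h2 : ((min i l : Fin N) : ℕ) ≤ l := min_le_right i l
    rcases exp_of_coeff_linForm_ne_zero h with rfl | rfl <;> rw [initSumFin_single] <;>
      split_ifs <;> omega

theorem hasWeight_linForm (β : Kqt) (i l : Fin N) :
    HasWeight Finsupp.degree 1 (linForm β i l : MvPowerSeries (Fin N) Kqt) := by
  intro α h
  rw [MvPolynomial.coeff_coe] at h
  rcases exp_of_coeff_linForm_ne_zero h with rfl | rfl <;> exact Finsupp.degree_single _ _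

theorem HasWeight.prod {σ ι : Type} {w : (σ →₀ ℕ) →+ ℕ} (s : Finset ι) {d : ι → ℕ}
    {F : ι → MvPowerSeries σ Kqt} (h : ∀ i ∈ s, HasWeight w (d i) (F i)) :
    HasWeight w (∑ i ∈ s, d i) (∏ i ∈ s, F i) := by
  classical
  induction s using Finset.induction_on with
  | empty => exact HasWeight.one w
  | insert a s ha ih =>
    rw [Finset.prod_insert ha, Finset.sum_insert ha]
    exact (h a (Finset.mem_insert_self a s)).mul
      (ih fun i hi => h i (Finset.mem_insert_of_mem hi))

theorem coe_prod {ι : Type} (s : Finset ι) (F : ι → MvPolynomial (Fin N) Kqt) :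
    ((∏ i ∈ s, F i : MvPolynomial (Fin N) Kqt) : MvPowerSeries (Fin N) Kqt) =
      ∏ i ∈ s, (F i : MvPowerSeries (Fin N) Kqt) :=
  map_prod (MvPolynomial.coeToMvPowerSeries.ringHom (σ := Fin N) (R := Kqt)) F s

theorem coe_sum {ι : Type} (s : Finset ι) (F : ι → MvPolynomial (Fin N) Kqt) :
    ((∑ i ∈ s, F i : MvPolynomial (Fin N) Kqt) : MvPowerSeries (Fin N) Kqt) =
      ∑ i ∈ s, (F i : MvPowerSeries (Fin N) Kqt) :=
  map_sum (MvPolynomial.coeToMvPowerSeries.ringHom (σ := Fin N) (R := Kqt)) F s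

/-- The leading exponent of the discriminant. -/
def discExp (N : ℕ) : Fin N →₀ ℕ :=
  ∑ i, ∑ l ∈ Finset.univ.erase i, Finsupp.single (min i l) 1

/-- The leading coefficient of the discriminant. -/
def discLead (N : ℕ) : Kqt := ∏ i : Fin N, ∏ l ∈ Finset.univ.erase i, linLead 1 i l

theorem discLead_ne_zero (N : ℕ) : discLead N ≠ 0 := by
  refine Finset.prod_ne_zero_iff.2 fun i _ => Finset.prod_ne_zero_iff.2 fun l _ => ?_
  rw [linLead]
  split_ifs
  · exact one_ne_zero
  · exact neg_ne_zero.2 one_ne_zero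

theorem leadsAt_prod_linForm (β : Kqt) (i : Fin N) :
    LeadsAt (initSumFin N) (∏ l ∈ Finset.univ.erase i,
        (linForm β i l : MvPowerSeries (Fin N) Kqt))
      (∑ l ∈ Finset.univ.erase i, Finsupp.single (min i l) 1)
      (∏ l ∈ Finset.univ.erase i, linLead β i l) :=
  LeadsAt.prod initSumFin_separating _ fun _ hl =>
    leadsAt_linForm β (Finset.ne_of_mem_erase hl).symm

theorem leadsAt_discPoly (N : ℕ) : LeadsAt (initSumFin N)
    (discPoly N : MvPowerSeries (Fin N) Kqt) (discExp N) (discLead N) := by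
  rw [discPoly, coe_prod]
  refine LeadsAt.prod initSumFin_separating _ fun i _ => ?_
  rw [coe_prod]
  exact leadsAt_prod_linForm 1 i

/-- The leading exponent of `linForm β i l` does not depend on `β`, so numerator and discriminant
lead at the same place. Each of the `i` indices `l < i` contributes `-β` instead of `-1`, whence the
factor `β ^ i`. -/
theorem leadsAt_numPoly (β : Kqt) (i : Fin N) : LeadsAt (initSumFin N)
    (numPoly β i : MvPowerSeries (Fin N) Kqt) (discExp N)
    (discLead N * ((1 - β) * β ^ (i : ℕ))) := by
  have h : LeadsAt (initSumFin N) (numPoly β i : MvPowerSeries (Fin N) Kqt)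
      (∑ l ∈ Finset.univ.erase i, Finsupp.single (min i l) 1 +
        ∑ k ∈ Finset.univ.erase i, ∑ l ∈ Finset.univ.erase k, Finsupp.single (min k l) 1)
      ((1 - β) * ((∏ l ∈ Finset.univ.erase i, linLead β i l) *
        ∏ k ∈ Finset.univ.erase i, ∏ l ∈ Finset.univ.erase k, linLead 1 k l)) := by
    rw [numPoly, MvPolynomial.coe_smul, MvPolynomial.coe_mul, coe_prod, coe_prod]
    refine ((leadsAt_prod_linForm β i).mul initSumFin_separating
      (LeadsAt.prod initSumFin_separating _ fun k _ => ?_)).smul _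
    rw [coe_prod]
    exact leadsAt_prod_linForm 1 k
  convert h using 1
  · exact (Finset.add_sum_erase _ (fun k : Fin N =>
      ∑ l ∈ Finset.univ.erase k, (Finsupp.single (min k l) 1 : Fin N →₀ ℕ))
      (Finset.mem_univ i)).symm
  · have h1 : ∏ l ∈ Finset.univ.erase i, linLead β i l =
        (∏ l ∈ Finset.univ.erase i, linLead 1 i l) * β ^ (i : ℕ) := by
      have h2 : ∀ l ∈ Finset.univ.erase i, linLead β i l =
          linLead 1 i l * if l < i then β else 1 := by
        intro l hl
        have := Finset.ne_of_mem_erase hl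
        rw [linLead, linLead]
        rcases lt_or_gt_of_ne this with h | h
        · rw [if_neg h.not_gt, if_neg h.not_gt, if_pos h, neg_mul, one_mul]
        · rw [if_pos h, if_pos h, if_neg h.not_gt, mul_one]
      rw [Finset.prod_congr rfl h2, Finset.prod_mul_distrib]
      congr 1
      rw [Finset.prod_ite, Finset.prod_const_one, mul_one, Finset.prod_const]
      congr 1
      have : (Finset.univ.erase i).filter (fun l => l < i) = Finset.Iio i := by
        ext l
        simp only [Finset.mem_filter, Finset.mem_erase, Finset.mem_univ, Finset.mem_Iio]
        exact ⟨fun h => h.2, fun h => ⟨⟨h.ne, trivial⟩, h⟩⟩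
      rw [this, Fin.card_Iio]
    rw [h1, discLead, ← Finset.mul_prod_erase _ _ (Finset.mem_univ i)]
    ring

theorem hasWeight_disc_aux (s : Finset (Fin N)) :
    HasWeight Finsupp.degree (∑ k ∈ s, ∑ _l ∈ Finset.univ.erase k, 1)
      (∏ k ∈ s, ∏ l ∈ Finset.univ.erase k, (linForm 1 k l : MvPowerSeries (Fin N) Kqt)) :=
  HasWeight.prod _ fun k _ => HasWeight.prod _ fun l _ => hasWeight_linForm 1 k l

theorem hasWeight_discPoly (N : ℕ) :
    HasWeight Finsupp.degree (∑ k : Fin N, ∑ _l ∈ Finset.univ.erase k, 1)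
      (discPoly N : MvPowerSeries (Fin N) Kqt) := by
  rw [discPoly, coe_prod]
  simp only [coe_prod]
  exact hasWeight_disc_aux _

theorem hasWeight_numPoly (β : Kqt) (i : Fin N) :
    HasWeight Finsupp.degree (∑ k : Fin N, ∑ _l ∈ Finset.univ.erase k, 1)
      (numPoly β i : MvPowerSeries (Fin N) Kqt) := by
  rw [numPoly, MvPolynomial.coe_smul, MvPolynomial.coe_mul, coe_prod, coe_prod,
    ← Finset.add_sum_erase _ _ (Finset.mem_univ i)]
  simp only [coe_prod]
  exact ((HasWeight.prod _ fun l _ => hasWeight_linForm β i l).mul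
    (hasWeight_disc_aux _)).smul _

/-- The eigenvalues of the operator `macOp a b`. -/
def macEigenvalue (a b : Kqt) (lam : YoungDiagram) : Kqt :=
  1 + ∑ i ∈ Finset.range (lam.colLen 0), (1 - b⁻¹) * b⁻¹ ^ i * (a ^ lam.rowLen i - 1)

theorem macEigenvalue_eq (a b : Kqt) {lam : YoungDiagram} (h : lam.colLen 0 ≤ N) :
    macEigenvalue a b lam = 1 + ∑ i : Fin N, (1 - b⁻¹) * b⁻¹ ^ (i : ℕ) * (a ^ lam.rowLen i - 1) := by
  rw [macEigenvalue, Fin.sum_univ_eq_sum_range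
    (fun i => (1 - b⁻¹) * b⁻¹ ^ i * (a ^ lam.rowLen i - 1))]
  congr 1
  refine Finset.sum_subset (Finset.range_mono h) fun i _ hi => ?_
  have : lam.rowLen i = 0 := by
    by_contra h1
    exact hi (Finset.mem_range.2 ((rowLen_pos_iff lam i).1 h1))
  rw [this, pow_zero, sub_self, mul_zero]

theorem leadsAt_polyEval_monoSym {lam : YoungDiagram} {α : Fin N →₀ ℕ}
    (hα : extendExp N α = leadExp lam) :
    LeadsAt (initSumFin N) (polyEval N (monoSym lam) : MvPowerSeries (Fin N) Kqt) α 1 := by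
  classical
  refine ⟨?_, fun γ hγ j => ?_⟩
  · rw [MvPolynomial.coeff_coe, coeff_polyEval, toSeries_monoSym, coeff_monoSeries, hα,
      expType_leadExp, if_pos rfl]
  · rw [MvPolynomial.coeff_coe, coeff_polyEval, toSeries_monoSym, coeff_monoSeries,
      ite_ne_right_iff] at hγ
    rw [initSumFin_apply, initSumFin_apply, hα, ← hγ.1]
    refine (initSum_le_of_expType _ j).trans_eq ?_
    rw [initSum_apply]
    rfl

theorem hasWeight_polyEval_monoSym (lam : YoungDiagram) : HasWeight Finsupp.degree lam.card
    (polyEval N (monoSym lam) : MvPowerSeries (Fin N) Kqt) := by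
  classical
  intro γ hγ
  rw [MvPolynomial.coeff_coe, coeff_polyEval, toSeries_monoSym, coeff_monoSeries,
    ite_ne_right_iff] at hγ
  rw [← hγ.1, card_expType, degree_extendExp]

/-- At the leading exponent of `m_λ`, the operator `T_i - 1` has the eigenvalue `a^(λ_i) - 1`.
Summing with the leading coefficients of the numerators gives the leading term of the discriminant
times the image; the discriminant is then divided out. -/
theorem polyEval_macOp_monoSym {a b : Kqt} (hb : b ≠ 0) {lam : YoungDiagram}
    (hN : lam.colLen 0 ≤ N) {α : Fin N →₀ ℕ} (hα : extendExp N α = leadExp lam) :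
    LeadsAt (initSumFin N) (polyEval N (macOp a b (monoSym lam)) : MvPowerSeries (Fin N) Kqt) α
      (macEigenvalue a b lam) ∧
    HasWeight Finsupp.degree lam.card
      (polyEval N (macOp a b (monoSym lam)) : MvPowerSeries (Fin N) Kqt) := by
  have hg := leadsAt_polyEval_monoSym (N := N) hα
  have hgw := hasWeight_polyEval_monoSym (N := N) lam
  have hcoe := congrArg (fun p : MvPolynomial (Fin N) Kqt => (p : MvPowerSeries (Fin N) Kqt))
    (discPoly_mul_polyEval_macOp (N := N) (a := a) hb (monoSym lam))
  simp only [MvPolynomial.coe_add, MvPolynomial.coe_mul, coe_sum] at hcoe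
  have hαi : ∀ i : Fin N, α i = lam.rowLen i := fun i => by
    rw [← extendExp_coe, hα, leadExp_apply]
  have hsub : ∀ (i : Fin N) γ, MvPowerSeries.coeff γ ((scaleVar a i (polyEval N (monoSym lam)) -
      polyEval N (monoSym lam) : MvPolynomial (Fin N) Kqt) : MvPowerSeries (Fin N) Kqt) =
      (a ^ γ i - 1) * MvPowerSeries.coeff γ
        (polyEval N (monoSym lam) : MvPowerSeries (Fin N) Kqt) := by
    intro i γ
    rw [MvPolynomial.coeff_coe, MvPolynomial.coeff_sub, coeff_scaleVar, MvPolynomial.coeff_coe]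
    ring
  have hlead : LeadsAt (initSumFin N)
      ((discPoly N * polyEval N (macOp a b (monoSym lam)) : MvPolynomial (Fin N) Kqt) :
        MvPowerSeries (Fin N) Kqt)
      (discExp N + α) (discLead N * macEigenvalue a b lam) := by
    rw [MvPolynomial.coe_mul, hcoe]
    have h1 : ∀ i : Fin N, LeadsAt (initSumFin N)
        ((scaleVar a i (polyEval N (monoSym lam)) - polyEval N (monoSym lam) :
          MvPolynomial (Fin N) Kqt) : MvPowerSeries (Fin N) Kqt) α (a ^ lam.rowLen i - 1) := by
      intro i
      refine ⟨by rw [hsub, hg.1, mul_one, hαi], fun γ hγ => hg.2 γ ?_⟩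
      rw [hsub] at hγ
      exact right_ne_zero_of_mul hγ
    have h2 := ((leadsAt_discPoly N).mul initSumFin_separating hg).add
      (LeadsAt.sum Finset.univ fun i _ =>
        (leadsAt_numPoly b⁻¹ i).mul initSumFin_separating (h1 i))
    convert h2 using 1
    rw [macEigenvalue_eq a b hN, mul_add, Finset.mul_sum]
    congr 1
    exact Finset.sum_congr rfl fun i _ => by ring
  have hδ : MvPolynomial.coeff (discExp N) (discPoly N) ≠ 0 := by
    rw [← MvPolynomial.coeff_coe, (leadsAt_discPoly N).1]
    exact discLead_ne_zero N
  constructor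
  · have h3 : LeadsAt (initSumFin N)
        (polyEval N (macOp a b (monoSym lam)) : MvPowerSeries (Fin N) Kqt) α
        (MvPowerSeries.coeff α
          (polyEval N (macOp a b (monoSym lam)) : MvPowerSeries (Fin N) Kqt)) := by
      refine ⟨rfl, fun γ hγ j => le_of_mul_bounded (initSumFin N j) hδ (fun β hβ => ?_)
        (by rwa [MvPolynomial.coeff_coe] at hγ)⟩
      rw [← map_add]
      exact hlead.2 β (by rwa [MvPolynomial.coeff_coe]) j
    have h4 := ((leadsAt_discPoly N).mul initSumFin_separating h3).1
    rw [← MvPolynomial.coe_mul, hlead.1] at h4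
    rw [mul_left_cancel₀ (discLead_ne_zero N) h4]
    exact h3
  · refine hasWeight_of_mul Finsupp.degree (fun h => hδ (by rw [h, MvPolynomial.coeff_zero]))
      (hasWeight_discPoly N) ?_
    rw [MvPolynomial.coe_mul, hcoe]
    refine ((hasWeight_discPoly N).mul hgw).add (HasWeight.sum _ fun i _ =>
      (hasWeight_numPoly b⁻¹ i).mul fun γ hγ => hgw γ ?_)
    rw [hsub] at hγ
    exact right_ne_zero_of_mul hγ

end FiniteVariables

theorem macOp_monoSym {a b : Kqt} (hb : b ≠ 0) (lam : YoungDiagram) :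
    macOp a b (monoSym lam) - macEigenvalue a b lam • monoSym lam ∈
      Submodule.span Kqt (monoSym '' {mu | DomLT mu lam}) := by
  have key : toSeries (macOp a b (monoSym lam) - macEigenvalue a b lam • monoSym lam) ∈
      Submodule.span Kqt (monoSeries (Set.univ : Set ℕ) '' {mu | DomLT mu lam}) := by
    refine mem_span_of_coeff expType leadExp _ (fun i α => coeff_monoSeries i α) _
      (fun α => coeff_toSeries_eq_leadExp α _) (finite_domLT lam) fun α hα => ?_
    rw [coeff_toSeries_eq_leadExp] at hα
    generalize expType α = mu at hα ⊢
    -- Enough variables for the leading exponents of both partitions to survive the restriction.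
    set N := max (lam.colLen 0) (mu.colLen 0) with hNdef
    obtain ⟨γ, hγ⟩ := exists_extendExp_eq (N := N) (lam := lam) (le_max_left _ _)
    obtain ⟨δ, hδ⟩ := exists_extendExp_eq (N := N) (lam := mu) (le_max_right _ _)
    obtain ⟨h1, h2⟩ := polyEval_macOp_monoSym (a := a) hb (le_max_left _ _ : _ ≤ N) hγ
    rw [map_sub, map_sub, map_smul, map_smul, toSeries_monoSym, coeff_monoSeries,
      expType_leadExp] at hα
    have hne : mu ≠ lam := by
      rintro rfl
      rw [if_pos rfl, ← hγ, ← coeff_polyEval, ← MvPolynomial.coeff_coe, h1.1, smul_eq_mul, mul_one,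
        sub_self] at hα
      exact hα rfl
    rw [if_neg hne, smul_zero, sub_zero, ← hδ, ← coeff_polyEval, ← MvPolynomial.coeff_coe] at hα
    refine ⟨hne, ?_, fun k => ?_⟩
    · rw [← h2 δ hα, ← degree_extendExp, hδ, degree_leadExp]
    · have h3 := h1.2 δ hα k
      rw [initSumFin_apply, initSumFin_apply, hδ, hγ, initSum_apply, initSum_apply] at h3
      exact h3
  have himg : monoSeries (Set.univ : Set ℕ) '' {mu | DomLT mu lam} =
      toSeries.toLinearMap '' (monoSym '' {mu | DomLT mu lam}) := by
    rw [Set.image_image]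
    exact Set.image_congr fun mu _ => (toSeries_monoSym mu).symm
  rw [himg, Submodule.span_image] at key
  obtain ⟨g, hg, hg1⟩ := key
  rwa [← toSeries_injective hg1]

/-! ### Existence of Macdonald polynomials -/

/-- The monomials in `a` and `b` are linearly independent. -/
def GenericParams (a b : Kqt) : Prop :=
  LinearIndependent ℤ fun p : ℕ × ℕ => a ^ p.1 * b ^ p.2

/-- The nonzero determinant makes the map on exponents injective, so distinct monomials in the two
parameters are distinct monomials in `q` and `t`. -/
theorem genericParams_of_exponents {x y z w : ℕ} (h : x * w ≠ y * z) :
    GenericParams (q ^ x * t ^ y) (q ^ z * t ^ w) := by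
  have h1 : LinearIndependent ℤ fun α : Fin 2 →₀ ℕ => MvPolynomial.monomial α (1 : ℚ) := by
    have := (MvPolynomial.basisMonomials (Fin 2) ℚ).linearIndependent
    rw [MvPolynomial.coe_basisMonomials] at this
    refine this.restrict_scalars fun m n hmn => ?_
    simpa using hmn
  have h2 : LinearIndependent ℤ fun α : Fin 2 →₀ ℕ =>
      algebraMap (MvPolynomial (Fin 2) ℚ) Kqt (MvPolynomial.monomial α 1) :=
    h1.map' ((algebraMap (MvPolynomial (Fin 2) ℚ) Kqt).toAddMonoidHom.toIntLinearMap)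
      (LinearMap.ker_eq_bot.2 (IsFractionRing.injective (MvPolynomial (Fin 2) ℚ) Kqt))
  set e : ℕ × ℕ → (Fin 2 →₀ ℕ) := fun p =>
    Finsupp.single 0 (x * p.1 + z * p.2) + Finsupp.single 1 (y * p.1 + w * p.2) with he
  have hinj : Function.Injective e := by
    intro p p' hp
    have e0 := DFunLike.congr_fun hp 0
    have e1 := DFunLike.congr_fun hp 1
    simp [he] at e0 e1
    zify at e0 e1 h
    have hd : (x * w - y * z : ℤ) ≠ 0 := sub_ne_zero.2 h
    refine Prod.ext ?_ ?_
    · zify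
      refine mul_left_cancel₀ hd ?_
      linear_combination (w : ℤ) * e0 - z * e1
    · zify
      refine mul_left_cancel₀ hd ?_
      linear_combination (x : ℤ) * e1 - y * e0
  have h3 := h2.comp e hinj
  unfold GenericParams
  convert h3 using 1
  funext p
  rw [Function.comp_apply, he, ← one_mul (1 : ℚ), ← MvPolynomial.monomial_mul,
    ← MvPolynomial.X_pow_eq_monomial, ← MvPolynomial.X_pow_eq_monomial, map_mul, map_pow, map_pow]
  change _ = q ^ _ * t ^ _
  ring

namespace GenericParams

variable {a b : Kqt}

theorem pow_mul_pow_injective (h : GenericParams a b) {i j k l : ℕ}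
    (h1 : a ^ i * b ^ j = a ^ k * b ^ l) : i = k ∧ j = l :=
  Prod.ext_iff.1 (LinearIndependent.injective h (a₁ := (i, j)) (a₂ := (k, l)) h1)

theorem ne_zero_right (h : GenericParams a b) : b ≠ 0 := by
  have := LinearIndependent.ne_zero (0, 1) h
  simpa using this

theorem pow_left_ne_one (h : GenericParams a b) (r : ℕ) : a ^ (r + 1) ≠ 1 := fun h1 => by
  have := (h.pow_mul_pow_injective (i := r + 1) (j := 0) (k := 0) (l := 0) (by simpa using h1)).1
  omega

theorem pow_right_ne_one (h : GenericParams a b) (r : ℕ) : b ^ (r + 1) ≠ 1 := fun h1 => by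
  have := (h.pow_mul_pow_injective (i := 0) (j := r + 1) (k := 0) (l := 0) (by simpa using h1)).2
  omega

theorem macEigenvalue_injective (h : GenericParams a b) :
    Function.Injective (macEigenvalue a b) := by
  classical
  intro lam mu heq
  set N := max (lam.colLen 0) (mu.colLen 0) with hN
  have hb := h.ne_zero_right
  have hb1 : 1 - b⁻¹ ≠ 0 := by
    intro h1
    apply h.pow_right_ne_one 0
    rw [zero_add, pow_one, ← inv_inv b, ← sub_eq_zero.1 h1, inv_one]
  -- Scaling by `b ^ N` removes the negative powers of `b`. Up to terms independent of `nu`, the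
  -- eigenvalue is the sum of the monomials `a^(nu_i) b^(N-i)`; the exponent of `b` identifies the
  -- row, and that of `a` its length.
  have hsum : ∀ nu : YoungDiagram, nu.colLen 0 ≤ N → macEigenvalue a b nu = 1 +
      (1 - b⁻¹) * (b⁻¹ ^ N * (Finsupp.linearCombination ℤ (fun p : ℕ × ℕ => a ^ p.1 * b ^ p.2)
        (∑ i : Fin N, Finsupp.single (nu.rowLen i, N - (i : ℕ)) 1)) -
        ∑ i : Fin N, b⁻¹ ^ (i : ℕ)) := by
    intro nu hnu
    rw [macEigenvalue_eq a b hnu, map_sum, Finset.mul_sum, ← Finset.sum_sub_distrib, Finset.mul_sum]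
    congr 1
    refine Finset.sum_congr rfl fun i _ => ?_
    rw [Finsupp.linearCombination_single, one_smul]
    have h2 : b⁻¹ ^ N * b ^ (N - (i : ℕ)) = b⁻¹ ^ (i : ℕ) := by
      have h3 : b⁻¹ ^ N = b⁻¹ ^ (i : ℕ) * b⁻¹ ^ (N - (i : ℕ)) := by
        rw [← pow_add]
        congr 1
        omega
      rw [h3, mul_assoc, ← mul_pow, inv_mul_cancel₀ hb, one_pow, mul_one]
    linear_combination (-(1 - b⁻¹) * a ^ nu.rowLen i) * h2
  rw [hsum lam (le_max_left _ _), hsum mu (le_max_right _ _)] at heq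
  have h4 := mul_left_cancel₀ (pow_ne_zero N (inv_ne_zero hb))
    (sub_left_inj.1 (mul_left_cancel₀ hb1 (add_left_cancel heq)))
  have h5 := LinearIndependent.finsuppLinearCombination_injective h h4
  refine youngDiagram_ext fun i => ?_
  by_cases hi : i < N
  · have h6 := DFunLike.congr_fun h5 (lam.rowLen i, N - i)
    rw [Finsupp.finsetSum_apply, Finsupp.finsetSum_apply] at h6
    have h7 : ∀ nu : YoungDiagram, ∑ k : Fin N, (Finsupp.single (nu.rowLen k, N - (k : ℕ)) (1 : ℤ))
        (lam.rowLen i, N - i) = if nu.rowLen i = lam.rowLen i then 1 else 0 := by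
      intro nu
      rw [Finset.sum_eq_single ⟨i, hi⟩]
      · rw [Finsupp.single_apply]
        simp
      · intro k _ hk
        rw [Finsupp.single_apply, if_neg]
        intro h8
        have := (Prod.ext_iff.1 h8).2
        simp only at this
        exact hk (Fin.ext (by have := k.isLt; simp only; omega))
      · intro h8
        exact absurd (Finset.mem_univ _) h8
    rw [h7, h7, if_pos rfl] at h6
    by_contra h8
    rw [if_neg (Ne.symm h8)] at h6
    exact one_ne_zero h6
  · have h8 : ∀ nu : YoungDiagram, nu.colLen 0 ≤ N → nu.rowLen i = 0 := by
      intro nu hnu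
      by_contra h9
      have := (rowLen_pos_iff nu i).1 h9
      omega
    rw [h8 lam (le_max_left _ _), h8 mu (le_max_right _ _)]

end GenericParams

theorem fockNorm_partitionEquiv (a b : Kqt) (lam : YoungDiagram) :
    fockNorm (macWeight a b) (partitionEquiv lam) = zee lam * zeeFactor a b lam := by
  change fockNorm (macWeight a b) (Multiset.toFinsupp (parts lam)) = _
  rw [fockNorm, Finsupp.prod, zee, zeeFactor, Finset.prod_multiset_map_count,
    Multiset.toFinsupp_support, Nat.cast_prod, ← Finset.prod_mul_distrib]
  refine Finset.prod_congr rfl fun r _ => ?_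
  rw [Multiset.toFinsupp_apply, macWeight, mul_pow]
  push_cast
  ring

theorem scalarProduct_eq_fock (a b : Kqt) (f g : Sym) :
    scalarProduct a b f g = fock (macWeight a b) f g := by
  have hrepr : ∀ (f : Sym) lam, powerSumBasis.repr f lam =
      MvPolynomial.coeff (partitionEquiv lam) f := fun f lam => by
    rw [powerSumBasis, Module.Basis.repr_reindex_apply, Equiv.symm_symm]
    rfl
  rw [scalarProduct, Finsupp.sum, fock]
  refine Finset.sum_equiv partitionEquiv (fun lam => ?_) fun lam _ => ?_
  · rw [Finsupp.mem_support_iff, hrepr, MvPolynomial.mem_support_iff]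
  · rw [hrepr, hrepr, fockNorm_partitionEquiv]

theorem span_monoSym : Submodule.span Kqt (Set.range monoSym) = ⊤ := by
  rw [eq_top_iff, ← powerSumBasis.span_eq, Submodule.span_le]
  rintro _ ⟨lam, rfl⟩
  rw [powerSumBasis_apply]
  have h : toSeries (powerSum lam) ∈ Submodule.span Kqt (monoSeries (Set.univ : Set ℕ) ''
      {mu | mu.card ≤ (expType (leadExp lam)).card}) := by
    refine mem_span_of_coeff expType leadExp _ (fun i α => coeff_monoSeries i α) _
      (fun α => coeff_toSeries_eq_leadExp α _) (finite_card_le _) fun α hα => ?_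
    have := hasWeight_toSeries (weight_sum_toMultiset (parts lam)) α hα
    rw [map_parts, ← values_leadExp, sum_values, ← card_expType, ← card_expType] at this
    exact this.le
  have himg : monoSeries (Set.univ : Set ℕ) '' {mu | mu.card ≤ (expType (leadExp lam)).card} =
      toSeries.toLinearMap '' (monoSym '' {mu | mu.card ≤ (expType (leadExp lam)).card}) := by
    rw [Set.image_image]
    exact Set.image_congr fun mu _ => (toSeries_monoSym mu).symm
  rw [himg, Submodule.span_image] at h
  obtain ⟨g, hg, hg1⟩ := h
  rw [← toSeries_injective hg1]
  exact Submodule.span_mono (Set.image_subset_range _ _) hg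

/-- The family consists of the triangular eigenvectors of `macOp a b`; eigenvectors of a
self-adjoint operator with distinct eigenvalues are orthogonal. -/
theorem exists_isMacdonaldFamily {a b : Kqt} (h : GenericParams a b) :
    ∃ P, IsMacdonaldFamily a b P := by
  classical
  choose P hP hPE using exists_triangular_eigenvector (r := DomLT) DomLT.trans wellFounded_domLT
    (macOp a b) monoSym (macEigenvalue a b) (macOp_monoSym h.ne_zero_right)
    (fun lam mu hlt heq => hlt.1 (h.macEigenvalue_injective heq))
  refine ⟨P, ?_, ?_, ?_, ?_⟩
  · refine linearIndependent_of_triangular (r := DomLT) DomLT.trans DomLT.irrefl hP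
      (fun lam => MvPowerSeries.coeff (leadExp lam) ∘ₗ toSeries.toLinearMap) (fun lam => ?_)
      fun lam mu hne => ?_
    · simp only [LinearMap.comp_apply, AlgHom.toLinearMap_apply, toSeries_monoSym]
      rw [coeff_monoSeries, expType_leadExp, if_pos rfl]
    · simp only [LinearMap.comp_apply, AlgHom.toLinearMap_apply, toSeries_monoSym]
      rw [coeff_monoSeries, expType_leadExp, if_neg hne.symm]
  · have := span_le_span_of_triangular (K := Kqt) wellFounded_domLT hP (A := Set.univ)
      (fun _ _ _ _ => Set.mem_univ _)
    rw [Set.image_univ, Set.image_univ, span_monoSym] at this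
    exact eq_top_iff.2 this
  · intro lam
    have h1 := Submodule.mem_map_of_mem (f := toSeries.toLinearMap) (hP lam)
    rw [← Submodule.span_image, Set.image_image, AlgHom.toLinearMap_apply, map_sub,
      toSeries_monoSym] at h1
    rwa [Set.image_congr fun mu _ => (toSeries_monoSym mu).symm]
  · intro lam mu hne
    rw [scalarProduct_eq_fock]
    have h1 := fock_macOp (a := a) h.pow_right_ne_one (P lam) (P mu)
    rw [hPE, hPE, fock_smul_left, fock_smul_right, ← sub_eq_zero, ← sub_mul] at h1
    exact (mul_eq_zero.1 h1).resolve_left (sub_ne_zero.2 (h.macEigenvalue_injective.ne hne))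

theorem macdonaldP_spec {a b : Kqt} (h : GenericParams a b) :
    IsMacdonaldFamily a b (macdonaldP a b) := by
  have hex := exists_isMacdonaldFamily h
  rw [macdonaldP, dif_pos hex]
  exact hex.choose_spec

/-! ### Products of series in disjoint sets of variables -/

theorem HasWeight.algHom_zero {σ J : Type} {w : (σ →₀ ℕ) →+ ℕ}
    (Φ : MvPolynomial J Kqt →ₐ[Kqt] MvPowerSeries σ Kqt)
    (hΦ : ∀ j, HasWeight w 0 (Φ (MvPolynomial.X j))) (f : MvPolynomial J Kqt) :
    HasWeight w 0 (Φ f) :=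
  hasWeight_of_isWeightedHomogeneous Φ (wt := fun _ => 0) hΦ fun α _ => by
    simp [Finsupp.weight_apply, Finsupp.sum]

theorem hasWeight_apply_psumSeries {σ : Type} {S : Set σ} (r : ℕ+) {v : σ} (hv : v ∉ S) :
    HasWeight (Finsupp.applyAddHom v) 0 (psumSeries S r) := by
  intro α h
  obtain ⟨u, hu, rfl⟩ := exists_of_coeff_psumSeries_ne_zero h
  refine Finsupp.single_eq_of_ne ?_
  rintro rfl
  exact hv hu

/-- When `A` involves only variables of `S` and `B` only the others, an exponent splits in a single
way. -/
theorem coeff_mul_of_disjoint {σ : Type} (S : Set σ) [DecidablePred (· ∈ S)]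
    {A B : MvPowerSeries σ Kqt} (hA : ∀ v ∉ S, HasWeight (Finsupp.applyAddHom v) 0 A)
    (hB : ∀ v ∈ S, HasWeight (Finsupp.applyAddHom v) 0 B) (α : σ →₀ ℕ) :
    MvPowerSeries.coeff α (A * B) = MvPowerSeries.coeff (α.filter (· ∈ S)) A *
      MvPowerSeries.coeff (α.filter fun v => ¬ v ∈ S) B := by
  classical
  rw [MvPowerSeries.coeff_mul]
  refine Finset.sum_eq_single_of_mem (α.filter (· ∈ S), α.filter fun v => ¬ v ∈ S)
    (Finset.HasAntidiagonal.mem_antidiagonal.2 (Finsupp.filter_add_filter_not α _)) ?_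
  rintro ⟨β, γ⟩ hp hne
  by_contra h
  have hsum : β + γ = α := Finset.HasAntidiagonal.mem_antidiagonal.1 hp
  have h1 : ∀ v ∉ S, β v = 0 := fun v hv => hA v hv β (left_ne_zero_of_mul h)
  have h2 : ∀ v ∈ S, γ v = 0 := fun v hv => hB v hv γ (right_ne_zero_of_mul h)
  refine hne (Prod.ext ?_ ?_)
  · ext v
    rw [Finsupp.filter_apply, ← hsum, Finsupp.add_apply]
    split_ifs with hv
    · rw [h2 v hv, add_zero]
    · exact h1 v hv
  · ext v
    rw [Finsupp.filter_apply, ← hsum, Finsupp.add_apply]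
    split_ifs with hv
    · exact h2 v hv
    · rw [h1 v hv, zero_add]

/-! ### Multi-symmetric series -/

section Multi

variable {n : ℕ}

/-- The part of an exponent that belongs to the alphabet `i`. -/
def block (i : Fin n) : (Fin n × ℕ →₀ ℕ) →+ (ℕ →₀ ℕ) :=
  (Finsupp.applyAddHom i).comp (Finsupp.curryAddEquiv (M := ℕ)).toAddMonoidHom

@[simp]
theorem block_apply (i : Fin n) (α : Fin n × ℕ →₀ ℕ) (m : ℕ) : block i α m = α (i, m) := rfl

/-- The multi-partition formed by the nonzero exponents. -/
def multiType (α : Fin n × ℕ →₀ ℕ) : Fin n → YoungDiagram := fun i => expType (block i α)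

/-- The embedding of a single alphabet. -/
def blockEmb (i : Fin n) : ℕ ↪ Fin n × ℕ := ⟨fun m => (i, m), fun a b h => by simpa using h⟩

theorem block_embDomain (i k : Fin n) (α : ℕ →₀ ℕ) :
    block i (Finsupp.embDomain (blockEmb k) α) = if i = k then α else 0 := by
  ext m
  rw [block_apply]
  split_ifs with h
  · subst h
    exact Finsupp.embDomain_apply_self (blockEmb i) α m
  · rw [Finsupp.embDomain_of_notMem_range, Finsupp.zero_apply]
    rintro ⟨m', hm'⟩
    exact h (Prod.ext_iff.1 hm').1.symm

theorem embDomain_block {i : Fin n} {α : Fin n × ℕ →₀ ℕ} (h : ∀ v, v.1 ≠ i → α v = 0) :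
    Finsupp.embDomain (blockEmb i) (block i α) = α := by
  ext ⟨k, m⟩
  by_cases hk : k = i
  · subst hk
    exact Finsupp.embDomain_apply_self (blockEmb k) _ m
  · rw [h _ hk, Finsupp.embDomain_of_notMem_range]
    rintro ⟨m', hm'⟩
    exact hk (Prod.ext_iff.1 hm').1.symm

/-- The exponent of the leading monomial of a monomial multi-symmetric function. -/
def multiLead (lam : Fin n → YoungDiagram) : Fin n × ℕ →₀ ℕ :=
  ∑ i, Finsupp.embDomain (blockEmb i) (leadExp (lam i))

theorem block_multiLead (lam : Fin n → YoungDiagram) (i : Fin n) :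
    block i (multiLead lam) = leadExp (lam i) := by
  rw [multiLead, map_sum]
  simp only [block_embDomain]
  rw [Finset.sum_ite_eq, if_pos (Finset.mem_univ i)]

@[simp]
theorem multiType_multiLead (lam : Fin n → YoungDiagram) : multiType (multiLead lam) = lam := by
  funext i
  rw [multiType, block_multiLead, expType_leadExp]

open Classical in
theorem coeff_monoSeries_block (i : Fin n) (lam : YoungDiagram) (α : Fin n × ℕ →₀ ℕ) :
    MvPowerSeries.coeff α (monoSeries {w | w.1 = i} lam) =
      if (∀ v, v.1 ≠ i → α v = 0) ∧ expType (block i α) = lam then 1 else 0 := by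
  have hiff : ((∀ v ∈ α.support, v ∈ {w : Fin n × ℕ | w.1 = i}) ∧
      α.support.val.map α = (lam.rowLens : Multiset ℕ)) ↔
      (∀ v, v.1 ≠ i → α v = 0) ∧ expType (block i α) = lam := by
    have h1 : (∀ v ∈ α.support, v ∈ {w : Fin n × ℕ | w.1 = i}) ↔ ∀ v, v.1 ≠ i → α v = 0 := by
      constructor
      · intro h v hv
        by_contra h2
        exact hv (h v (Finsupp.mem_support_iff.2 h2))
      · intro h v hv
        by_contra h2
        exact Finsupp.mem_support_iff.1 hv (h v h2)
    rw [h1]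
    refine and_congr_right fun h => ?_
    rw [expType_eq_iff]
    conv_lhs => rw [← embDomain_block h]
    rw [Finsupp.support_embDomain, Finset.map_val, Multiset.map_map, values]
    have h3 : (⇑(Finsupp.embDomain (blockEmb i) (block i α)) ∘ ⇑(blockEmb i)) = ⇑(block i α) :=
      funext fun m => Finsupp.embDomain_apply_self _ _ _
    rw [h3]
  by_cases h : (∀ v, v.1 ≠ i → α v = 0) ∧ expType (block i α) = lam
  · rw [if_pos h]
    exact if_pos (hiff.2 h)
  · rw [if_neg h]
    exact if_neg fun h1 => h (hiff.1 h1)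

open Classical in
theorem coeff_prod_monoSeries (lam : Fin n → YoungDiagram) (s : Finset (Fin n))
    (α : Fin n × ℕ →₀ ℕ) :
    MvPowerSeries.coeff α (∏ i ∈ s, monoSeries {w | w.1 = i} (lam i)) =
      if (∀ v, v.1 ∉ s → α v = 0) ∧ ∀ i ∈ s, expType (block i α) = lam i then 1 else 0 := by
  induction s using Finset.induction_on generalizing α with
  | empty =>
    rw [Finset.prod_empty, MvPowerSeries.coeff_one]
    refine if_congr ?_ rfl rfl
    constructor
    · rintro rfl
      simp
    · intro h
      ext v
      exact h.1 v (Finset.notMem_empty _)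
  | insert i s hi ih =>
    rw [Finset.prod_insert hi, coeff_mul_of_disjoint {w : Fin n × ℕ | w.1 = i},
      coeff_monoSeries_block, ih, ite_zero_mul_ite_zero, one_mul]
    · have hb1 : block i (α.filter (· ∈ {w : Fin n × ℕ | w.1 = i})) = block i α := by
        ext m
        rw [block_apply, Finsupp.filter_apply_pos (· ∈ {w : Fin n × ℕ | w.1 = i}) _ rfl, block_apply]
      have hb2 : ∀ k ∈ s, block k (α.filter fun v => ¬ v ∈ {w : Fin n × ℕ | w.1 = i}) =
          block k α := by
        intro k hk
        ext m
        rw [block_apply, Finsupp.filter_apply_pos, block_apply]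
        rintro rfl
        exact hi hk
      refine if_congr ?_ rfl rfl
      rw [hb1]
      constructor
      · rintro ⟨⟨_, h2⟩, h3, h4⟩
        refine ⟨fun v hv => ?_, fun k hk => ?_⟩
        · rw [Finset.mem_insert, not_or] at hv
          have := h3 v hv.2
          rwa [Finsupp.filter_apply_pos (fun v => ¬ v ∈ {w : Fin n × ℕ | w.1 = i}) _ (show ¬ v ∈ {w : Fin n × ℕ | w.1 = i} from hv.1)] at this
        · rcases Finset.mem_insert.1 hk with rfl | hk
          · exact h2
          · rw [← hb2 k hk]
            exact h4 k hk
      · rintro ⟨h1, h2⟩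
        refine ⟨⟨fun v hv => Finsupp.filter_apply_neg _ _ hv, h2 i (Finset.mem_insert_self i s)⟩,
          fun v hv => ?_, fun k hk => ?_⟩
        · by_cases hvi : v.1 = i
          · exact Finsupp.filter_apply_neg _ _ (not_not.2 hvi)
          · rw [Finsupp.filter_apply_pos (fun v => ¬ v ∈ {w : Fin n × ℕ | w.1 = i}) _ (show ¬ v ∈ {w : Fin n × ℕ | w.1 = i} from hvi)]
            exact h1 v (by rw [Finset.mem_insert, not_or]; exact ⟨hvi, hv⟩)
        · rw [hb2 k hk]
          exact h2 k (Finset.mem_insert_of_mem hk)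
    · intro v hv β hβ
      rw [coeff_monoSeries_block, ite_ne_right_iff] at hβ
      exact hβ.1.1 v hv
    · intro v hv β hβ
      rw [ih, ite_ne_right_iff] at hβ
      refine hβ.1.1 v ?_
      rw [show v.1 = i from hv]
      exact hi

open Classical in
theorem coeff_multiMonoSeries (lam : Fin n → YoungDiagram) (α : Fin n × ℕ →₀ ℕ) :
    MvPowerSeries.coeff α (multiMonoSeries lam) = if multiType α = lam then 1 else 0 := by
  rw [multiMonoSeries, coeff_prod_monoSeries]
  refine if_congr ?_ rfl rfl
  rw [funext_iff]
  simp [multiType]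

/-- Multi-symmetric functions are invariant under permuting each alphabet separately, and such a
permutation sorts every block of the exponent. -/
theorem coeff_toMultiSeries_eq_multiLead (α : Fin n × ℕ →₀ ℕ) (f : MSym n) :
    MvPowerSeries.coeff α (toMultiSeries f) =
      MvPowerSeries.coeff (multiLead (multiType α)) (toMultiSeries f) := by
  have hex : ∀ i : Fin n, ∃ π : Equiv.Perm ℕ,
      ∀ m, block i α (π m) = leadExp (expType (block i α)) m := fun i =>
    exists_perm_of_values_eq (by rw [values_leadExp, rowLens_expType])
  choose π hπ using hex
  set e : Fin n × ℕ ≃ Fin n × ℕ := Equiv.prodCongrRight π with he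
  have h1 : Finsupp.embDomain e.toEmbedding (multiLead (multiType α)) = α := by
    refine embDomain_eq_of_forall e ?_
    rintro ⟨i, m⟩
    rw [he, Equiv.prodCongrRight_apply, ← block_apply, hπ, ← block_apply, block_multiLead]
    rfl
  have h2 : MvPowerSeries.killCompl e.toEmbedding (toMultiSeries f) = toMultiSeries f := by
    have : (MvPowerSeries.killCompl e.toEmbedding).comp (toMultiSeries (n := n)) =
        toMultiSeries := by
      refine MvPolynomial.algHom_ext fun v => ?_
      rw [AlgHom.comp_apply, toMultiSeries_X, killCompl_psumSeries]
      rfl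
    exact AlgHom.congr_fun this f
  conv_lhs => rw [← h1, ← MvPowerSeries.coeff_killCompl, h2]

end Multi

/-! ### The coproduct -/

/-- The coproduct `f ↦ f[X + Y]`, as a polynomial in the power sums of `Y`. -/
def coprod : Sym →ₐ[Kqt] MvPolynomial ℕ+ Sym :=
  MvPolynomial.aeval fun r => MvPolynomial.C (MvPolynomial.X r) + MvPolynomial.X r

theorem coprod_X (r : ℕ+) : coprod (MvPolynomial.X r) =
    MvPolynomial.C (MvPolynomial.X r) + MvPolynomial.X r := by
  rw [coprod, MvPolynomial.aeval_X]

/-- The homomorphism that substitutes the series `y` for the power sums of `Y` and the series `x`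
for those of `X`. -/
def evalCoprod {σ : Type} (x y : ℕ+ → MvPowerSeries σ Kqt) :
    MvPolynomial ℕ+ Sym →+* MvPowerSeries σ Kqt :=
  MvPolynomial.eval₂Hom (MvPolynomial.aeval x : Sym →ₐ[Kqt] MvPowerSeries σ Kqt).toRingHom y

theorem evalCoprod_coprod {σ : Type} (x y : ℕ+ → MvPowerSeries σ Kqt) (f : Sym) :
    evalCoprod x y (coprod f) = MvPolynomial.aeval (fun r => x r + y r) f := by
  induction f using MvPolynomial.induction_on with
  | C c =>
    rw [← MvPolynomial.algebraMap_eq, AlgHom.commutes, AlgHom.commutes, evalCoprod,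
      MvPolynomial.algebraMap_apply, MvPolynomial.coe_eval₂Hom, MvPolynomial.eval₂_C]
    exact AlgHom.commutes (MvPolynomial.aeval x : Sym →ₐ[Kqt] MvPowerSeries σ Kqt) c
  | add p q hp hq => rw [map_add, map_add, hp, hq, map_add]
  | mul_X p r hp =>
    rw [map_mul, map_mul, hp, map_mul, coprod_X, map_add, MvPolynomial.aeval_X]
    congr 2
    · rw [evalCoprod, MvPolynomial.coe_eval₂Hom, MvPolynomial.eval₂_C]
      exact MvPolynomial.aeval_X x r
    · rw [evalCoprod, MvPolynomial.coe_eval₂Hom, MvPolynomial.eval₂_X]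

theorem evalCoprod_eq_sum {σ : Type} (x y : ℕ+ → MvPowerSeries σ Kqt)
    (g : MvPolynomial ℕ+ Sym) : evalCoprod x y g = ∑ β ∈ g.support,
      MvPolynomial.aeval x (MvPolynomial.coeff β g) *
        MvPolynomial.aeval y (MvPolynomial.monomial β (1 : Kqt)) := by
  rw [evalCoprod, MvPolynomial.coe_eval₂Hom, MvPolynomial.eval₂_eq]
  refine Finset.sum_congr rfl fun β _ => ?_
  rw [MvPolynomial.aeval_monomial, map_one, one_mul]
  rfl

/-- Bounds on the types of the monomials of `f` are inherited by the first factors of its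
coproduct. -/
theorem initSum_le_of_coprod {f : Sym} {L : ℕ → ℕ}
    (hf : ∀ α, MvPowerSeries.coeff α (toSeries f) ≠ 0 →
      ∀ j, ∑ i ∈ Finset.range j, (expType α).rowLen i ≤ L j)
    (β : ℕ+ →₀ ℕ) {γ : ℕ →₀ ℕ}
    (hγ : MvPowerSeries.coeff γ (toSeries (MvPolynomial.coeff β (coprod f))) ≠ 0) (j : ℕ) :
    initSum j γ ≤ L j := by
  classical
  by_contra hlt
  set x : ℕ+ → MvPowerSeries (ℕ ⊕ ℕ) Kqt := psumSeries (Set.range Sum.inl) with hx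
  set y : ℕ+ → MvPowerSeries (ℕ ⊕ ℕ) Kqt := psumSeries (Set.range Sum.inr) with hy
  -- Two countable alphabets together form one, so `f[X + Y]` is `f` itself after relabelling.
  obtain ⟨e⟩ : Nonempty (ℕ ⊕ ℕ ≃ ℕ) := nonempty_equiv_of_countable
  have hxy : ∀ r, x r + y r = psumSeries Set.univ r := by
    intro r
    ext α
    rw [map_add]
    by_cases hα : ∃ v, α = Finsupp.single v (r : ℕ)
    · obtain ⟨v, rfl⟩ := hα
      rw [coeff_single_psumSeries r (Set.mem_univ v)]
      have hzero : ∀ S : Set (ℕ ⊕ ℕ), v ∉ S →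
          MvPowerSeries.coeff (Finsupp.single v (r : ℕ)) (psumSeries S r) = 0 := by
        intro S hv
        by_contra h
        have := hasWeight_apply_psumSeries r hv _ h
        simp at this
      rcases v with v | v
      · rw [hx, hy, coeff_single_psumSeries r (Set.mem_range_self v), hzero _ (by simp), add_zero]
      · rw [hx, hy, coeff_single_psumSeries r (Set.mem_range_self v), hzero _ (by simp), zero_add]
    · have hzero : ∀ S : Set (ℕ ⊕ ℕ), MvPowerSeries.coeff α (psumSeries S r) = 0 := by
        intro S
        by_contra h
        obtain ⟨v, _, h1⟩ := exists_of_coeff_psumSeries_ne_zero h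
        exact hα ⟨v, h1⟩
      rw [hx, hy, hzero, hzero, hzero, add_zero]
  have h1 : evalCoprod x y (coprod f) =
      MvPowerSeries.killCompl e.toEmbedding (toSeries f) := by
    rw [evalCoprod_coprod]
    have : (MvPolynomial.aeval fun r => x r + y r : Sym →ₐ[Kqt] _) =
        (MvPowerSeries.killCompl e.toEmbedding).comp toSeries := by
      refine MvPolynomial.algHom_ext fun r => ?_
      rw [AlgHom.comp_apply, toSeries_X, killCompl_psumSeries, MvPolynomial.aeval_X, hxy]
      rfl
    rw [this, AlgHom.comp_apply]
  have hinl : ∀ g : Sym, MvPowerSeries.killCompl Function.Embedding.inl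
      (MvPolynomial.aeval x g : MvPowerSeries (ℕ ⊕ ℕ) Kqt) = toSeries g := by
    intro g
    have : (MvPowerSeries.killCompl Function.Embedding.inl).comp
        (MvPolynomial.aeval x : Sym →ₐ[Kqt] _) = toSeries := by
      refine MvPolynomial.algHom_ext fun r => ?_
      rw [AlgHom.comp_apply, toSeries_X, MvPolynomial.aeval_X, hx, killCompl_psumSeries]
      congr 1
      ext m
      simp
    rw [← this, AlgHom.comp_apply]
  have hinr : ∀ g : Sym, MvPowerSeries.killCompl Function.Embedding.inr
      (MvPolynomial.aeval y g : MvPowerSeries (ℕ ⊕ ℕ) Kqt) = toSeries g := by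
    intro g
    have : (MvPowerSeries.killCompl Function.Embedding.inr).comp
        (MvPolynomial.aeval y : Sym →ₐ[Kqt] _) = toSeries := by
      refine MvPolynomial.algHom_ext fun r => ?_
      rw [AlgHom.comp_apply, toSeries_X, MvPolynomial.aeval_X, hy, killCompl_psumSeries]
      congr 1
      ext m
      simp
    rw [← this, AlgHom.comp_apply]
  have hfil1 : ∀ δ : ℕ →₀ ℕ, (Finsupp.embDomain Function.Embedding.inl γ +
      Finsupp.embDomain Function.Embedding.inr δ : ℕ ⊕ ℕ →₀ ℕ).filter (· ∈ Set.range Sum.inl) =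
      Finsupp.embDomain Function.Embedding.inl γ := by
    intro δ
    ext (v | v)
    · rw [Finsupp.filter_apply_pos _ _ ⟨v, rfl⟩, Finsupp.add_apply,
        Finsupp.embDomain_of_notMem_range Function.Embedding.inr _ _ (by simp), add_zero]
    · rw [Finsupp.filter_apply_neg _ _ (by simp),
        Finsupp.embDomain_of_notMem_range Function.Embedding.inl _ _ (by simp)]
  have hfil2 : ∀ δ : ℕ →₀ ℕ, (Finsupp.embDomain Function.Embedding.inl γ +
      Finsupp.embDomain Function.Embedding.inr δ : ℕ ⊕ ℕ →₀ ℕ).filter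
        (fun v => ¬ v ∈ Set.range Sum.inl) = Finsupp.embDomain Function.Embedding.inr δ := by
    intro δ
    ext (v | v)
    · rw [Finsupp.filter_apply_neg _ _ (by simp),
        Finsupp.embDomain_of_notMem_range Function.Embedding.inr _ _ (by simp)]
    · rw [Finsupp.filter_apply_pos _ _ (by simp), Finsupp.add_apply,
        Finsupp.embDomain_of_notMem_range Function.Embedding.inl _ _ (by simp), zero_add]
  -- The coefficient of `x^γ` in `f[X + Y]`, regarded as a symmetric function of `Y`.
  set g : Sym := ∑ β ∈ (coprod f).support, MvPolynomial.monomial β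
    (MvPowerSeries.coeff γ (toSeries (MvPolynomial.coeff β (coprod f)))) with hg
  have h2 : ∀ δ, MvPowerSeries.coeff (Finsupp.embDomain Function.Embedding.inl γ +
      Finsupp.embDomain Function.Embedding.inr δ) (evalCoprod x y (coprod f)) =
      MvPowerSeries.coeff δ (toSeries g) := by
    intro δ
    rw [evalCoprod_eq_sum, map_sum, hg, map_sum, map_sum]
    refine Finset.sum_congr rfl fun β _ => ?_
    rw [coeff_mul_of_disjoint (Set.range Sum.inl), hfil1, hfil2, ← MvPowerSeries.coeff_killCompl,
      ← MvPowerSeries.coeff_killCompl, hinl, hinr]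
    · conv_rhs => rw [← mul_one (MvPowerSeries.coeff γ _), ← smul_eq_mul,
        ← MvPolynomial.smul_monomial, map_smul, map_smul, smul_eq_mul]
    · intro v hv
      refine HasWeight.algHom_zero _ (fun r => ?_) _
      rw [MvPolynomial.aeval_X]
      exact hasWeight_apply_psumSeries r hv
    · rintro _ ⟨v, rfl⟩
      refine HasWeight.algHom_zero _ (fun r => ?_) _
      rw [MvPolynomial.aeval_X]
      exact hasWeight_apply_psumSeries r (by simp)
  -- An exponent of `f` containing `γ` would have `j` entries with sum above `L j`, contrary to
  -- `hf`. Hence `g = 0`, and so are all its coefficients in the power sums of `Y`.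
  have h3 : toSeries g = 0 := by
    ext δ
    rw [← h2, h1, map_zero, MvPowerSeries.coeff_killCompl]
    by_contra h4
    refine hlt (le_trans ?_ (hf _ h4 j))
    set ε : ℕ ↪ ℕ := Function.Embedding.inl.trans e.toEmbedding with hε
    refine le_trans (le_of_eq ?_) (sum_le_of_expType ((Finset.range j).map ε) (by simp))
    rw [initSum_apply, Finset.sum_map]
    refine Finset.sum_congr rfl fun i _ => ?_
    have h5 : ε i = e.toEmbedding (Sum.inl i) := rfl
    rw [h5, Finsupp.embDomain_apply_self, Finsupp.add_apply,
      Finsupp.embDomain_of_notMem_range Function.Embedding.inr _ _ (by simp), add_zero]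
    exact (Finsupp.embDomain_apply_self Function.Embedding.inl γ i).symm
  have h6 : g = 0 := toSeries_injective (by rw [h3, map_zero])
  apply hγ
  by_cases hβ : β ∈ (coprod f).support
  · have h7 := congrArg (MvPolynomial.coeff β) h6
    rw [hg, MvPolynomial.coeff_sum, MvPolynomial.coeff_zero] at h7
    simp only [MvPolynomial.coeff_monomial] at h7
    rwa [Finset.sum_ite_eq', if_pos hβ] at h7
  · rw [MvPolynomial.notMem_support_iff.1 hβ, map_zero, map_zero]

/-! ### Triangularity of products of plethysms in several alphabets -/

section MultiLeading

variable {n : ℕ}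

theorem adams_smul (r : ℕ+) (c : Kqt) (Z : MSym n) : adams r (c • Z) = adamsK r c • adams r Z := by
  rw [MvPolynomial.smul_eq_C_mul, map_mul, MvPolynomial.smul_eq_C_mul]
  congr 1
  rw [adams, MvPolynomial.coe_eval₂Hom, MvPolynomial.eval₂_C]
  rfl

theorem adams_combination (r : ℕ+) (w : Fin n → Kqt) :
    adams r (∑ j, w j • alphabet j) = ∑ j, adamsK r (w j) • (MvPolynomial.X (j, r) : MSym n) := by
  rw [map_sum]
  exact Finset.sum_congr rfl fun j _ => by rw [adams_smul, adams_alphabet]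

theorem toMultiSeries_pleth (f : Sym) (Z : MSym n) : toMultiSeries (pleth f Z) =
    MvPolynomial.aeval (fun r => toMultiSeries (adams r Z)) f := by
  have : (toMultiSeries (n := n)).comp (MvPolynomial.aeval fun r => adams r Z) =
      MvPolynomial.aeval (fun r => toMultiSeries (adams r Z)) :=
    MvPolynomial.algHom_ext fun r => by
      rw [AlgHom.comp_apply, MvPolynomial.aeval_X, MvPolynomial.aeval_X]
  exact AlgHom.congr_fun this f

theorem toMultiSeries_adams_combination (r : ℕ+) (w : Fin n → Kqt) :
    toMultiSeries (adams r (∑ j, w j • alphabet j)) =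
      ∑ j, adamsK r (w j) • psumSeries {v : Fin n × ℕ | v.1 = j} r := by
  rw [adams_combination, map_sum]
  exact Finset.sum_congr rfl fun j _ => by rw [map_smul, toMultiSeries_X]

theorem hasWeight_psumSeries {σ : Type} {w : (σ →₀ ℕ) →+ ℕ} {S : Set σ} {r : ℕ+} {d : ℕ}
    (h : ∀ v ∈ S, w (Finsupp.single v (r : ℕ)) = d) : HasWeight w d (psumSeries S r) := by
  intro α hα
  obtain ⟨v, hv, rfl⟩ := exists_of_coeff_psumSeries_ne_zero hα
  exact h v hv

theorem hasWeight_block_psumSeries {w : (ℕ →₀ ℕ) →+ ℕ} {i j : Fin n} (h : j ≠ i) (r : ℕ+) :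
    HasWeight (w.comp (block i)) 0 (psumSeries {v : Fin n × ℕ | v.1 = j} r) := by
  refine hasWeight_psumSeries fun v hv => ?_
  have h1 : block i (Finsupp.single v (r : ℕ)) = 0 := by
    ext m
    rw [block_apply]
    refine Finsupp.single_eq_of_ne ?_
    rintro rfl
    exact h hv.symm
  rw [AddMonoidHom.comp_apply, h1, map_zero]

theorem sum_degree_block (α : Fin n × ℕ →₀ ℕ) : ∑ i, (block i α).degree = α.degree := by
  induction α using Finsupp.induction_linear with
  | zero => simp
  | add α β hα hβ => simp only [map_add, Finset.sum_add_distrib, hα, hβ]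
  | single v k =>
    have h1 : Finsupp.single v k = Finsupp.embDomain (blockEmb v.1) (Finsupp.single v.2 k) := by
      rw [Finsupp.embDomain_single]
      rfl
    rw [h1]
    simp only [block_embDomain, apply_ite, map_zero, Finsupp.degree_single]
    rw [← h1, Finsupp.degree_single, Finset.sum_ite_eq', if_pos (Finset.mem_univ _)]

theorem initSum_le_degree (j : ℕ) (α : ℕ →₀ ℕ) : initSum j α ≤ α.degree := by
  rw [← card_expType]
  exact (initSum_le_of_expType α j).trans (sum_rowLen_le_card _ _)

/-- The functionals that define the dominance order on the exponents of several alphabets. -/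
def multiSum (x : Fin n × ℕ) : (Fin n × ℕ →₀ ℕ) →+ ℕ :=
  ∑ i ∈ Finset.Iio x.1, Finsupp.degree.comp (block i) + (initSum x.2).comp (block x.1)

theorem multiSum_apply (i : Fin n) (j : ℕ) (α : Fin n × ℕ →₀ ℕ) : multiSum (i, j) α =
    ∑ l ∈ Finset.Iio i, (block l α).degree + initSum j (block i α) := by
  rw [multiSum, AddMonoidHom.add_apply, AddMonoidHom.finsetSum_apply]
  rfl

theorem multiSum_separating (α β : Fin n × ℕ →₀ ℕ) (h : ∀ x, multiSum x α = multiSum x β) :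
    α = β := by
  have key : ∀ i : Fin n, block i α = block i β := by
    intro i
    induction i using WellFoundedLT.induction with
    | ind i ih =>
      refine initSum_separating _ _ fun j => ?_
      have h1 := h (i, j)
      rw [multiSum_apply, multiSum_apply,
        Finset.sum_congr rfl fun l hl => by rw [ih l (Finset.mem_Iio.1 hl)]] at h1
      exact Nat.add_left_cancel h1
  ext ⟨i, m⟩
  rw [← block_apply, key i, block_apply]

theorem multiSum_le_degree (x : Fin n × ℕ) (α : Fin n × ℕ →₀ ℕ) : multiSum x α ≤ α.degree := by
  obtain ⟨i, j⟩ := x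
  rw [multiSum_apply, ← sum_degree_block, ← Finset.sum_erase_add _ _ (Finset.mem_univ i)]
  refine Nat.add_le_add (Finset.sum_le_sum_of_subset fun l hl => ?_) (initSum_le_degree _ _)
  exact Finset.mem_erase.2 ⟨(Finset.mem_Iio.1 hl).ne, Finset.mem_univ _⟩

section Triangular

variable {f : Sym} {lam : YoungDiagram}

theorem expType_of_triangular (h : toSeries f - monoSeries Set.univ lam ∈
    Submodule.span Kqt (monoSeries (Set.univ : Set ℕ) '' {mu | DomLT mu lam}))
    {α : ℕ →₀ ℕ} (hα : MvPowerSeries.coeff α (toSeries f) ≠ 0) :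
    (expType α).card = lam.card ∧ ∀ j, ∑ i ∈ Finset.range j, (expType α).rowLen i ≤
      ∑ i ∈ Finset.range j, lam.rowLen i := by
  classical
  by_cases h1 : expType α = lam
  · rw [h1]
    exact ⟨rfl, fun j => le_rfl⟩
  · by_contra h2
    have h3 := typ_mem_of_mem_span expType (monoSeries Set.univ)
      (fun i α => coeff_monoSeries i α) h (α := α) fun h4 => h2 h4.2
    rw [map_sub, coeff_monoSeries, if_neg h1, sub_zero] at h3
    exact hα h3

theorem coeff_leadExp_of_triangular (h : toSeries f - monoSeries Set.univ lam ∈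
    Submodule.span Kqt (monoSeries (Set.univ : Set ℕ) '' {mu | DomLT mu lam})) :
    MvPowerSeries.coeff (leadExp lam) (toSeries f) = 1 := by
  classical
  have h3 := typ_mem_of_mem_span expType (monoSeries Set.univ)
    (fun i α => coeff_monoSeries i α) h (α := leadExp lam) fun h4 => h4.1 (expType_leadExp lam)
  rw [map_sub, coeff_monoSeries, if_pos (expType_leadExp lam)] at h3
  exact sub_eq_zero.1 h3

theorem isWeightedHomogeneous_of_triangular (h : toSeries f - monoSeries Set.univ lam ∈
    Submodule.span Kqt (monoSeries (Set.univ : Set ℕ) '' {mu | DomLT mu lam})) :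
    MvPolynomial.IsWeightedHomogeneous (fun r : ℕ+ => (r : ℕ)) f lam.card :=
  isWeightedHomogeneous_of_hasWeight fun α hα => by
    rw [← card_expType]
    exact (expType_of_triangular h hα).1

variable {k : Fin n} {w : Fin n → Kqt}

/-- Setting all alphabets except the k-th to zero leaves `f[X_k]`, because `X_k` has coefficient 1.
-/
theorem killCompl_toMultiSeries_pleth (hk : w k = 1) (f : Sym) :
    MvPowerSeries.killCompl (blockEmb k) (toMultiSeries (pleth f (∑ j, w j • alphabet j))) =
      toSeries f := by
  have : (MvPowerSeries.killCompl (blockEmb k)).comp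
      (MvPolynomial.aeval fun r => toMultiSeries (adams r (∑ j, w j • alphabet j))) =
      toSeries := by
    refine MvPolynomial.algHom_ext fun r => ?_
    rw [AlgHom.comp_apply, MvPolynomial.aeval_X, toSeries_X, toMultiSeries_adams_combination,
      map_sum, Finset.sum_eq_single_of_mem k (Finset.mem_univ k), map_smul, hk, map_one, one_smul,
      killCompl_psumSeries]
    · congr 1
      exact Set.eq_univ_of_forall fun m => rfl
    · intro j _ hj
      rw [map_smul, killCompl_psumSeries]
      have : psumSeries (blockEmb k ⁻¹' {v : Fin n × ℕ | v.1 = j}) r = 0 := by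
        ext α
        rw [map_zero]
        by_contra hα
        obtain ⟨v, hv, -⟩ := exists_of_coeff_psumSeries_ne_zero hα
        exact hj hv.symm
      rw [this, smul_zero]
  rw [toMultiSeries_pleth]
  exact AlgHom.congr_fun this f

theorem hasWeight_block_toMultiSeries_pleth (hlt : ∀ j < k, w j = 0) {i : Fin n} (hi : i < k)
    (u : (ℕ →₀ ℕ) →+ ℕ) (f : Sym) :
    HasWeight (u.comp (block i)) 0 (toMultiSeries (pleth f (∑ j, w j • alphabet j))) := by
  rw [toMultiSeries_pleth]
  refine HasWeight.algHom_zero _ (fun r => ?_) f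
  rw [MvPolynomial.aeval_X, toMultiSeries_adams_combination]
  refine HasWeight.sum _ fun j _ => ?_
  by_cases hj : j = i
  · rw [hlt j (hj ▸ hi), map_zero, zero_smul]
    exact HasWeight.zero _ _
  · exact (hasWeight_block_psumSeries hj r).smul _

theorem hasWeight_degree_toMultiSeries_pleth (w : Fin n → Kqt) {d : ℕ}
    (hf : MvPolynomial.IsWeightedHomogeneous (fun r : ℕ+ => (r : ℕ)) f d) :
    HasWeight Finsupp.degree d (toMultiSeries (pleth f (∑ j, w j • alphabet j))) := by
  rw [toMultiSeries_pleth]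
  refine hasWeight_of_isWeightedHomogeneous _ (fun r => ?_) hf
  rw [MvPolynomial.aeval_X, toMultiSeries_adams_combination]
  exact HasWeight.sum _ fun j _ => (hasWeight_degree_psumSeries _ r).smul _

/-- The alphabet is `X_k` plus a rest without variables of block `k`. Hence that block only sees the
first factors of the coproduct, which `initSum_le_of_coprod` bounds whatever is substituted for `Y`.
-/
theorem initSum_block_le (hk : w k = 1) {L : ℕ → ℕ}
    (hf : ∀ α, MvPowerSeries.coeff α (toSeries f) ≠ 0 →
      ∀ j, ∑ i ∈ Finset.range j, (expType α).rowLen i ≤ L j) {α : Fin n × ℕ →₀ ℕ}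
    (hα : MvPowerSeries.coeff α (toMultiSeries (pleth f (∑ j, w j • alphabet j))) ≠ 0) (j : ℕ) :
    initSum j (block k α) ≤ L j := by
  set x : ℕ+ → MvPowerSeries (Fin n × ℕ) Kqt := psumSeries {v | v.1 = k} with hx
  set y : ℕ+ → MvPowerSeries (Fin n × ℕ) Kqt := fun r =>
    ∑ j ∈ Finset.univ.erase k, adamsK r (w j) • psumSeries {v | v.1 = j} r with hy
  have h1 : (fun r => toMultiSeries (adams r (∑ j, w j • alphabet j))) = fun r => x r + y r := by
    funext r
    rw [toMultiSeries_adams_combination, ← Finset.add_sum_erase _ _ (Finset.mem_univ k), hk,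
      map_one, one_smul]
  rw [toMultiSeries_pleth, h1, ← evalCoprod_coprod, evalCoprod_eq_sum, map_sum] at hα
  obtain ⟨β, -, hβ⟩ := Finset.exists_ne_zero_of_sum_ne_zero hα
  obtain ⟨α₁, α₂, rfl, h2, h3⟩ := exists_of_coeff_mul_ne_zero hβ
  have h4 : initSum j (block k α₂) = 0 := by
    refine HasWeight.algHom_zero (w := (initSum j).comp (block k)) _ (fun r => ?_) _ α₂ h3
    rw [MvPolynomial.aeval_X]
    exact HasWeight.sum _ fun i hi =>
      (hasWeight_block_psumSeries (Finset.ne_of_mem_erase hi) r).smul _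
  have h5 : Finsupp.embDomain (blockEmb k) (block k α₁) = α₁ := by
    refine embDomain_block fun v hv => ?_
    refine HasWeight.algHom_zero (w := Finsupp.applyAddHom v) _ (fun r => ?_) _ α₁ h2
    rw [MvPolynomial.aeval_X]
    exact hasWeight_apply_psumSeries r hv
  have h6 : (MvPowerSeries.killCompl (blockEmb k)).comp (MvPolynomial.aeval x) = toSeries := by
    refine MvPolynomial.algHom_ext fun r => ?_
    rw [AlgHom.comp_apply, MvPolynomial.aeval_X, toSeries_X, hx, killCompl_psumSeries]
    congr 1
    exact Set.eq_univ_of_forall fun m => rfl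
  rw [map_add, map_add, h4, add_zero]
  refine initSum_le_of_coprod hf β ?_ j
  rwa [← AlgHom.congr_fun h6, AlgHom.comp_apply, MvPowerSeries.coeff_killCompl, h5]

theorem leadsAt_toMultiSeries_pleth (h : toSeries f - monoSeries Set.univ lam ∈
    Submodule.span Kqt (monoSeries (Set.univ : Set ℕ) '' {mu | DomLT mu lam}))
    (hk : w k = 1) (hlt : ∀ j < k, w j = 0) :
    LeadsAt multiSum (toMultiSeries (pleth f (∑ j, w j • alphabet j)))
      (Finsupp.embDomain (blockEmb k) (leadExp lam)) 1 := by
  refine ⟨?_, ?_⟩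
  · rw [← MvPowerSeries.coeff_killCompl, killCompl_toMultiSeries_pleth hk]
    exact coeff_leadExp_of_triangular h
  · rintro α hα ⟨i, j⟩
    have h0 : ∀ l < k, ∀ u : (ℕ →₀ ℕ) →+ ℕ, u (block l α) = 0 := fun l hl u =>
      hasWeight_block_toMultiSeries_pleth hlt hl u f α hα
    rcases lt_trichotomy i k with hik | rfl | hik
    · rw [multiSum_apply, h0 i hik, Finset.sum_eq_zero fun l hl =>
        h0 l ((Finset.mem_Iio.1 hl).trans hik) Finsupp.degree]
      exact Nat.zero_le _
    · rw [multiSum_apply, Finset.sum_eq_zero fun l hl => h0 l (Finset.mem_Iio.1 hl) Finsupp.degree,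
        zero_add, multiSum_apply, block_embDomain, if_pos rfl]
      refine (initSum_block_le hk (fun α hα => (expType_of_triangular h hα).2) hα j).trans ?_
      rw [initSum_apply]
      exact Nat.le_add_left _ _
    -- Beyond block `k` the functional at the leading exponent already equals the total degree,
    -- which bounds it on every exponent.
    · refine (multiSum_le_degree _ _).trans ?_
      rw [hasWeight_degree_toMultiSeries_pleth w (isWeightedHomogeneous_of_triangular h) α hα,
        multiSum_apply]
      refine le_trans ?_ (Nat.le_add_right _ _)
      refine le_trans (le_of_eq ?_) (Finset.single_le_sum (f := fun l =>
        (block l (Finsupp.embDomain (blockEmb k) (leadExp lam))).degree)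
        (fun l _ => Nat.zero_le _) (Finset.mem_Iio.2 hik))
      rw [block_embDomain, if_pos rfl, degree_leadExp]

end Triangular

theorem triangular_prod_pleth {P : Fin n → Sym} {lam : Fin n → YoungDiagram}
    (h : ∀ i, toSeries (P i) - monoSeries Set.univ (lam i) ∈
      Submodule.span Kqt (monoSeries (Set.univ : Set ℕ) '' {mu | DomLT mu (lam i)}))
    {w : Fin n → Fin n → Kqt} (hw : ∀ i, w i i = 1) (hlt : ∀ i, ∀ j < i, w i j = 0) :
    toMultiSeries (∏ i, pleth (P i) (∑ j, w i j • alphabet j)) - multiMonoSeries lam ∈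
      Submodule.span Kqt (multiMonoSeries '' {mu | MultiDomLT mu lam}) := by
  classical
  set F := toMultiSeries (∏ i, pleth (P i) (∑ j, w i j • alphabet j)) with hF
  have hlead : LeadsAt multiSum F (multiLead lam) 1 := by
    rw [hF, map_prod]
    have := LeadsAt.prod multiSum_separating Finset.univ fun i _ =>
      leadsAt_toMultiSeries_pleth (h i) (hw i) (hlt i)
    rwa [Finset.prod_const_one] at this
  have hdeg : HasWeight Finsupp.degree (∑ i, (lam i).card) F := by
    rw [hF, map_prod]
    exact HasWeight.prod _ fun i _ =>
      hasWeight_degree_toMultiSeries_pleth _ (isWeightedHomogeneous_of_triangular (h i))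
  have hcoeff : ∀ α, MvPowerSeries.coeff α F =
      MvPowerSeries.coeff (multiLead (multiType α)) F := fun α =>
    coeff_toMultiSeries_eq_multiLead α _
  refine mem_span_of_coeff multiType multiLead multiMonoSeries
    (fun i α => (coeff_multiMonoSeries i α).trans (by congr)) _ (fun α => ?_) (finite_multiDomLT lam) fun α hα => ?_
  · rw [map_sub, map_sub, coeff_multiMonoSeries, coeff_multiMonoSeries, multiType_multiLead,
      ← hcoeff]
  · rw [map_sub, coeff_multiMonoSeries, hcoeff] at hα
    by_cases h1 : multiType α = lam
    · rw [h1, if_pos rfl, hlead.1, sub_self] at hα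
      exact absurd rfl hα
    · rw [if_neg h1, sub_zero] at hα
      refine ⟨h1, ?_, fun k j => ?_⟩
      · rw [← hdeg _ hα, ← sum_degree_block]
        exact Finset.sum_congr rfl fun i _ => by rw [block_multiLead, degree_leadExp]
      · have := hlead.2 _ hα (k, j)
        simp only [multiSum_apply, block_multiLead, degree_leadExp, initSum_apply] at this
        exact this

end MultiLeading

/-! ### The scalar product of multi-symmetric functions -/

theorem weight_powerSum (lam : YoungDiagram) :
    MvPolynomial.IsWeightedHomogeneous (fun r : ℕ+ => (r : ℕ)) (powerSum lam) lam.card := by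
  have := weight_sum_toMultiset (parts lam)
  rwa [map_parts, ← values_leadExp, sum_values, degree_leadExp] at this

theorem powerSum_eq_monomial (lam : YoungDiagram) :
    powerSum lam = MvPolynomial.monomial (partitionEquiv lam) 1 := by
  rw [← powerSumBasis_apply, powerSumBasis, Module.Basis.reindex_apply,
    MvPolynomial.coe_basisMonomials, Equiv.symm_symm]

theorem fockNorm_pow_mul (c : ℕ+ → Kqt) (κ : Kqt) (lam : YoungDiagram) :
    fockNorm (fun r : ℕ+ => κ ^ (r : ℕ) * c r) (partitionEquiv lam) =
      κ ^ lam.card * fockNorm c (partitionEquiv lam) := by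
  have := fock_weight c κ (weight_powerSum lam) (powerSum lam)
  rw [powerSum_eq_monomial] at this
  simpa [fock_monomial_left] using this

section

variable (n : ℕ) (a b : Kqt)

/-- The norms of the power sums of the partial sums of the alphabets. -/
def multiWeight (v : Fin n × ℕ+) : Kqt :=
  (a ^ (n - 1 - (v.1 : ℕ))) ^ (v.2 : ℕ) *
    if (v.1 : ℕ) + 1 = n then macWeight a b v.2 else macWeight 0 0 v.2

variable {n}

theorem fockNorm_prod (c : Fin n × ℕ+ → Kqt) (lam : Fin n → YoungDiagram) :
    fockNorm c (multiPartitionEquiv n lam) =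
      ∏ i, fockNorm (fun r => c (i, r)) (partitionEquiv (lam i)) := by
  classical
  set s : Finset ℕ+ := Finset.univ.biUnion fun i => (partitionEquiv (lam i)).support with hs
  have h1 : ∀ i, (partitionEquiv (lam i)).support ⊆ s := fun i =>
    Finset.subset_biUnion_of_mem (fun i => (partitionEquiv (lam i)).support) (Finset.mem_univ i)
  have h2 : ∀ i r, multiPartitionEquiv n lam (i, r) = partitionEquiv (lam i) r := fun i r => rfl
  have h3 : (multiPartitionEquiv n lam).support ⊆ Finset.univ ×ˢ s := by
    rintro ⟨i, r⟩ h
    rw [Finsupp.mem_support_iff, h2] at h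
    exact Finset.mem_product.2 ⟨Finset.mem_univ _, h1 i (Finsupp.mem_support_iff.2 h)⟩
  rw [fockNorm, Finsupp.prod_of_support_subset _ h3 _ (by simp), Finset.prod_product]
  refine Finset.prod_congr rfl fun i _ => ?_
  rw [fockNorm, Finsupp.prod_of_support_subset _ (h1 i) _ (by simp)]
  simp only [h2]

/-- In the earlier alphabets the norm is `z_λ` alone, obtained from the parameters `(0, 0)` because
`zeeFactor 0 0` is 1. Only the last alphabet carries the Macdonald factor. -/
theorem fockNorm_multiPartitionEquiv (lam : Fin n → YoungDiagram) :
    fockNorm (multiWeight n a b) (multiPartitionEquiv n lam) = multiZee n a b lam := by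
  have hz : ∀ mu, zeeFactor 0 0 mu = 1 := fun mu => by simp [zeeFactor]
  have h1 : ∀ i : Fin n, fockNorm (fun r => multiWeight n a b (i, r)) (partitionEquiv (lam i)) =
      a ^ ((n - 1 - (i : ℕ)) * (lam i).card) * zee (lam i) *
        if (i : ℕ) + 1 = n then zeeFactor a b (lam i) else 1 := by
    intro i
    have := fockNorm_pow_mul (fun r => if (i : ℕ) + 1 = n then macWeight a b r else macWeight 0 0 r)
      (a ^ (n - 1 - (i : ℕ))) (lam i)
    refine this.trans ?_
    rw [← pow_mul, mul_assoc]
    congr 1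
    split_ifs with h
    · exact fockNorm_partitionEquiv a b (lam i)
    · rw [← hz (lam i)]
      exact fockNorm_partitionEquiv 0 0 (lam i)
  have h2 : ((n : ℤ) - 1) * ∑ i, ((lam i).card : ℤ) -
      ∑ i : Fin n, ((i : ℕ) : ℤ) * ((lam i).card : ℤ) =
      ((∑ i : Fin n, (n - 1 - (i : ℕ)) * (lam i).card : ℕ) : ℤ) := by
    rw [Finset.mul_sum, ← Finset.sum_sub_distrib, Nat.cast_sum]
    refine Finset.sum_congr rfl fun i _ => ?_
    have : ((n - 1 - (i : ℕ) : ℕ) : ℤ) = n - 1 - i := by omega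
    rw [Nat.cast_mul, this]
    ring
  rw [fockNorm_prod, multiZee, h2, zpow_natCast, ← Finset.prod_pow_eq_pow_sum,
    ← Finset.prod_mul_distrib, ← Finset.prod_mul_distrib]
  exact Finset.prod_congr rfl fun i _ => h1 i

/-- In the coordinates given by the power sums of the partial sums of alphabets, the form is
diagonal on monomials. -/
theorem multiScalarProduct_eq_fock (f g : MSym n) : multiScalarProduct n a b f g =
    fock (multiWeight n a b) ((partialEquiv n).symm f) ((partialEquiv n).symm g) := by
  have hrepr : ∀ (f : MSym n) lam, (multiPowerSumBasis n).repr f lam =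
      MvPolynomial.coeff (multiPartitionEquiv n lam) ((partialEquiv n).symm f) := fun f lam => by
    rw [multiPowerSumBasis, Module.Basis.map_repr, LinearEquiv.trans_apply,
      Module.Basis.repr_reindex_apply, Equiv.symm_symm]
    rfl
  rw [multiScalarProduct, Finsupp.sum, fock]
  refine Finset.sum_equiv (multiPartitionEquiv n) (fun lam => ?_) fun lam _ => ?_
  · rw [Finsupp.mem_support_iff, hrepr, MvPolynomial.mem_support_iff]
  · rw [hrepr, hrepr, fockNorm_multiPartitionEquiv]

end

/-! ### A Gram matrix -/

section Gram

variable {K : Type*} [Field K]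

/-- The coefficients `g_j / g_k` for `j ≥ k`. -/
def ratioCoeff (g : ℕ → K) (k j : ℕ) : K := if j < k then 0 else g j / g k

theorem ratioCoeff_of_lt (g : ℕ → K) {k j : ℕ} (h : j < k) : ratioCoeff g k j = 0 := if_pos h

theorem ratioCoeff_of_le (g : ℕ → K) {k j : ℕ} (h : k ≤ j) : ratioCoeff g k j = g j / g k :=
  if_neg (by omega)

/-- The hypothesis `hc` makes the products of differences of ratios telescope. For `k < l` the terms
from `l` on give `κ / g k`, and the jump of the second sequence at `l - 1` gives `-κ / g k`. For `k
= l` that jump is squared and adds `c (k - 1)` instead, except for `k = 0`, where there is no jump.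
-/
theorem sum_ratioCoeff_of_le {g c : ℕ → K} {n : ℕ} {κ : K} (hg : ∀ i < n, g i ≠ 0)
    (hgn : g n = 0) (hc : ∀ i < n, (g i - g (i + 1)) * c i = κ) {k l : ℕ} (hkl : k ≤ l)
    (hl : l < n) :
    ∑ i ∈ Finset.range n, (ratioCoeff g k i - ratioCoeff g k (i + 1)) *
        (c i * (ratioCoeff g l i - ratioCoeff g l (i + 1))) =
      if k = l then κ / g k + (if k = 0 then 0 else c (k - 1)) else 0 := by
  have hk0 := hg k (by omega)
  have hl0 := hg l hl
  have htail : ∑ i ∈ Finset.Ico l n, (ratioCoeff g k i - ratioCoeff g k (i + 1)) *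
      (c i * (ratioCoeff g l i - ratioCoeff g l (i + 1))) = κ / g k := by
    have : ∀ i ∈ Finset.Ico l n, (ratioCoeff g k i - ratioCoeff g k (i + 1)) *
        (c i * (ratioCoeff g l i - ratioCoeff g l (i + 1))) =
        -(κ / (g k * g l)) * (g (i + 1) - g i) := by
      intro i hi
      rw [Finset.mem_Ico] at hi
      rw [ratioCoeff_of_le g (show k ≤ i by omega), ratioCoeff_of_le g (show k ≤ i + 1 by omega),
        ratioCoeff_of_le g hi.1, ratioCoeff_of_le g (show l ≤ i + 1 by omega), ← hc i hi.2]
      field_simp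
      ring
    rw [Finset.sum_congr rfl this, ← Finset.mul_sum, Finset.sum_Ico_sub g hl.le, hgn]
    field_simp
    ring
  rw [← Finset.sum_range_add_sum_Ico _ hl.le, htail]
  rcases Nat.eq_zero_or_pos l with rfl | hlpos
  · obtain rfl : k = 0 := by omega
    simp
  obtain ⟨l, rfl⟩ : ∃ l', l = l' + 1 := ⟨l - 1, by omega⟩
  rw [Finset.sum_range_succ, Finset.sum_eq_zero, zero_add]
  · rw [ratioCoeff_of_lt g (lt_add_one l), ratioCoeff_of_le g le_rfl, div_self hl0]
    split_ifs with h1 h2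
    · omega
    · subst h1
      rw [ratioCoeff_of_lt g (lt_add_one l), ratioCoeff_of_le g le_rfl, div_self hl0,
        Nat.add_sub_cancel]
      ring
    · rw [ratioCoeff_of_le g (show k ≤ l by omega), ratioCoeff_of_le g hkl,
        ← hc l (by omega)]
      field_simp
      ring
  · intro i hi
    rw [Finset.mem_range] at hi
    rw [ratioCoeff_of_lt g (show i < l + 1 by omega),
      ratioCoeff_of_lt g (show i + 1 < l + 1 by omega)]
    ring

theorem sum_ratioCoeff {g c : ℕ → K} {n : ℕ} {κ : K} (hg : ∀ i < n, g i ≠ 0)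
    (hgn : g n = 0) (hc : ∀ i < n, (g i - g (i + 1)) * c i = κ) {k l : ℕ} (hk : k < n)
    (hl : l < n) :
    ∑ i ∈ Finset.range n, (ratioCoeff g k i - ratioCoeff g k (i + 1)) *
        (c i * (ratioCoeff g l i - ratioCoeff g l (i + 1))) =
      if k = l then κ / g k + (if k = 0 then 0 else c (k - 1)) else 0 := by
  rcases le_total k l with h | h
  · exact sum_ratioCoeff_of_le hg hgn hc h hl
  · have := sum_ratioCoeff_of_le hg hgn hc h hk
    rw [Finset.sum_congr rfl fun i _ => show _ = (ratioCoeff g l i - ratioCoeff g l (i + 1)) *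
      (c i * (ratioCoeff g k i - ratioCoeff g k (i + 1))) by ring, this]
    by_cases hkl : k = l
    · rw [hkl]
    · rw [if_neg hkl, if_neg (Ne.symm hkl)]

theorem sum_smul_sub_shift {M : Type*} [AddCommGroup M] [Module K M] (w : ℕ → K) (x : ℕ → M)
    (n : ℕ) : ∑ j ∈ Finset.range n, w j • (x j - if j = 0 then 0 else x (j - 1)) =
      ∑ j ∈ Finset.range n, (w j - w (j + 1)) • x j +
        w n • if n = 0 then 0 else x (n - 1) := by
  induction n with
  | zero => simp
  | succ n ih =>
    rw [Finset.sum_range_succ, ih, Finset.sum_range_succ, if_neg (Nat.succ_ne_zero n),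
      Nat.add_sub_cancel, smul_sub, sub_smul]
    abel

end Gram

/-! ### The alphabets of the factors -/

theorem adamsK_q (r : ℕ+) : adamsK r q = q ^ (r : ℕ) := by
  rw [adamsK, q, IsFractionRing.map, IsLocalization.map_eq, ← map_pow]
  congr 1
  exact MvPolynomial.expand_X _ _

theorem adamsK_t (r : ℕ+) : adamsK r t = t ^ (r : ℕ) := by
  rw [adamsK, t, IsFractionRing.map, IsLocalization.map_eq, ← map_pow]
  congr 1
  exact MvPolynomial.expand_X _ _

theorem genericParams_q_pow_mul_t (m : ℕ) : GenericParams q (q ^ m * t) := by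
  have := genericParams_of_exponents (x := 1) (y := 0) (z := m) (w := 1) (by norm_num)
  simpa using this

theorem genericParams_factor {n : ℕ} (k : Fin n) :
    GenericParams (firstParam n k) (secondParam n k) := by
  rw [firstParam, secondParam]
  split_ifs with h
  · exact genericParams_q_pow_mul_t _
  · have := genericParams_of_exponents (x := n - k) (y := 1) (z := n - 1 - k) (w := 1) (by
      have := k.isLt
      omega)
    simpa using this

theorem q_ne_zero : q ≠ 0 := fun h => by
  have := (genericParams_q_pow_mul_t 1).ne_zero_right
  simp [h] at this

theorem q_pow_ne_one (r : ℕ+) : 1 - q ^ (r : ℕ) ≠ 0 := sub_ne_zero.2 fun h => by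
  have := (genericParams_q_pow_mul_t 0).pow_left_ne_one (r - 1)
  rw [Nat.sub_add_cancel r.pos] at this
  exact this h.symm

theorem one_sub_pow_ne_zero (m : ℕ) (r : ℕ+) : 1 - (q ^ (r : ℕ)) ^ m * t ^ (r : ℕ) ≠ 0 :=
  sub_ne_zero.2 fun h => by
    have := (genericParams_q_pow_mul_t m).pow_right_ne_one (r - 1)
    rw [Nat.sub_add_cancel r.pos, mul_pow, ← pow_mul, mul_comm m, pow_mul] at this
    exact this h.symm

/-- The numbers whose ratios are the coefficients of the alphabets of the factors. -/
def factorSeq (Q T : Kqt) (n j : ℕ) : Kqt := if j < n then Q ^ j - Q ^ (n - 1) * T else 0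

/-- The coefficient of the `j`-th alphabet in the alphabet of the `k`-th factor. -/
def factorCoeff (Q T : Kqt) (n k j : ℕ) : Kqt := ratioCoeff (factorSeq Q T n) k j

theorem factorSeq_of_lt (Q T : Kqt) {n j : ℕ} (h : j < n) :
    factorSeq Q T n j = Q ^ j * (1 - Q ^ (n - 1 - j) * T) := by
  rw [factorSeq, if_pos h, mul_sub, mul_one, ← mul_assoc, ← pow_add]
  congr 4
  omega

theorem factorSeq_ne_zero (r : ℕ+) {n j : ℕ} (h : j < n) :
    factorSeq (q ^ (r : ℕ)) (t ^ (r : ℕ)) n j ≠ 0 := by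
  rw [factorSeq_of_lt _ _ h]
  exact mul_ne_zero (pow_ne_zero _ (pow_ne_zero _ q_ne_zero)) (one_sub_pow_ne_zero _ r)

theorem adamsK_factorSeq (r : ℕ+) (n j : ℕ) :
    adamsK r (factorSeq q t n j) = factorSeq (q ^ (r : ℕ)) (t ^ (r : ℕ)) n j := by
  rw [factorSeq, factorSeq]
  split_ifs
  · rw [map_sub, map_mul, map_pow, map_pow, adamsK_q, adamsK_t]
  · exact map_zero _

theorem adamsK_factorCoeff (r : ℕ+) (n k j : ℕ) :
    adamsK r (factorCoeff q t n k j) = factorCoeff (q ^ (r : ℕ)) (t ^ (r : ℕ)) n k j := by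
  rw [factorCoeff, factorCoeff, ratioCoeff, ratioCoeff]
  split_ifs
  · exact map_zero _
  · rw [map_div₀, adamsK_factorSeq, adamsK_factorSeq]

/-! ### Orthogonality of the alphabets of the factors -/

section

variable {n : ℕ}

/-- The alphabet of the `k`-th factor. -/
def factorAlphabet (k : Fin n) : MSym n := ∑ j : Fin n, factorCoeff q t n k j • alphabet j

theorem adams_factorAlphabet (k : Fin n) (r : ℕ+) : adams r (factorAlphabet k) =
    ∑ j : Fin n, factorCoeff (q ^ (r : ℕ)) (t ^ (r : ℕ)) n k j • MvPolynomial.X (j, r) := by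
  rw [factorAlphabet, adams_combination]
  exact Finset.sum_congr rfl fun j _ => by rw [adamsK_factorCoeff]

theorem partialEquiv_symm_adams_factorAlphabet (k : Fin n) (r : ℕ+) :
    (partialEquiv n).symm (adams r (factorAlphabet k)) =
      ∑ i : Fin n, (factorCoeff (q ^ (r : ℕ)) (t ^ (r : ℕ)) n k i -
        factorCoeff (q ^ (r : ℕ)) (t ^ (r : ℕ)) n k (i + 1)) • MvPolynomial.X (i, r) := by
  set w := factorCoeff (q ^ (r : ℕ)) (t ^ (r : ℕ)) n k with hw
  set x : ℕ → MSym n := fun j => if h : j < n then MvPolynomial.X (⟨j, h⟩, r) else 0 with hx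
  have hxj : ∀ j : Fin n, x j = MvPolynomial.X (j, r) := fun j => dif_pos j.isLt
  have hsymm : ∀ j : Fin n, (partialEquiv n).symm (MvPolynomial.X (j, r)) =
      x j - if (j : ℕ) = 0 then 0 else x (j - 1) := by
    intro j
    have h1 : (partialEquiv n).symm (MvPolynomial.X (j, r)) =
        MvPolynomial.X (j, r) - prevVar j r := MvPolynomial.aeval_X _ (j, r)
    rw [h1, hxj, prevVar]
    congr 1
    split_ifs with h
    · rfl
    · exact (hxj ⟨j - 1, by omega⟩).symm
  -- The sequence is cut off to 0 at `n`, so the boundary term of the summation by parts vanishes.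
  have hwn : w n = 0 := by
    rw [hw, factorCoeff, ratioCoeff_of_le _ k.isLt.le, factorSeq, if_neg (lt_irrefl n), zero_div]
  rw [adams_factorAlphabet, map_sum]
  have h1 := sum_smul_sub_shift w x n
  rw [hwn, zero_smul, add_zero, Finset.sum_range, Finset.sum_range] at h1
  rw [Finset.sum_congr rfl fun j _ => by rw [map_smul, hsymm j], h1]
  exact Finset.sum_congr rfl fun j _ => by rw [hxj]

/-- The substitution of the alphabets of the factors. -/
def factorHom (n : ℕ) : MSym n →ₐ[Kqt] MSym n := multiPleth factorAlphabet

theorem factorHom_X (v : Fin n × ℕ+) :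
    factorHom n (MvPolynomial.X v) = adams v.2 (factorAlphabet v.1) := MvPolynomial.aeval_X _ v

theorem factorHom_rename (k : Fin n) (f : Sym) :
    factorHom n (MvPolynomial.rename (Prod.mk k) f) = pleth f (factorAlphabet k) := by
  rw [factorHom, multiPleth, MvPolynomial.aeval_rename]
  rfl

/-- The norms of the power sums of the alphabets of the factors. -/
def factorWeight (v : Fin n × ℕ+) : Kqt :=
  (q ^ (n - 1 - (v.1 : ℕ))) ^ (v.2 : ℕ) * macWeight (firstParam n v.1) (secondParam n v.1) v.2

theorem macWeight_zero_zero (r : ℕ+) : macWeight (0 : Kqt) 0 r = (r : ℕ) := by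
  simp [macWeight]

/-- `multiWeight` in terms of `q^r` and `t^r`. -/
theorem multiWeight_eq (i : Fin n) (r : ℕ+) : multiWeight n q t (i, r) =
    (q ^ (r : ℕ)) ^ (n - 1 - (i : ℕ)) *
      if (i : ℕ) + 1 = n then (r : ℕ) * ((1 - q ^ (r : ℕ)) / (1 - t ^ (r : ℕ))) else (r : ℕ) := by
  rw [multiWeight, macWeight_zero_zero, macWeight, ← pow_mul, ← pow_mul, mul_comm (n - 1 - (i : ℕ))]

/-- With `Q = q^r`, `T = t^r` and `m = n - 1 - k`, this is `(1 - Q) / (1 - Q^m T) + Q = (1 - Q^(m+1)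
T) / (1 - Q^m T)`, up to the factor `r Q^m`. For `k = 0` the summand `Q` is absent, which is why the
first factor has first parameter `q`. -/
theorem factorWeight_eq (k : Fin n) (r : ℕ+) : factorWeight (k, r) =
    (r : ℕ) * (q ^ (r : ℕ)) ^ (n - 1) * (1 - q ^ (r : ℕ)) /
      factorSeq (q ^ (r : ℕ)) (t ^ (r : ℕ)) n k +
      if (k : ℕ) = 0 then 0 else (q ^ (r : ℕ)) ^ (n - k) * (r : ℕ) := by
  have hm := one_sub_pow_ne_zero (n - 1 - k) r
  have hpow : ∀ m : ℕ, (q ^ m * t) ^ (r : ℕ) = (q ^ (r : ℕ)) ^ m * t ^ (r : ℕ) := fun m => by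
    rw [mul_pow, ← pow_mul, mul_comm m, pow_mul]
  have hQ : (q ^ (r : ℕ)) ≠ 0 := pow_ne_zero _ q_ne_zero
  have hk := k.isLt
  rw [factorWeight, macWeight, factorSeq_of_lt _ _ hk, firstParam, secondParam, hpow, ← pow_mul,
    mul_comm (n - 1 - (k : ℕ)) (r : ℕ), pow_mul]
  obtain ⟨m, hm1⟩ : ∃ m, n = m + k + 1 := ⟨n - 1 - k, by omega⟩
  have h1 : n - 1 - k = m := by omega
  have h2 : n - 1 = m + k := by omega
  have h3 : n - k = m + 1 := by omega
  split_ifs with hk0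
  · rw [h1] at hm
    rw [h1, h2, hk0]
    field_simp
    ring
  · rw [h3, hpow]
    rw [h1] at hm
    rw [h1, h2, pow_add _ m]
    field_simp
    ring

/-- The Gram matrix of the `p_r[Y_k]`. In the notation `Q = q^r`, `T = t^r`, the constant is `κ = r
Q^(n-1) (1 - Q)`: for `i < n - 1` the difference `g_i - g_(i+1)` is `Q^i (1 - Q)`, while at `i = n -
1` it is `Q^(n-1) (1 - T)`, which cancels the denominator of the last norm. -/
theorem sum_factorCoeff (k l : Fin n) (r : ℕ+) :
    ∑ i : Fin n, (factorCoeff (q ^ (r : ℕ)) (t ^ (r : ℕ)) n k i -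
        factorCoeff (q ^ (r : ℕ)) (t ^ (r : ℕ)) n k (i + 1)) * (multiWeight n q t (i, r) *
      (factorCoeff (q ^ (r : ℕ)) (t ^ (r : ℕ)) n l i -
        factorCoeff (q ^ (r : ℕ)) (t ^ (r : ℕ)) n l (i + 1))) =
      if k = l then factorWeight (k, r) else 0 := by
  set Q := q ^ (r : ℕ) with hQ
  set T := t ^ (r : ℕ) with hT
  have hQ0 : Q ≠ 0 := pow_ne_zero _ q_ne_zero
  have hT1 : 1 - T ≠ 0 := by simpa using one_sub_pow_ne_zero 0 r
  set c : ℕ → Kqt := fun i => Q ^ (n - 1 - i) *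
    if i + 1 = n then (r : ℕ) * ((1 - Q) / (1 - T)) else (r : ℕ) with hc
  have h := sum_ratioCoeff (g := factorSeq Q T n) (c := c) (n := n)
    (κ := (r : ℕ) * Q ^ (n - 1) * (1 - Q)) (fun i hi => factorSeq_ne_zero r hi)
    (if_neg (lt_irrefl n)) (fun i hi => ?_) k.isLt l.isLt
  · rw [Finset.sum_range] at h
    simp only [multiWeight_eq]
    refine h.trans ?_
    rw [factorWeight_eq]
    refine if_congr Fin.ext_iff.symm ?_ rfl
    congr 1
    split_ifs with hk
    · rfl
    · have hk' := k.isLt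
      rw [hc]
      simp only
      rw [if_neg (by omega), show n - 1 - ((k : ℕ) - 1) = n - k by omega]
  · obtain ⟨m, rfl⟩ : ∃ m, n = m + i + 1 := ⟨n - 1 - i, by omega⟩
    rw [hc]
    simp only
    rw [show m + i + 1 - 1 - i = m by omega, factorSeq, factorSeq, if_pos hi, Nat.add_sub_cancel,
      pow_add Q m]
    by_cases hm : m = 0
    · subst hm
      rw [if_neg (by omega), if_pos (by omega)]
      field_simp
      ring
    · rw [if_pos (by omega), if_neg (by omega)]
      ring

theorem fock_factorHom (f g : MSym n) :
    multiScalarProduct n q t (factorHom n f) (factorHom n g) = fock factorWeight f g := by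
  classical
  have hinj : ∀ r : ℕ+, Function.Injective fun i : Fin n => (i, r) := fun r i j h => by
    simpa using h
  set d : Fin n → ℕ+ → Fin n → Kqt := fun k r i =>
    factorCoeff (q ^ (r : ℕ)) (t ^ (r : ℕ)) n k i -
      factorCoeff (q ^ (r : ℕ)) (t ^ (r : ℕ)) n k (i + 1) with hd
  -- The coefficients of `p_r[Y_k]` in the diagonal coordinates. They are supported on a single `r`,
  -- so different `r` are orthogonal and each `r` reduces to `sum_factorCoeff`.
  set a : Fin n × ℕ+ → (Fin n × ℕ+ →₀ Kqt) := fun u =>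
    Finsupp.embDomain ⟨_, hinj u.2⟩ (Finsupp.equivFunOnFinite.symm (d u.1 u.2)) with ha
  have hsum : ∀ {M : Type} [AddCommMonoid M] (u : Fin n × ℕ+) (F : Fin n × ℕ+ → Kqt → M),
      (∀ v, F v 0 = 0) → (a u).sum F = ∑ i, F (i, u.2) (d u.1 u.2 i) := by
    intro M _ u F hF
    rw [ha, Finsupp.sum_embDomain, Finsupp.sum_fintype _ _ fun i => hF _]
    rfl
  have ha' : ∀ (u : Fin n × ℕ+) (i : Fin n) (r : ℕ+),
      a u (i, r) = if u.2 = r then d u.1 u.2 i else 0 := by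
    intro u i r
    split_ifs with h
    · subst h
      exact Finsupp.embDomain_apply_self ⟨_, hinj u.2⟩ _ i
    · refine Finsupp.embDomain_of_notMem_range _ _ _ ?_
      rintro ⟨j, hj⟩
      exact h (Prod.ext_iff.1 hj).2
  rw [multiScalarProduct_eq_fock]
  refine fock_linear_change _ _ a ((partialEquiv n).symm.toAlgHom.comp (factorHom n))
    (fun u => ?_) (fun u u' => ?_) f g
  · rw [hsum u (fun v x => x • (MvPolynomial.X v : MSym n)) fun v => zero_smul _ _, AlgHom.comp_apply, factorHom_X]
    exact partialEquiv_symm_adams_factorAlphabet u.1 u.2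
  · rw [hsum u (fun v x => x * (multiWeight n q t v * a u' v)) fun v => zero_mul _]
    simp only [ha']
    by_cases h : u'.2 = u.2
    · simp only [h]
      rw [hd]
      refine (sum_factorCoeff u.1 u'.1 u.2).trans ?_
      refine if_congr ?_ rfl rfl
      rw [Prod.ext_iff, h]
      simp
    · simp only [if_neg h, mul_zero, Finset.sum_const_zero]
      rw [if_neg]
      rintro rfl
      exact h rfl

theorem fock_prod_rename (c : Fin n × ℕ+ → Kqt) (f g : Fin n → Sym) :
    fock c (∏ k, MvPolynomial.rename (Prod.mk k) (f k)) (∏ k, MvPolynomial.rename (Prod.mk k) (g k)) =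
      ∏ k, fock (fun r => c (k, r)) (f k) (g k) := by
  classical
  have hder : ∀ (f : Fin n → Sym) (s : Finset (Fin n)), ∀ k ∉ s, ∀ r : ℕ+, MvPolynomial.pderiv (k, r)
      (∏ k ∈ s, MvPolynomial.rename (Prod.mk k) (f k)) = 0 := by
    intro f s k hk r
    refine MvPolynomial.pderiv_eq_zero_of_notMem_vars fun h => ?_
    obtain ⟨j, hj, h1⟩ := Finset.mem_biUnion.1 (MvPolynomial.vars_prod _ h)
    obtain ⟨r', -, h2⟩ := Finset.mem_image.1 (MvPolynomial.vars_rename _ _ h1)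
    obtain rfl : j = k := (Prod.ext_iff.1 h2).1
    exact hk hj
  have key : ∀ s : Finset (Fin n), fock c (∏ k ∈ s, MvPolynomial.rename (Prod.mk k) (f k))
      (∏ k ∈ s, MvPolynomial.rename (Prod.mk k) (g k)) =
      ∏ k ∈ s, fock (fun r => c (k, r)) (f k) (g k) := by
    intro s
    induction s using Finset.induction_on with
    | empty =>
      rw [Finset.prod_empty, Finset.prod_empty, Finset.prod_empty, ← MvPolynomial.C_1,
        fock_C_left]
      simp
    | insert k s hk ih =>
      rw [Finset.prod_insert hk, Finset.prod_insert hk, Finset.prod_insert hk,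
        fock_rename_mul c (Prod.mk_right_injective k) (hder f s k hk) (hder g s k hk), ih]
      rfl
  exact key Finset.univ

theorem multiScalarProduct_prod_pleth {f g : Fin n → Sym} {d : Fin n → ℕ}
    (hg : ∀ k, MvPolynomial.IsWeightedHomogeneous (fun r : ℕ+ => (r : ℕ)) (g k) (d k)) :
    multiScalarProduct n q t (∏ k, pleth (f k) (factorAlphabet k))
        (∏ k, pleth (g k) (factorAlphabet k)) =
      ∏ k : Fin n, (q ^ (n - 1 - (k : ℕ))) ^ d k *
        scalarProduct (firstParam n k) (secondParam n k) (f k) (g k) := by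
  simp only [← factorHom_rename, ← map_prod]
  rw [fock_factorHom, fock_prod_rename]
  refine Finset.prod_congr rfl fun k _ => ?_
  rw [scalarProduct_eq_fock, ← fock_weight _ _ (hg k)]
  rfl

end

/-! ### Uniqueness of orthogonal triangular families -/

section Uniqueness

variable {I K V W : Type*} [Field K] [AddCommGroup V] [Module K V] [AddCommGroup W] [Module K W]
  {r : I → I → Prop}

/-- Gives injectivity of `toMultiSeries` once a spanning triangular family is known, with no
separate analysis of multi-power sums. -/
theorem injective_of_linearIndependent_comp {f : V →ₗ[K] W} {P : I → V}
    (hspan : Submodule.span K (Set.range P) = ⊤) (h : LinearIndependent K (f ∘ P)) :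
    Function.Injective f := by
  rw [injective_iff_map_eq_zero]
  intro v hv
  have hv1 : v ∈ Submodule.span K (Set.range P) := hspan ▸ Submodule.mem_top
  rw [Finsupp.mem_span_range_iff_exists_finsupp] at hv1
  obtain ⟨l, rfl⟩ := hv1
  have h1 : Finsupp.linearCombination K (f ∘ P) l = 0 := by
    rw [← hv, map_finsuppSum, Finsupp.linearCombination_apply]
    simp
  rw [(linearIndependent_iff.1 h) l h1, Finsupp.sum_zero_index]

theorem sub_mem_span_of_triangular (htrans : ∀ {i j k}, r i j → r j k → r i k)
    (hwf : WellFounded r) {f : V →ₗ[K] W} (hf : Function.Injective f) {M : I → W} {P P' : I → V}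
    (hP : ∀ i, f (P i) - M i ∈ Submodule.span K (M '' {j | r j i}))
    (hP' : ∀ i, f (P' i) - M i ∈ Submodule.span K (M '' {j | r j i})) (i : I) :
    P' i - P i ∈ Submodule.span K (P '' {j | r j i}) := by
  have h1 := span_le_span_of_triangular hwf (M := M) (P := f ∘ P) hP (A := {j | r j i})
    fun _ hj _ hk => htrans hk hj
  have h2 := h1 (Submodule.sub_mem _ (hP' i) (hP i))
  rw [sub_sub_sub_cancel_right, ← map_sub, Set.image_comp, Submodule.span_image] at h2
  obtain ⟨v, hv, hv1⟩ := h2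
  rwa [← hf hv1]

theorem eq_of_triangular_of_orthogonal (htrans : ∀ {i j k}, r i j → r j k → r i k)
    (hirrefl : ∀ i, ¬ r i i) (hwf : WellFounded r) {f : V →ₗ[K] W} (hf : Function.Injective f)
    {M : I → W} {B : V →ₗ[K] V →ₗ[K] K} (hB : ∀ v, (∀ w, B v w = 0) → v = 0) {P P' : I → V}
    (hspan : Submodule.span K (Set.range P) = ⊤)
    (hP : ∀ i, f (P i) - M i ∈ Submodule.span K (M '' {j | r j i}))
    (hP' : ∀ i, f (P' i) - M i ∈ Submodule.span K (M '' {j | r j i}))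
    (horth : ∀ i j, i ≠ j → B (P i) (P j) = 0) (horth' : ∀ i j, i ≠ j → B (P' i) (P' j) = 0) :
    P' = P := by
  funext i
  have hD := sub_mem_span_of_triangular (r := r) htrans hwf hf hP hP' i
  refine sub_eq_zero.1 (hB (P' i - P i) ?_)
  -- For `j` below `i`, `P j` is a combination of `P' k` with `k` equal to or below `j`, all
  -- orthogonal to `P' i`; and `P i` is orthogonal to `P j`. Otherwise the difference is a
  -- combination of members `P k` with `k ≠ j`. Nondegeneracy of `B` then suffices; symmetry is not
  -- needed.
  have key : ∀ j, B (P' i - P i) (P j) = 0 := by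
    intro j
    by_cases hj : r j i
    · have hne : i ≠ j := by
        rintro rfl
        exact hirrefl i hj
      have h1 : Submodule.span K (P' '' {k | r k j}) ≤ LinearMap.ker (B (P' i)) := by
        rw [Submodule.span_le]
        rintro _ ⟨k, hk, rfl⟩
        refine horth' i k ?_
        rintro rfl
        exact hirrefl i (htrans hk hj)
      have h3 := sub_mem_span_of_triangular (r := r) htrans hwf hf hP' hP j
      have h2 : P j - P' j ∈ LinearMap.ker (B (P' i)) := h1 h3
      rw [LinearMap.mem_ker, map_sub, horth' i j hne, sub_zero] at h2
      rw [map_sub, LinearMap.sub_apply, h2, horth i j hne, sub_zero]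
    · have h1 : Submodule.span K (P '' {k | r k i}) ≤ LinearMap.ker (B.flip (P j)) := by
        rw [Submodule.span_le]
        rintro _ ⟨k, hk, rfl⟩
        refine horth k j ?_
        rintro rfl
        exact hj hk
      exact h1 hD
  have htop : (⊤ : Submodule K V) ≤ LinearMap.ker (B (P' i - P i)) := by
    rw [← hspan, Submodule.span_le]
    rintro _ ⟨j, rfl⟩
    exact key j
  exact fun w => htop Submodule.mem_top

end Uniqueness

/-! ### Factorization of the multi-Macdonald polynomials -/

section

variable {n : ℕ}

theorem multiWeight_ne_zero (v : Fin n × ℕ+) : multiWeight n q t v ≠ 0 := by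
  obtain ⟨i, r⟩ := v
  have hr : ((r : ℕ) : Kqt) ≠ 0 := Nat.cast_ne_zero.2 r.ne_zero
  have ht : 1 - t ^ (r : ℕ) ≠ 0 := by simpa using one_sub_pow_ne_zero 0 r
  rw [multiWeight_eq]
  refine mul_ne_zero (pow_ne_zero _ (pow_ne_zero _ q_ne_zero)) ?_
  split_ifs
  · exact mul_ne_zero hr (div_ne_zero (q_pow_ne_one r) ht)
  · exact hr

/-- The scalar product of multi-symmetric functions as a bilinear map. -/
def multiForm (n : ℕ) : MSym n →ₗ[Kqt] MSym n →ₗ[Kqt] Kqt :=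
  (fockForm (multiWeight n q t)).compl₁₂ (partialEquiv n).symm.toLinearMap
    (partialEquiv n).symm.toLinearMap

theorem multiForm_apply (f g : MSym n) : multiForm n f g = multiScalarProduct n q t f g := by
  rw [multiScalarProduct_eq_fock]
  rfl

theorem multiForm_nondegenerate {f : MSym n} (h : ∀ g, multiForm n f g = 0) : f = 0 := by
  have h1 : (partialEquiv n).symm f = 0 := by
    refine fockForm_injective (multiWeight n q t) multiWeight_ne_zero fun g => ?_
    have := h (partialEquiv n g)
    rwa [multiForm_apply, multiScalarProduct_eq_fock, AlgEquiv.symm_apply_apply] at this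
  simpa using h1

theorem linearIndependent_of_multi_triangular {P : (Fin n → YoungDiagram) → MSym n}
    (h : ∀ lam, toMultiSeries (P lam) - multiMonoSeries lam ∈
      Submodule.span Kqt (multiMonoSeries '' {mu | MultiDomLT mu lam})) :
    LinearIndependent Kqt ((toMultiSeries (n := n)).toLinearMap ∘ P) := by
  classical
  refine linearIndependent_of_triangular (r := MultiDomLT) MultiDomLT.trans MultiDomLT.irrefl h
    (fun lam => MvPowerSeries.coeff (multiLead lam)) (fun lam => ?_) fun lam mu hne => ?_
  · rw [coeff_multiMonoSeries, multiType_multiLead, if_pos rfl]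
  · rw [coeff_multiMonoSeries, multiType_multiLead, if_neg hne.symm]

theorem multiMacdonaldP_eq_of_family {P : (Fin n → YoungDiagram) → MSym n}
    (h : IsMultiMacdonaldFamily n q t P) : multiMacdonaldP n q t = P := by
  have hex : ∃ P, IsMultiMacdonaldFamily n q t P := ⟨P, h⟩
  rw [multiMacdonaldP, dif_pos hex]
  have h' := hex.choose_spec
  refine eq_of_triangular_of_orthogonal (r := MultiDomLT) MultiDomLT.trans MultiDomLT.irrefl
    (wellFounded_multiDomLT n) (f := (toMultiSeries (n := n)).toLinearMap)
    (injective_of_linearIndependent_comp h.span_eq_top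
      (linearIndependent_of_multi_triangular h.triangular))
    (B := multiForm n) (fun _ => multiForm_nondegenerate) h.span_eq_top h.triangular h'.triangular
    (fun lam mu hne => ?_) fun lam mu hne => ?_
  · rw [multiForm_apply, h.orthogonal lam mu hne]
  · rw [multiForm_apply, h'.orthogonal lam mu hne]

theorem monomial_multiPartitionEquiv (lam : Fin n → YoungDiagram) :
    MvPolynomial.monomial (multiPartitionEquiv n lam) (1 : Kqt) =
      ∏ k, MvPolynomial.rename (Prod.mk k) (powerSum (lam k)) := by
  classical
  rw [multiPartitionEquiv_eq, MvPolynomial.monomial_sum_one]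
  refine Finset.prod_congr rfl fun k _ => ?_
  rw [monomial_toFinsupp, powerSum, map_multiset_prod, Multiset.map_map, Multiset.map_map]
  simp

theorem span_prod_rename {P : Fin n → YoungDiagram → Sym}
    (h : ∀ k, Submodule.span Kqt (Set.range (P k)) = ⊤) :
    Submodule.span Kqt (Set.range fun lam : Fin n → YoungDiagram =>
      ∏ k, MvPolynomial.rename (Prod.mk k) (P k (lam k))) = ⊤ := by
  classical
  set S : Fin n → Set (MSym n) := fun k =>
    Set.range fun mu => MvPolynomial.rename (Prod.mk k) (P k mu) with hS
  have h1 : ∀ k (f : Sym), MvPolynomial.rename (Prod.mk k) f ∈ Submodule.span Kqt (S k) := by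
    intro k f
    have h2 : f ∈ Submodule.span Kqt (Set.range (P k)) := h k ▸ Submodule.mem_top
    have h3 := Submodule.mem_map_of_mem
      (f := (MvPolynomial.rename (R := Kqt) (Prod.mk k : ℕ+ → Fin n × ℕ+)).toLinearMap) h2
    rwa [← Submodule.span_image, ← Set.range_comp] at h3
  have h2 : ∀ (f : Fin n → Sym) (s : Finset (Fin n)),
      ∏ k ∈ s, MvPolynomial.rename (Prod.mk k) (f k) ∈ ∏ k ∈ s, Submodule.span Kqt (S k) := by
    intro f s
    induction s using Finset.induction_on with
    | empty => exact Submodule.one_le.1 le_rfl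
    | insert k s hk ih =>
      rw [Finset.prod_insert hk, Finset.prod_insert hk]
      exact Submodule.mul_mem_mul (h1 k _) ih
  rw [eq_top_iff, ← ((MvPolynomial.basisMonomials (Fin n × ℕ+) Kqt).reindex
    (multiPartitionEquiv n).symm).span_eq, Submodule.span_le]
  rintro _ ⟨lam, rfl⟩
  rw [Module.Basis.reindex_apply, MvPolynomial.coe_basisMonomials, Equiv.symm_symm]
  beta_reduce
  rw [monomial_multiPartitionEquiv]
  have h3 := h2 (fun k => powerSum (lam k)) Finset.univ
  rw [Submodule.prod_span] at h3
  refine Submodule.span_mono ?_ h3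
  intro g hg
  obtain ⟨x, hx, rfl⟩ := (Set.mem_fintype_prod _ _).1 hg
  choose mu hmu using hx
  exact ⟨mu, Finset.prod_congr rfl fun k _ => hmu k⟩

theorem factorCoeff_self (k : Fin n) : factorCoeff q t n k k = 1 := by
  rw [factorCoeff, ratioCoeff_of_le _ le_rfl, div_self]
  simpa using factorSeq_ne_zero 1 k.isLt

/-- Each `Y_k` is `X_k` plus later alphabets, so the generators are recovered from the last alphabet
downwards. -/
theorem factorHom_surjective (n : ℕ) : Function.Surjective (factorHom n) := by
  rw [← AlgHom.range_eq_top, eq_top_iff, ← MvPolynomial.adjoin_range_X, Algebra.adjoin_le_iff]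
  rintro _ ⟨⟨k, r⟩, rfl⟩
  induction k using WellFoundedGT.induction with
  | ind k ih =>
    have h1 : factorHom n (MvPolynomial.X (k, r)) ∈ (factorHom n).range := ⟨_, rfl⟩
    rw [factorHom_X, adams_factorAlphabet, ← Finset.add_sum_erase _ _ (Finset.mem_univ k),
      ← adamsK_factorCoeff, factorCoeff_self, map_one, one_smul] at h1
    refine (add_mem_cancel_right (Subalgebra.sum_mem _ fun j hj => ?_)).1 h1
    rcases lt_or_gt_of_ne (Finset.ne_of_mem_erase hj) with hlt | hgt
    · rw [factorCoeff, ratioCoeff_of_lt _ (Fin.lt_def.1 hlt), zero_smul]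
      exact Subalgebra.zero_mem _
    · exact Subalgebra.smul_mem _ (ih j hgt) _

theorem isMultiMacdonaldFamily_prod (n : ℕ) : IsMultiMacdonaldFamily n q t fun lam =>
    ∏ k, pleth (macdonaldP (firstParam n k) (secondParam n k) (lam k)) (factorAlphabet k) := by
  have hspec : ∀ k : Fin n, IsMacdonaldFamily (firstParam n k) (secondParam n k)
      (macdonaldP (firstParam n k) (secondParam n k)) := fun k =>
    macdonaldP_spec (genericParams_factor k)
  have htri := fun lam : Fin n → YoungDiagram =>
    triangular_prod_pleth (fun k => (hspec k).triangular (lam k))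
      (w := fun k j => factorCoeff q t n k j) factorCoeff_self
      fun k j hj => ratioCoeff_of_lt _ (Fin.lt_def.1 hj)
  refine ⟨(linearIndependent_of_multi_triangular htri).of_comp _, ?_, htri, ?_⟩
  · have h1 := congrArg (Submodule.map (factorHom n).toLinearMap)
      (span_prod_rename fun k => (hspec k).span_eq_top)
    rw [← Submodule.span_image, ← Set.range_comp, Submodule.map_top,
      LinearMap.range_eq_top.2 (factorHom_surjective n)] at h1
    rw [← h1]
    congr 2
    funext lam
    simp [map_prod, factorHom_rename]
  · intro lam mu hne
    obtain ⟨k, hk⟩ := Function.ne_iff.1 hne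
    rw [multiScalarProduct_prod_pleth fun k =>
      isWeightedHomogeneous_of_triangular ((hspec k).triangular (mu k))]
    refine Finset.prod_eq_zero (Finset.mem_univ k) ?_
    rw [(hspec k).orthogonal _ _ hk, mul_zero]

theorem multiMacdonaldP_eq_prod (lam : Fin n → YoungDiagram) : multiMacdonaldP n q t lam =
    ∏ k, pleth (macdonaldP (firstParam n k) (secondParam n k) (lam k)) (factorAlphabet k) := by
  rw [multiMacdonaldP_eq_of_family (isMultiMacdonaldFamily_prod n)]

end

/-! ### The modified polynomials -/

section

variable {n : ℕ}

theorem adams_alphabetZ (m : ℕ) (r : ℕ+) : adams r (alphabetZ n m) = ∑ j : Fin n,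
    (if (j : ℕ) + 1 + m < n then (q ^ (r : ℕ)) ^ m * t ^ (r : ℕ) else
      (q ^ (r : ℕ)) ^ ((j : ℕ) + 1 + m - n)) • (MvPolynomial.X (j, r) : MSym n) := by
  rw [alphabetZ, adams_combination]
  refine Finset.sum_congr rfl fun j _ => ?_
  split_ifs <;> simp only [map_mul, map_pow, adamsK_q, adamsK_t]

theorem phi_X (i : Fin n) (r : ℕ+) : phi n (MvPolynomial.X (i, r)) =
    if (i : ℕ) + 1 = n then (1 - t ^ (r : ℕ))⁻¹ • ∑ j, MvPolynomial.X (j, r) -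
      ∑ j ∈ Finset.Iio i, MvPolynomial.X (j, r) else MvPolynomial.X (i, r) := by
  have h1 : phi n (MvPolynomial.X (i, r)) = adams r (phiAlphabet i) := MvPolynomial.aeval_X _ _
  rw [h1, phiAlphabet]
  split_ifs
  · rw [map_sub, adams_smul, map_sum, map_sum, map_inv₀, map_sub, map_one, adamsK_t]
    simp only [adams_alphabet]
  · exact adams_alphabet r i

theorem phi_X_eq_add (i : Fin n) (r : ℕ+) : phi n (MvPolynomial.X (i, r)) =
    MvPolynomial.X (i, r) + (if (i : ℕ) + 1 = n then (1 - t ^ (r : ℕ))⁻¹ - 1 else 0) •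
      ∑ j, MvPolynomial.X (j, r) := by
  rw [phi_X]
  split_ifs with h
  · have h1 : (Finset.univ : Finset (Fin n)) = insert i (Finset.Iio i) := by
      ext j
      simp only [Finset.mem_univ, Finset.mem_insert, Finset.mem_Iio, Fin.ext_iff, Fin.lt_def,
        true_iff]
      omega
    rw [sub_smul, one_smul, h1, Finset.sum_insert (by simp)]
    abel
  · rw [zero_smul, add_zero]

/-- By `phi_X_eq_add`, `phi` adds one and the same constant to the coefficients of all alphabets in
`Y_k`. That constant, `Q^m T / (1 - Q^m T)`, cancels the term `-Q^m T` in each numerator with `j ≥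
k` and is the entire coefficient for `j < k`. Here `Q = q^r`, `T = t^r` and `m = n - 1 - k`. -/
theorem phi_adams_factorAlphabet (k : Fin n) (r : ℕ+) : phi n (adams r (factorAlphabet k)) =
    (1 - secondParam n k ^ (r : ℕ))⁻¹ • adams r (alphabetZ n (n - 1 - (k : ℕ))) := by
  have hk := k.isLt
  obtain ⟨m, hm⟩ : ∃ m, n = m + k + 1 := ⟨n - 1 - k, by omega⟩
  have hmk : n - 1 - (k : ℕ) = m := by omega
  have hD := one_sub_pow_ne_zero m r
  have hT : 1 - t ^ (r : ℕ) ≠ 0 := by simpa using one_sub_pow_ne_zero 0 r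
  have hQ : q ^ (r : ℕ) ≠ 0 := pow_ne_zero _ q_ne_zero
  have hs : secondParam n k ^ (r : ℕ) = (q ^ (r : ℕ)) ^ m * t ^ (r : ℕ) := by
    rw [secondParam, hmk, mul_pow, ← pow_mul, mul_comm m, pow_mul]
  rw [hs, hmk, adams_alphabetZ, adams_factorAlphabet, map_sum]
  set Q := q ^ (r : ℕ)
  set T := t ^ (r : ℕ)
  have hseq : factorSeq Q T n k = Q ^ (k : ℕ) * (1 - Q ^ m * T) := by
    rw [factorSeq_of_lt _ _ hk, hmk]
  set i : Fin n := ⟨n - 1, by omega⟩ with hi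
  -- Only the last alphabet is moved by `phi`; the factor `1 - T` of `g_(n-1)` cancels the
  -- denominator introduced there.
  have hlast : factorCoeff Q T n k i * ((1 - T)⁻¹ - 1) = Q ^ m * T / (1 - Q ^ m * T) := by
    rw [factorCoeff, ratioCoeff_of_le _ (show (k : ℕ) ≤ n - 1 by omega), hseq,
      factorSeq_of_lt _ _ i.isLt, hi]
    simp only
    rw [Nat.sub_self, pow_zero, one_mul, show n - 1 = m + k by omega, pow_add]
    field_simp
    ring
  have hsum : ∑ j : Fin n, phi n (factorCoeff Q T n k j • MvPolynomial.X (j, r)) =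
      ∑ j : Fin n, (factorCoeff Q T n k j + Q ^ m * T / (1 - Q ^ m * T)) •
        (MvPolynomial.X (j, r) : MSym n) := by
    simp only [map_smul, phi_X_eq_add, smul_add, Finset.sum_add_distrib, add_smul]
    congr 1
    rw [Finset.sum_eq_single_of_mem i (Finset.mem_univ i), if_pos (by rw [hi]; simp only; omega),
      smul_smul, hlast, Finset.smul_sum]
    intro j _ hj
    rw [if_neg, zero_smul, smul_zero]
    intro h
    exact hj (Fin.ext (by rw [hi]; simp only; omega))
  rw [hsum, Finset.smul_sum]
  refine Finset.sum_congr rfl fun j _ => ?_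
  rw [smul_smul]
  congr 1
  have hj := j.isLt
  split_ifs with h
  · rw [factorCoeff, ratioCoeff_of_lt _ (show (j : ℕ) < k by omega)]
    field_simp
    ring
  · obtain ⟨d, hd⟩ : ∃ d, (j : ℕ) = d + k := ⟨j - k, by omega⟩
    rw [factorCoeff, ratioCoeff_of_le _ (show (k : ℕ) ≤ j by omega), hseq, factorSeq, if_pos hj,
      show (j : ℕ) + 1 + m - n = d by omega, hd, show n - 1 = m + k by omega, pow_add, pow_add]
    field_simp
    ring

theorem phi_pleth (k : Fin n) (f : Sym) : phi n (pleth f (factorAlphabet k)) =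
    pleth (MvPolynomial.aeval (fun r : ℕ+ => (1 - secondParam n k ^ (r : ℕ))⁻¹ •
      (MvPolynomial.X r : Sym)) f) (alphabetZ n (n - 1 - (k : ℕ))) := by
  have : (phi n).comp (MvPolynomial.aeval fun r => adams r (factorAlphabet k)) =
      (MvPolynomial.aeval fun r => adams r (alphabetZ n (n - 1 - (k : ℕ)))).comp
        (MvPolynomial.aeval fun r : ℕ+ => (1 - secondParam n k ^ (r : ℕ))⁻¹ •
          (MvPolynomial.X r : Sym)) := by
    refine MvPolynomial.algHom_ext fun r => ?_
    rw [AlgHom.comp_apply, AlgHom.comp_apply, MvPolynomial.aeval_X, MvPolynomial.aeval_X, map_smul,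
      MvPolynomial.aeval_X, phi_adams_factorAlphabet]
  exact AlgHom.congr_fun this f

end

end

end MultiMacdonald

/-! ### The product formula -/

theorem mainTheorem8 (n : ℕ) (hn : 1 ≤ n) (lam : Fin n → YoungDiagram) :
    MultiMacdonald.multiMacdonaldH n lam =
      ∏ i : Fin n,
        MultiMacdonald.pleth
          (MultiMacdonald.macdonaldH (MultiMacdonald.firstParam n i)
            (MultiMacdonald.secondParam n i) (lam i))
          (MultiMacdonald.alphabetZ n (n - 1 - (i : ℕ))) := by
  open MultiMacdonald in
  -- The normalizing constant is a product of one `cCoeff` per factor, so it is distributed over the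
  -- factors, where each constant turns `P` into `J`.
  rw [multiMacdonaldH, multiMacdonaldJ, map_smul, multiMacdonaldP_eq_prod, map_prod,
    ← Finset.prod_smul]
  refine Finset.prod_congr rfl fun i _ => ?_
  rw [MultiMacdonald.phi_pleth, MultiMacdonald.macdonaldH, MultiMacdonald.macdonaldJ, map_smul]
  exact (map_smul (MvPolynomial.aeval _) _ _).symm
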